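/- **Setting.** Let $\Omega=(0,1)$, let $\langle\cdot,\cdot\rangle$ and $\|\cdot\|$ be the inner product and norm of $L_2(\Omega)$, and let $p\ge 3$ be an integer, $\sigma\ge p+1$, $\lambda\ge 3$, $M$ real numbers. Let $0<\varepsilon\le 1$, let $N$ be a positive integer divisible by $4$, and assume $\sigma\varepsilon\ln N\le \tfrac14$. *Problem.* Let $f\in L_2(\Omega)$ and let $u\in H^4(\Omega)\cap H^2_0(\Omega)$ be the solution of $$\varepsilon^4u^{(4)}+4u=f\ \text{ in }\Omega,\qquad u(\xi)=u'(\xi)=0,\quad \xi\in\{0,1\}.$$ Assume that $u=u_{\mathrm{bl},0}+u_{\mathrm{reg}}+u_{\mathrm{bl},1}$ on $[0,1]$, where the three components are $p+3$ times differentiable on $[0,1]$, satisfy $\varepsilon^4u_{\mathrm{reg}}^{(4)}+4u_{\mathrm{reg}}=f$ and $\varepsilon^4u_{\mathrm{bl},i}^{(4)}+4u_{\mathrm{bl},i}=0$ in $\Omega$ ($i=0,1$), and, for all $x\in[0,1]$ and $\kappa=0,1,\dots,p+3$, $$|u_{\mathrm{reg}}^{(\kappa)}(x)|\le M,\qquad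 |u_{\mathrm{bl},0}^{(\kappa)}(x)|\le M\varepsilon^{-\kappa}e^{-x/\varepsilon},\qquad |u_{\mathrm{bl},1}^{(\kappa)}(x)|\le M\varepsilon^{-\kappa}e^{-(1-x)/\varepsilon}.$$ Put $v=\varepsilon^{3/2}u''$, $u_{\mathrm{bl}}=u_{\mathrm{bl},0}+u_{\mathrm{bl},1}$, $v_{\mathrm{reg}}=\varepsilon^{3/2}u_{\mathrm{reg}}''$, $v_{\mathrm{bl}}=\varepsilon^{3/2}u_{\mathrm{bl}}''$. *Finite element method.* Let $\tau=\min\{\tfrac14,\sigma\varepsilon\ln N\}$ $(=\sigma\varepsilon\ln N)$, and let $0=x_0<\dots<x_N=1$ be the Shishkin mesh that divides $[0,\tau]$ and $[1-\tau,1]$ uniformly into $N/4$ cells each and $[\tau,1-\tau]$ uniformly into $N/2$ cells. Let $V_h$ be the set of pairs $(s,t)\in H^2_0(\Omega)\times H^2(\Omega)$ of $C^1[0,1]$ functions that are polynomials of degree at most $p$ on each cell, and let $$\mathcal B\bigl((u,v),(u_*,v_*)\bigr)=\lambda\langle v-\varepsilon^{3/2}u'',v_*-\varepsilon^{3/2}u_*''\rangle+\langle\varepsilon^{5/2}v''+4u,\varepsilon^{3/2}v_*''+4u_*\rangle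 .$$ Let $(u_h,v_h)\in V_h$ be the solution of $$\mathcal B\bigl((u_h,v_h),(u_*,v_*)\bigr)=\langle f,\varepsilon^{3/2}v_*''+4u_*\rangle\qquad\forall (u_*,v_*)\in V_h .$$ *Special interpolants.* For a cell $J=(a,b)$ let $I_Jw$ be the polynomial of degree at most $p$ with $(I_Jw-w)(a)=(I_Jw-w)'(a)=0$ and $\int_a^b(I_Jw-w)''q\,dx=0$ for all polynomials $q$ of degree at most $p-2$, and let $Iw$ be the function with $Iw=I_Jw$ on each cell $J$. Let $\chi_0,\chi_1$ be the cubic polynomials with $\chi_0(0)=\chi_0'(0)=\chi_0(\tau)=0$, $\chi_0'(\tau)=1$ and $\chi_1(0)=\chi_1'(0)=\chi_1'(\tau)=0$, $\chi_1(\tau)=1$. For $(w,w_{\mathrm{reg}},w_{\mathrm{bl}})=(u,u_{\mathrm{reg}},u_{\mathrm{bl}})$ and $(v,v_{\mathrm{reg}},v_{\mathrm{bl}})$ define $\tilde w=\tilde u$ and $\tilde w=\tilde v$, respectively, by $$\tilde w(x)=\begin{cases}(Iw)(x)-\chi_0(x)w_{\mathrm{bl}}'(\tau)-\chi_1(x)w_{\mathrm{bl}}(\tau),&x\in[0,\tau],\\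 (Iw_{\mathrm{reg}})(x),&x\in[\tau,1-\tau],\\ (Iw)(x)+\chi_0(1-x)w_{\mathrm{bl}}'(1-\tau)-\chi_1(1-x)w_{\mathrm{bl}}(1-\tau),&x\in[1-\tau,1].\end{cases}$$ *Balanced norm.* Let $|||(u,v)|||^2=\|u\|^2+\varepsilon^3\|u''\|^2+\|v\|^2+\varepsilon^4\|v''\|^2$. **Proposition.** There is a constant $C>0$, depending only on $p,\sigma,\lambda,M$ (in particular not on $\varepsilon$ or $N$), such that in the above setting $$|||(\tilde u-u_h,\tilde v-v_h)|||\le C\Bigl\{(\ln N)^{p+1}+|\lambda-4|\min\bigl\{\varepsilon^{3/2}N^2,\varepsilon^{-1/2}\bigr\}\Bigr\}N^{-(p+1)} .$$ -/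

import Mathlib

open Set MeasureTheory Polynomial

namespace ThinShell

noncomputable section

/-! Functions on the closed unit interval are represented by total functions `ℝ → ℝ`; every
notion below depends only on their values on `[0,1]`. -/

/-- The `k`-th derivative on `[0,1]` (one-sided at the two end points). -/
abbrev D (k : ℕ) (w : ℝ → ℝ) : ℝ → ℝ := iteratedDerivWithin k w (Icc 0 1)

/-- `w` possesses derivatives up to order `K` at every point of `[0,1]`. -/
def DiffUpTo (K : ℕ) (w : ℝ → ℝ) : Prop :=
  ∀ k < K, DifferentiableOn ℝ (D k w) (Icc 0 1)

/-! ### Sobolev spaces and the boundary value problem -/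

/-- The space `L_2(0,1)`. -/
def MemL2 (w : ℝ → ℝ) : Prop := MemLp w 2 (volume.restrict (Ioo 0 1))

/-- The Sobolev space `H^2(0,1)`, by means of the continuously differentiable representatives:
`w'` is absolutely continuous on `[0,1]` and `w''`, which exists almost everywhere, is
in `L_2(0,1)`. -/
structure MemH2 (w : ℝ → ℝ) : Prop where
  diff : DifferentiableOn ℝ w (Icc 0 1)
  ac : AbsolutelyContinuousOnInterval (D 1 w) 0 1
  memL2 : MemL2 (D 2 w)

/-- Homogeneous boundary conditions `w(ξ) = w'(ξ) = 0`, `ξ ∈ {0,1}`. -/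
structure Clamped (w : ℝ → ℝ) : Prop where
  value_zero : w 0 = 0
  slope_zero : D 1 w 0 = 0
  value_one : w 1 = 0
  slope_one : D 1 w 1 = 0

/-- The Sobolev space `H^2_0(0,1)`. -/
structure MemH20 (w : ℝ → ℝ) : Prop extends MemH2 w, Clamped w

/-- `u ∈ H^4(0,1) ∩ H^2_0(0,1)` solves `ε^4 u'''' + 4 u = f` in `(0,1)`,
`u(ξ) = u'(ξ) = 0` for `ξ ∈ {0,1}`. -/
structure IsSolution (ε : ℝ) (f u : ℝ → ℝ) : Prop where
  diff : DiffUpTo 3 u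
  ac : AbsolutelyContinuousOnInterval (D 3 u) 0 1
  memL2 : MemL2 (D 4 u)
  ode : ∀ᵐ x ∂(volume.restrict (Ioo (0 : ℝ) 1)), ε ^ 4 * D 4 u x + 4 * u x = f x
  clamped : Clamped u

/-- The decomposition `u = u_bl,0 + u_reg + u_bl,1` on `[0,1]` into a regular component and two
boundary layer components, with derivative bounds up to the order `K` and with the constant `M`. -/
structure IsDecomp (K : ℕ) (M ε : ℝ) (f u ureg ubl₀ ubl₁ : ℝ → ℝ) : Prop where
  sum : ∀ x ∈ Icc (0 : ℝ) 1, u x = ubl₀ x + ureg x + ubl₁ x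
  diff_reg : DiffUpTo K ureg
  diff_bl₀ : DiffUpTo K ubl₀
  diff_bl₁ : DiffUpTo K ubl₁
  bound_reg : ∀ k ≤ K, ∀ x ∈ Icc (0 : ℝ) 1, |D k ureg x| ≤ M
  bound_bl₀ : ∀ k ≤ K, ∀ x ∈ Icc (0 : ℝ) 1,
    |D k ubl₀ x| ≤ M * ((ε ^ k)⁻¹ * Real.exp (-x / ε))
  bound_bl₁ : ∀ k ≤ K, ∀ x ∈ Icc (0 : ℝ) 1,
    |D k ubl₁ x| ≤ M * ((ε ^ k)⁻¹ * Real.exp (-(1 - x) / ε))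
  ode_reg : ∀ᵐ x ∂(volume.restrict (Ioo (0 : ℝ) 1)), ε ^ 4 * D 4 ureg x + 4 * ureg x = f x
  ode_bl₀ : ∀ x ∈ Ioo (0 : ℝ) 1, ε ^ 4 * D 4 ubl₀ x + 4 * ubl₀ x = 0
  ode_bl₁ : ∀ x ∈ Ioo (0 : ℝ) 1, ε ^ 4 * D 4 ubl₁ x + 4 * ubl₁ x = 0

/-! ### Bilinear form, linear functional and balanced norm -/

/-- `B((u,v),(u_*,v_*)) = λ ⟨v - ε^{3/2} u'', v_* - ε^{3/2} u_*''⟩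
  + ⟨ε^{5/2} v'' + 4 u, ε^{3/2} v_*'' + 4 u_*⟩`. -/
def bilin (lam ε : ℝ) (U W : (ℝ → ℝ) × (ℝ → ℝ)) : ℝ :=
  lam * (∫ x in (0 : ℝ)..1, (U.2 x - ε ^ (3 / 2 : ℝ) * D 2 U.1 x) *
      (W.2 x - ε ^ (3 / 2 : ℝ) * D 2 W.1 x)) +
    ∫ x in (0 : ℝ)..1, (ε ^ (5 / 2 : ℝ) * D 2 U.2 x + 4 * U.1 x) *
      (ε ^ (3 / 2 : ℝ) * D 2 W.2 x + 4 * W.1 x)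

/-- `F((u_*,v_*)) = ⟨f, ε^{3/2} v_*'' + 4 u_*⟩`. -/
def load (ε : ℝ) (f : ℝ → ℝ) (W : (ℝ → ℝ) × (ℝ → ℝ)) : ℝ :=
  ∫ x in (0 : ℝ)..1, f x * (ε ^ (3 / 2 : ℝ) * D 2 W.2 x + 4 * W.1 x)

/-- The squared norm of `L_2(0,1)`. -/
def normSq (w : ℝ → ℝ) : ℝ := ∫ x in (0 : ℝ)..1, w x ^ 2

/-- The balanced norm: the square root of
`‖u‖^2 + ε^3 ‖u''‖^2 + ‖v‖^2 + ε^4 ‖v''‖^2`. -/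
def balancedNorm (ε : ℝ) (U : (ℝ → ℝ) × (ℝ → ℝ)) : ℝ :=
  Real.sqrt (normSq U.1 + ε ^ 3 * normSq (D 2 U.1) + normSq U.2 + ε ^ 4 * normSq (D 2 U.2))

/-! ### Shishkin mesh, splines and the finite element method -/

/-- The mesh transition point `τ = min {1/4, σ ε ln N}`. -/
def transition (σ ε : ℝ) (N : ℕ) : ℝ := min (1 / 4) (σ * ε * Real.log N)

/-- The nodes `x_0 < x_1 < ⋯ < x_N` of the mesh with transition point `τ`, for `4 ∣ N`: each of
`[0,τ]` and `[1-τ,1]` is uniformly divided into `N/4` cells and `[τ,1-τ]` into `N/2` cells. -/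
def node (τ : ℝ) (N i : ℕ) : ℝ :=
  if 4 * i ≤ N then i * (4 * τ / N)
  else if 4 * i ≤ 3 * N then τ + (i - N / 4 : ℝ) * (2 * (1 - 2 * τ) / N)
  else 1 - (N - i : ℝ) * (4 * τ / N)

/-- The spline space `S_p^k` for the nodes `x 0 < ⋯ < x N`. -/
structure IsSpline (p k : ℕ) (x : ℕ → ℝ) (N : ℕ) (s : ℝ → ℝ) : Prop where
  contDiff : ContDiffOn ℝ k s (Icc 0 1)
  piecewise : ∀ i < N, ∃ P : ℝ[X], P.natDegree ≤ p ∧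
    ∀ t ∈ Ioo (x i) (x (i + 1)), s t = P.eval t

/-- The finite element space `V_h = (S_p^1)^2 ∩ (H^2_0 × H^2)`. -/
def feSpace (p : ℕ) (x : ℕ → ℝ) (N : ℕ) : Set ((ℝ → ℝ) × (ℝ → ℝ)) :=
  {W | IsSpline p 1 x N W.1 ∧ IsSpline p 1 x N W.2 ∧ MemH20 W.1 ∧ MemH2 W.2}

/-- `U = (u_h, v_h)` is the finite element solution: `U ∈ V_h` and `B(U,W) = F(W)` for
all `W ∈ V_h`. -/
def IsFEMSolution (p : ℕ) (x : ℕ → ℝ) (N : ℕ) (lam ε : ℝ) (f : ℝ → ℝ)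
    (U : (ℝ → ℝ) × (ℝ → ℝ)) : Prop :=
  U ∈ feSpace p x N ∧ ∀ W ∈ feSpace p x N, bilin lam ε U W = load ε f W

/-! ### Local interpolation -/

/-- `P` is the local interpolant of `w` on `(a,b)`: a polynomial of degree at most `p` with
`(P-w)(a) = (P-w)'(a) = 0` and `(P-w)''` orthogonal to all polynomials of degree at
most `p-2`. -/
structure IsLocalInterp (p : ℕ) (a b : ℝ) (w : ℝ → ℝ) (P : ℝ[X]) : Prop where
  degree : P.natDegree ≤ p
  value : P.eval a = w a
  slope : P.derivative.eval a = D 1 w a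
  orth : ∀ q : ℝ[X], q.natDegree + 2 ≤ p →
    ∫ x in a..b, (P.derivative.derivative.eval x - D 2 w x) * q.eval x = 0

lemma intg (w : ℝ → ℝ) {a b : ℝ} (hw : IntervalIntegrable (D 2 w) volume a b) (q : ℝ[X]) :
    IntervalIntegrable (fun x => D 2 w x * q.eval x) volume a b :=
  hw.mul_continuousOn q.continuous.continuousOn

lemma eq_zero_of_integral_sq {a b : ℝ} (hab : a < b) (q : ℝ[X])
    (h : ∫ x in a..b, q.eval x * q.eval x = 0) : q = 0 := by
  have h2 : ∀ x ∈ Icc a b, q.eval x = 0 := by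
    intro x hx
    by_contra hne
    have := intervalIntegral.integral_pos (f := fun x => q.eval x * q.eval x) hab
      (q.continuous.mul q.continuous).continuousOn (fun y _ => mul_self_nonneg _)
      ⟨x, hx, mul_self_pos.2 hne⟩
    linarith
  exact Polynomial.eq_zero_of_infinite_isRoot q
    ((Icc_infinite hab).mono fun x hx => h2 x hx)

lemma exists_antideriv (q : ℝ[X]) : ∃ r : ℝ[X], r.derivative = q := by
  induction q using Polynomial.induction_on' with
  | add p q hp hq =>
    obtain ⟨r, rfl⟩ := hp
    obtain ⟨s, rfl⟩ := hq
    exact ⟨r + s, by simp⟩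
  | monomial n c =>
    refine ⟨monomial (n + 1) (c / (n + 1)), ?_⟩
    rw [derivative_monomial]
    have : (n : ℝ) + 1 ≠ 0 := by positivity
    simp [this]

lemma exists_proj (w : ℝ → ℝ) {a b : ℝ} (hab : a < b)
    (hw : IntervalIntegrable (D 2 w) volume a b) (n : ℕ) :
    ∃ Q ∈ degreeLE ℝ n, ∀ q ∈ degreeLE ℝ n,
      ∫ x in a..b, (Q.eval x - D 2 w x) * q.eval x = 0 := by
  have hc : ∀ r s : ℝ[X], IntervalIntegrable (fun x => r.eval x * s.eval x) volume a b :=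
    fun r s => (r.continuous.mul s.continuous).intervalIntegrable _ _
  let S := degreeLE ℝ n
  have : FiniteDimensional ℝ S := by
    have : S = degreeLT ℝ (n + 1) := by
      ext f; simp only [S, mem_degreeLE, mem_degreeLT]
      rw [Polynomial.degree_lt_iff_coeff_zero, Polynomial.degree_le_iff_coeff_zero]
      refine forall_congr' fun m => ?_
      rw [Nat.cast_lt, Nat.succ_le_iff]
    rw [this]
    exact Module.Finite.equiv (degreeLTEquiv ℝ (n + 1)).symm
  let T : S →ₗ[ℝ] Module.Dual ℝ S := LinearMap.mk₂ ℝ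
    (fun r s => ∫ x in a..b, (r : ℝ[X]).eval x * (s : ℝ[X]).eval x)
    (fun r s t => by
      simp only [Submodule.coe_add, eval_add, add_mul]
      exact intervalIntegral.integral_add (hc _ _) (hc _ _))
    (fun c r s => by
      simp only [Submodule.coe_smul, eval_smul, smul_eq_mul, mul_assoc]
      exact intervalIntegral.integral_const_mul _ _)
    (fun r s t => by
      simp only [Submodule.coe_add, eval_add, mul_add]
      exact intervalIntegral.integral_add (hc _ _) (hc _ _))
    (fun c r s => by
      simp only [Submodule.coe_smul, eval_smul, smul_eq_mul, mul_left_comm _ c]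
      exact intervalIntegral.integral_const_mul _ _)
  have hT : Function.Injective T := by
    rw [injective_iff_map_eq_zero]
    intro r hr
    have : T r r = 0 := by rw [hr]; rfl
    exact Subtype.ext (eq_zero_of_integral_sq hab _ this)
  have hsurj : Function.Surjective T :=
    (LinearMap.injective_iff_surjective_of_finrank_eq_finrank
      (Subspace.dual_finrank_eq).symm).1 hT
  let L : Module.Dual ℝ S :=
    { toFun := fun s => ∫ x in a..b, D 2 w x * (s : ℝ[X]).eval x
      map_add' := fun r s => by
        simp only [Submodule.coe_add, eval_add, mul_add]
        exact intervalIntegral.integral_add (intg w hw _) (intg w hw _)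
      map_smul' := fun c r => by
        simp only [Submodule.coe_smul, eval_smul, smul_eq_mul, mul_left_comm _ c,
          RingHom.id_apply]
        exact intervalIntegral.integral_const_mul _ _ }
  obtain ⟨Q, hQ⟩ := hsurj L
  refine ⟨Q, Q.2, fun q hq => ?_⟩
  have h1 : T Q ⟨q, hq⟩ = L ⟨q, hq⟩ := by rw [hQ]
  simp only [sub_mul]
  rw [intervalIntegral.integral_sub (hc _ _) (intg w hw _)]
  exact sub_eq_zero.2 h1

/-- The local interpolant exists and is unique. -/
theorem existsUnique_localInterp {p : ℕ} (hp : 2 ≤ p) {a b : ℝ} (hab : a < b) (w : ℝ → ℝ)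
    (hw : IntervalIntegrable (D 2 w) volume a b) : ∃! P, IsLocalInterp p a b w P := by
  obtain ⟨n, rfl⟩ := Nat.exists_eq_add_of_le' hp
  have hdeg : ∀ q : ℝ[X], q.natDegree ≤ n ↔ q ∈ degreeLE ℝ n := fun q => by
    rw [mem_degreeLE, natDegree_le_iff_degree_le]
  obtain ⟨Q, hQ, hQo⟩ := exists_proj w hab hw n
  obtain ⟨R, hR⟩ := exists_antideriv Q
  obtain ⟨R', hR'⟩ := exists_antideriv (R + C (D 1 w a - R.eval a))
  have hd2 : ∀ P : ℝ[X], P.natDegree ≤ n + 2 → P.derivative.derivative.natDegree ≤ n :=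
    fun P hP => by
      have h1 := natDegree_derivative_le P
      have h2 := natDegree_derivative_le P.derivative
      omega
  have hR'd : R'.derivative.derivative = Q := by rw [hR']; simp [hR]
  refine ⟨R' + C (w a - R'.eval a), ⟨?_, by simp, by simp [hR'], fun q hq => ?_⟩, ?_⟩
  · rw [natDegree_add_C]
    have h1 : R'.derivative.natDegree = R'.natDegree - 1 := natDegree_derivative R'
    have h2 : R'.derivative.derivative.natDegree = R'.derivative.natDegree - 1 :=
      natDegree_derivative R'.derivative
    rw [hR'd] at h2
    have := (hdeg Q).2 hQ
    omega
  · simp only [derivative_add, derivative_C, add_zero, hR'd]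
    exact hQo q ((hdeg q).1 (by omega))
  · intro P hP
    set P₀ := R' + C (w a - R'.eval a) with hP₀
    have hP₀d : P₀.derivative.derivative = Q := by simp [hP₀, hR'd]
    have h2 : P.derivative.derivative = Q := by
      rw [← sub_eq_zero]
      set E := P.derivative.derivative - Q with hE
      have hEd : E ∈ degreeLE ℝ n :=
        Submodule.sub_mem _ ((hdeg _).1 (hd2 P hP.degree)) hQ
      apply eq_zero_of_integral_sq hab
      have e1 := hP.orth E (by have := (hdeg E).2 hEd; omega)
      have e2 := hQo E hEd
      have i : ∀ r : ℝ[X], IntervalIntegrable (fun x => (r.eval x - D 2 w x) * E.eval x)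
          volume a b := fun r => by
        simp only [sub_mul]
        exact ((r.continuous.mul E.continuous).intervalIntegrable _ _).sub (intg w hw _)
      have e3 := intervalIntegral.integral_sub (i P.derivative.derivative) (i Q)
      rw [e1, e2, sub_zero] at e3
      rw [← e3]
      refine intervalIntegral.integral_congr fun x _ => ?_
      simp only [hE, eval_sub]; ring
    have key : ∀ A B : ℝ[X], A.derivative = B.derivative → A.eval a = B.eval a → A = B := by
      intro A B h1 h2
      have h3 : (A - B).natDegree = 0 := derivative_eq_zero.1 (by simp [h1])
      rw [natDegree_eq_zero] at h3
      obtain ⟨c, hc⟩ := h3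
      have h4 : (A - B).eval a = 0 := by simp [h2]
      rw [← hc, eval_C] at h4
      rw [← sub_eq_zero, ← hc, h4, C_0]
    refine key _ _ (key _ _ (h2.trans hP₀d.symm) ?_) ?_
    · rw [hP.slope]; simp [hP₀, hR']
    · rw [hP.value]; simp [hP₀]

/-- The local interpolant `I_J w`, `J = (a,b)`. -/
def localInterp (p : ℕ) (a b : ℝ) (w : ℝ → ℝ) : ℝ[X] :=
  Classical.epsilon (IsLocalInterp p a b w)

theorem isLocalInterp_localInterp {p : ℕ} (hp : 2 ≤ p) {a b : ℝ} (hab : a < b) (w : ℝ → ℝ)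
    (hw : IntervalIntegrable (D 2 w) volume a b) :
    IsLocalInterp p a b w (localInterp p a b w) :=
  Classical.epsilon_spec (existsUnique_localInterp hp hab w hw).exists

open Classical in
/-- The global interpolant `I w`, which equals `I_J w` on each cell `J` of the mesh: on
`[x_i, x_{i+1})`, and for `i + 1 = N` also at `x_N`, it is the local interpolant
on `(x_i, x_{i+1})`. -/
def interp (p : ℕ) (x : ℕ → ℝ) (N : ℕ) (w : ℝ → ℝ) (t : ℝ) : ℝ :=
  let i := Nat.findGreatest (fun j => x j ≤ t) (N - 1)
  (localInterp p (x i) (x (i + 1)) w).eval t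

/-! ### The special representatives -/

/-- The cubic with `χ₀(0) = χ₀'(0) = χ₀(τ) = 0` and `χ₀'(τ) = 1`. -/
def chi₀ (τ : ℝ) : ℝ[X] := C (1 / τ ^ 2) * X ^ 2 * (X - C τ)

/-- The cubic with `χ₁(0) = χ₁'(0) = χ₁'(τ) = 0` and `χ₁(τ) = 1`. -/
def chi₁ (τ : ℝ) : ℝ[X] := C (1 / τ ^ 3) * X ^ 2 * (C (3 * τ) - C 2 * X)

theorem chi₀_spec {τ : ℝ} (hτ : τ ≠ 0) : (chi₀ τ).natDegree ≤ 3 ∧ (chi₀ τ).eval 0 = 0 ∧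
    (chi₀ τ).derivative.eval 0 = 0 ∧ (chi₀ τ).eval τ = 0 ∧ (chi₀ τ).derivative.eval τ = 1 := by
  refine ⟨?_, ?_, ?_, ?_, ?_⟩
  · unfold chi₀; compute_degree
  all_goals simp [chi₀]
  field_simp

theorem chi₁_spec {τ : ℝ} (hτ : τ ≠ 0) : (chi₁ τ).natDegree ≤ 3 ∧ (chi₁ τ).eval 0 = 0 ∧
    (chi₁ τ).derivative.eval 0 = 0 ∧ (chi₁ τ).derivative.eval τ = 0 ∧ (chi₁ τ).eval τ = 1 := by
  refine ⟨?_, ?_, ?_, ?_, ?_⟩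
  · unfold chi₁; compute_degree
  all_goals simp [chi₁]
  · field_simp; ring
  · field_simp; ring

/-- The common construction of the special representatives of a function
`w = w_reg + w_bl` on the mesh `x` with transition point `τ`: on `[0,τ]`
and `[1-τ,1]` the interpolant of `w`, corrected by cubics, and on `[τ,1-τ]` the interpolant
of `w_reg`. -/
def special (p : ℕ) (x : ℕ → ℝ) (N : ℕ) (τ : ℝ) (w wreg wbl : ℝ → ℝ) (t : ℝ) : ℝ :=
  if t < τ then
    interp p x N w t - (chi₀ τ).eval t * D 1 wbl τ - (chi₁ τ).eval t * wbl τ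
  else if t < 1 - τ then
    interp p x N wreg t
  else
    interp p x N w t + (chi₀ τ).eval (1 - t) * D 1 wbl (1 - τ)
      - (chi₁ τ).eval (1 - t) * wbl (1 - τ)

/-- The function `ε^{3/2} w''`. -/
def scaledSecond (ε : ℝ) (w : ℝ → ℝ) (t : ℝ) : ℝ := ε ^ (3 / 2 : ℝ) * D 2 w t

/-- The special representative `ũ` of `u`, with `u_bl = u_bl,0 + u_bl,1`. -/
def uTilde (p : ℕ) (x : ℕ → ℝ) (N : ℕ) (τ : ℝ) (u ureg ubl₀ ubl₁ : ℝ → ℝ) : ℝ → ℝ :=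
  special p x N τ u ureg (ubl₀ + ubl₁)

/-- The special representative `ṽ` of `v = ε^{3/2} u''`, with `v_reg = ε^{3/2} u_reg''` and
`v_bl = ε^{3/2} (u_bl,0 + u_bl,1)''`. -/
def vTilde (p : ℕ) (x : ℕ → ℝ) (N : ℕ) (τ ε : ℝ) (u ureg ubl₀ ubl₁ : ℝ → ℝ) : ℝ → ℝ :=
  special p x N τ (scaledSecond ε u) (scaledSecond ε ureg) (scaledSecond ε (ubl₀ + ubl₁))

end

end ThinShell

open ThinShell

/-!
For clamped `e`, integration by parts makes the mixed terms `∫ (g'' e - e'' g)` vanish, so that `B`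
is coercive in the balanced norm, and by Galerkin orthogonality it suffices to bound
`B((ũ, ṽ) - (u, v), ·)` on the finite element space. Every cell contributes an interpolation error
and a correction that is cubic on the fine cells and consists of the boundary layers on the coarse
ones. The second derivative of the interpolation error is orthogonal to polynomials of degree at
most `p - 2`, and both of its endpoint jets vanish. Hence, after testing with polynomials, every
second derivative of an interpolation error can be removed; the only term that keeps a second
derivative of the second test function is `(4 - lam) ε^{3/2} ⟨ũ - u, g''⟩`. On the fine cells the
interpolation error is small enough to absorb the factor `ε^{-1/2}` that `‖g''‖` costs; on the
coarse cells one pays the smaller of this factor and the factor `N²` of the inverse inequality,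
which is the origin of the minimum in the rate. The corrections are of the size of the boundary
layers at the transition point, that is, of `exp (-τ / ε) = N^{-σ} ≤ N^{-(p+1)}`.
-/

namespace ThinShell

section IteratedDerivWithin

variable {𝕜 F : Type*} [NontriviallyNormedField 𝕜] [NormedAddCommGroup F] [NormedSpace 𝕜 F]
  {S : Set 𝕜} {K k : ℕ} {w : 𝕜 → F} {d : ℕ → 𝕜 → F}

theorem iteratedDerivWithin_eqOn_of_hasDerivWithinAt (hS : UniqueDiffOn 𝕜 S)
    (hzero : EqOn w (d 0) S)
    (hd : ∀ k < K, ∀ t ∈ S, HasDerivWithinAt (d k) (d (k + 1) t) S t) (hk : k ≤ K) :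
    EqOn (iteratedDerivWithin k w S) (d k) S := by
  induction k with
  | zero => rwa [iteratedDerivWithin_zero]
  | succ k ih =>
    intro t ht
    have hEq := ih (by omega)
    rw [iteratedDerivWithin_succ]
    exact ((hd k hk t ht).congr hEq (hEq ht)).derivWithin (hS t ht)

theorem iteratedDerivWithin_eqOn_eval {U S : Set 𝕜} (hU : IsOpen U) (hUS : U ⊆ S) {s : 𝕜 → 𝕜}
    {P : 𝕜[X]} (h : EqOn s (fun t => P.eval t) U) (k : ℕ) :
    EqOn (iteratedDerivWithin k s S) (fun t => (derivative^[k] P).eval t) U := by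
  induction k with
  | zero => rwa [iteratedDerivWithin_zero]
  | succ k ih =>
    intro t ht
    have hUt : U ∈ nhds t := hU.mem_nhds ht
    rw [iteratedDerivWithin_succ, derivWithin_of_mem_nhds (Filter.mem_of_superset hUt hUS),
      (Filter.eventuallyEq_of_mem hUt ih).deriv_eq, Polynomial.deriv,
      Function.iterate_succ_apply']

end IteratedDerivWithin

section DiffUpTo

variable {K k : ℕ} {v w : ℝ → ℝ} {S : Set ℝ} {t : ℝ}

theorem D_zero (w : ℝ → ℝ) : D 0 w = w := iteratedDerivWithin_zero

theorem D_succ (k : ℕ) (w : ℝ → ℝ) : D (k + 1) w = derivWithin (D k w) (Icc 0 1) :=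
  iteratedDerivWithin_succ

theorem D_eq_of_hasDerivWithinAt {d : ℕ → ℝ → ℝ} (hzero : EqOn w (d 0) (Icc 0 1))
    (hd : ∀ k < K, ∀ t ∈ Icc (0 : ℝ) 1, HasDerivWithinAt (d k) (d (k + 1) t) (Icc 0 1) t)
    (hk : k ≤ K) (ht : t ∈ Icc (0 : ℝ) 1) : D k w t = d k t :=
  iteratedDerivWithin_eqOn_of_hasDerivWithinAt (uniqueDiffOn_Icc zero_lt_one) hzero hd hk ht

theorem D_congr (h : EqOn w v (Icc 0 1)) (k : ℕ) (ht : t ∈ Icc (0 : ℝ) 1) : D k w t = D k v t :=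
  iteratedDerivWithin_congr h ht

theorem diffUpTo_of_hasDerivWithinAt {d : ℕ → ℝ → ℝ} (hzero : EqOn w (d 0) (Icc 0 1))
    (hd : ∀ k < K, ∀ t ∈ Icc (0 : ℝ) 1, HasDerivWithinAt (d k) (d (k + 1) t) (Icc 0 1) t) :
    DiffUpTo K w := fun k hk t ht =>
  have hEq : EqOn (D k w) (d k) (Icc 0 1) := fun _ => D_eq_of_hasDerivWithinAt hzero hd hk.le
  ((hd k hk t ht).congr hEq (hEq ht)).differentiableWithinAt

namespace DiffUpTo

theorem hasDerivWithinAt (h : DiffUpTo K w) (hk : k < K) (hS : S ⊆ Icc 0 1) (ht : t ∈ S) :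
    HasDerivWithinAt (D k w) (D (k + 1) w t) S t := by
  rw [D_succ]
  exact (h k hk t (hS ht)).hasDerivWithinAt.mono hS

theorem continuousOn (h : DiffUpTo K w) (hk : k < K) (hS : S ⊆ Icc 0 1) :
    ContinuousOn (D k w) S :=
  (h k hk).continuousOn.mono hS

theorem mono {K' : ℕ} (h : DiffUpTo K w) (hK : K' ≤ K) : DiffUpTo K' w :=
  fun k hk => h k (hk.trans_le hK)

theorem congr (hv : DiffUpTo K v) (h : EqOn w v (Icc 0 1)) : DiffUpTo K w := fun k hk =>
  (hv k hk).congr fun _ => D_congr h k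

end DiffUpTo

theorem DiffUpTo.hasDerivWithinAt_D_add (hv : DiffUpTo K v) (hw : DiffUpTo K w) :
    ∀ k < K, ∀ t ∈ Icc (0 : ℝ) 1,
      HasDerivWithinAt (D k v + D k w) ((D (k + 1) v + D (k + 1) w) t) (Icc 0 1) t :=
  fun _ hk _ ht =>
    (hv.hasDerivWithinAt hk Subset.rfl ht).add (hw.hasDerivWithinAt hk Subset.rfl ht)

theorem DiffUpTo.add (hv : DiffUpTo K v) (hw : DiffUpTo K w) : DiffUpTo K (v + w) :=
  diffUpTo_of_hasDerivWithinAt (d := fun k => D k v + D k w) (fun t _ => by simp)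
    (hv.hasDerivWithinAt_D_add hw)

theorem D_add (hv : DiffUpTo K v) (hw : DiffUpTo K w) (hk : k ≤ K) (ht : t ∈ Icc (0 : ℝ) 1) :
    D k (v + w) t = D k v t + D k w t :=
  D_eq_of_hasDerivWithinAt (d := fun k => D k v + D k w) (fun t _ => by simp)
    (hv.hasDerivWithinAt_D_add hw) hk ht

theorem DiffUpTo.hasDerivWithinAt_mul_D_add_two (hw : DiffUpTo (K + 2) w) (c : ℝ) :
    ∀ k < K, ∀ t ∈ Icc (0 : ℝ) 1,
      HasDerivWithinAt (fun t => c * D (k + 2) w t) (c * D (k + 1 + 2) w t) (Icc 0 1) t :=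
  fun k hk t ht => by
    rw [show k + 1 + 2 = k + 2 + 1 by ring]
    exact (hw.hasDerivWithinAt (by omega) Subset.rfl ht).const_mul c

theorem DiffUpTo.scaledSecond (hw : DiffUpTo (K + 2) w) (ε : ℝ) :
    DiffUpTo K (scaledSecond ε w) :=
  diffUpTo_of_hasDerivWithinAt (fun _ _ => rfl) (hw.hasDerivWithinAt_mul_D_add_two _)

theorem D_scaledSecond (hw : DiffUpTo (K + 2) w) (ε : ℝ) (hk : k ≤ K) (ht : t ∈ Icc (0 : ℝ) 1) :
    D k (ThinShell.scaledSecond ε w) t = ε ^ (3 / 2 : ℝ) * D (k + 2) w t :=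
  D_eq_of_hasDerivWithinAt (fun _ _ => rfl) (hw.hasDerivWithinAt_mul_D_add_two _) hk ht

end DiffUpTo

/-! ### Meshes and splines -/

/-- A mesh `0 = x 0 < ⋯ < x N = 1` of the unit interval; the values of `x` beyond `N` are
irrelevant. -/
structure IsMesh (x : ℕ → ℝ) (N : ℕ) : Prop where
  first : x 0 = 0
  last : x N = 1
  lt : ∀ i < N, x i < x (i + 1)

namespace IsMesh

variable {x : ℕ → ℝ} {N i : ℕ}

theorem monotoneOn (hx : IsMesh x N) : MonotoneOn x (Iic N) :=
  monotoneOn_of_le_add_one ordConnected_Iic fun i _ _ hi => (hx.lt i hi).le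

theorem mono {j : ℕ} (hx : IsMesh x N) (hij : i ≤ j) (hj : j ≤ N) : x i ≤ x j :=
  hx.monotoneOn (hij.trans hj) hj hij

theorem nonneg (hx : IsMesh x N) (hi : i ≤ N) : 0 ≤ x i :=
  hx.first ▸ hx.mono (Nat.zero_le i) hi

theorem le_one (hx : IsMesh x N) (hi : i ≤ N) : x i ≤ 1 :=
  hx.last ▸ hx.mono hi le_rfl

theorem cell_subset (hx : IsMesh x N) (hi : i < N) : Icc (x i) (x (i + 1)) ⊆ Icc 0 1 :=
  Icc_subset_Icc (hx.nonneg hi.le) (hx.le_one hi)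

theorem openCell_subset (hx : IsMesh x N) (hi : i < N) : Ioo (x i) (x (i + 1)) ⊆ Icc 0 1 :=
  Ioo_subset_Icc_self.trans (hx.cell_subset hi)

theorem exists_mem_Ico (hx : IsMesh x N) {t : ℝ} (ht : t ∈ Ico (0 : ℝ) 1) :
    ∃ i < N, t ∈ Ico (x i) (x (i + 1)) := by
  classical
  have hex : ∃ k, t < x k := ⟨N, hx.last ▸ ht.2⟩
  have hle : Nat.find hex ≤ N := Nat.find_min' hex (hx.last ▸ ht.2)
  have hne : Nat.find hex ≠ 0 := fun h0 => by
    have hlt := Nat.find_spec hex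
    rw [h0, hx.first] at hlt
    exact hlt.not_ge ht.1
  obtain ⟨j, hj⟩ := Nat.exists_eq_succ_of_ne_zero hne
  exact ⟨j, by omega, not_lt.1 (Nat.find_min hex (by omega)),
    by simpa only [hj] using Nat.find_spec hex⟩

theorem Icc_succ_eq_union (hx : IsMesh x N) (hi : i < N) :
    Icc (x 0) (x (i + 1)) = Icc (x 0) (x i) ∪ Icc (x i) (x (i + 1)) :=
  (Icc_union_Icc_eq_Icc (hx.mono (Nat.zero_le i) hi.le) (hx.lt i hi).le).symm

theorem continuousOn_of_cells (hx : IsMesh x N) {g : ℝ → ℝ}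
    (h : ∀ i < N, ContinuousOn g (Icc (x i) (x (i + 1)))) : ContinuousOn g (Icc 0 1) := by
  suffices hglue : ∀ k ≤ N, ContinuousOn g (Icc (x 0) (x k)) by
    simpa only [hx.first, hx.last] using hglue N le_rfl
  intro k hk
  induction k with
  | zero => rw [Icc_self]; exact continuousOn_singleton _ _
  | succ k ih =>
    rw [hx.Icc_succ_eq_union hk]
    exact (ih (by omega)).union_of_isClosed (h k hk) isClosed_Icc isClosed_Icc

theorem hasDerivWithinAt_of_cells (hx : IsMesh x N) {g g' : ℝ → ℝ}
    (h : ∀ i < N, ∀ t ∈ Icc (x i) (x (i + 1)),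
      HasDerivWithinAt g (g' t) (Icc (x i) (x (i + 1))) t) (t : ℝ) :
    HasDerivWithinAt g (g' t) (Icc 0 1) t := by
  suffices hglue : ∀ k ≤ N, HasDerivWithinAt g (g' t) (Icc (x 0) (x k)) t by
    simpa only [hx.first, hx.last] using hglue N le_rfl
  intro k hk
  induction k with
  | zero => rw [Icc_self]; exact HasFDerivWithinAt.of_finite (finite_singleton _)
  | succ k ih =>
    rw [hx.Icc_succ_eq_union hk]
    refine (ih (by omega)).union ?_
    by_cases htk : t ∈ Icc (x k) (x (k + 1))
    · exact h k hk t htk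
    · exact HasFDerivWithinAt.of_notMem_closure (by rwa [isClosed_Icc.closure_eq])

theorem exists_glue (hx : IsMesh x N) (G : ℕ → ℝ → ℝ)
    (hG : ∀ i, i + 1 < N → G i (x (i + 1)) = G (i + 1) (x (i + 1))) :
    ∃ g : ℝ → ℝ, ∀ i < N, EqOn g (G i) (Icc (x i) (x (i + 1))) := by
  suffices hglue : ∀ k ≤ N, ∃ g : ℝ → ℝ, ∀ i < k, EqOn g (G i) (Icc (x i) (x (i + 1))) from
    hglue N le_rfl
  intro k hk
  induction k with
  | zero => exact ⟨0, by simp⟩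
  | succ k ih =>
    obtain ⟨g, hg⟩ := ih (by omega)
    refine ⟨fun t => if t ≤ x k ∧ 0 < k then g t else G k t, fun i hi t ht => ?_⟩
    rcases Nat.lt_succ_iff_lt_or_eq.1 hi with hik | rfl
    · have htk : t ≤ x k := ht.2.trans (hx.mono hik (by omega))
      simpa [htk, Nat.zero_lt_of_lt hik] using hg i hik ht
    · dsimp only
      split_ifs with hti
      · obtain ⟨j, rfl⟩ := Nat.exists_eq_succ_of_ne_zero hti.2.ne'
        obtain rfl : t = x (j + 1) := le_antisymm hti.1 ht.1
        rw [hg j (by omega) ⟨(hx.lt j (by omega)).le, le_rfl⟩]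
        exact hG j (by omega)
      · rfl

variable {g : ℝ → ℝ} {G : ℕ → ℝ → ℝ}

theorem intervalIntegrable_cell (hx : IsMesh x N) (hi : i < N)
    {G : ℝ → ℝ} (hG : ContinuousOn G (Icc (x i) (x (i + 1))))
    (h : EqOn g G (Ioo (x i) (x (i + 1)))) :
    IntervalIntegrable g volume (x i) (x (i + 1)) := by
  have hle := (hx.lt i hi).le
  refine (hG.intervalIntegrable_of_Icc hle).congr_uIoo ?_
  rw [uIoo_of_le hle]
  exact h.symm

theorem intervalIntegrable_of_cells (hx : IsMesh x N)
    (hG : ∀ i < N, ContinuousOn (G i) (Icc (x i) (x (i + 1))))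
    (h : ∀ i < N, EqOn g (G i) (Ioo (x i) (x (i + 1)))) : IntervalIntegrable g volume 0 1 := by
  have := IntervalIntegrable.trans_iterate (a := x) fun i hi =>
    hx.intervalIntegrable_cell hi (hG i hi) (h i hi)
  rwa [hx.first, hx.last] at this

theorem integral_eq_sum (hx : IsMesh x N)
    (hG : ∀ i < N, ContinuousOn (G i) (Icc (x i) (x (i + 1))))
    (h : ∀ i < N, EqOn g (G i) (Ioo (x i) (x (i + 1)))) :
    ∫ t in (0 : ℝ)..1, g t = ∑ i ∈ Finset.range N, ∫ t in x i..x (i + 1), G i t := by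
  have := intervalIntegral.sum_integral_adjacent_intervals (a := x) fun i hi =>
    hx.intervalIntegrable_cell hi (hG i hi) (h i hi)
  rw [hx.first, hx.last] at this
  rw [← this]
  refine Finset.sum_congr rfl fun i hi => intervalIntegral.integral_congr_uIoo ?_
  rw [uIoo_of_le (hx.lt i (Finset.mem_range.1 hi)).le]
  exact h i (Finset.mem_range.1 hi)

end IsMesh

/-- `s` is the continuously differentiable piecewise polynomial that equals `P i` on the `i`-th
cell. At the nodes the second derivative is left unspecified. -/
structure HasPieces (x : ℕ → ℝ) (N : ℕ) (s : ℝ → ℝ) (P : ℕ → ℝ[X]) : Prop where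
  value : ∀ i < N, EqOn s (fun t => (P i).eval t) (Icc (x i) (x (i + 1)))
  slope : ∀ i < N, EqOn (D 1 s) (fun t => (P i).derivative.eval t) (Icc (x i) (x (i + 1)))
  second : ∀ i < N,
    EqOn (D 2 s) (fun t => (P i).derivative.derivative.eval t) (Ioo (x i) (x (i + 1)))

section Splines

variable {p N : ℕ} {x : ℕ → ℝ} {s : ℝ → ℝ} {P : ℕ → ℝ[X]}

theorem IsSpline.continuousOn_slope (hs : IsSpline p 1 x N s) : ContinuousOn (D 1 s) (Icc 0 1) :=
  hs.contDiff.continuousOn_iteratedDerivWithin le_rfl (uniqueDiffOn_Icc zero_lt_one)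

theorem IsSpline.hasPieces (hx : IsMesh x N) (hs : IsSpline p 1 x N s)
    (hP : ∀ i < N, EqOn s (fun t => (P i).eval t) (Ioo (x i) (x (i + 1)))) :
    HasPieces x N s P := by
  have hD (k : ℕ) (i : ℕ) (hi : i < N) := iteratedDerivWithin_eqOn_eval isOpen_Ioo
    (hx.openCell_subset hi) (hP i hi) k
  have extend {g : ℝ → ℝ} {Q : ℝ[X]} {i : ℕ} (hi : i < N) (hg : ContinuousOn g (Icc 0 1))
      (h : EqOn g (fun t => Q.eval t) (Ioo (x i) (x (i + 1)))) :
      EqOn g (fun t => Q.eval t) (Icc (x i) (x (i + 1))) :=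
    h.of_subset_closure (hg.mono (hx.cell_subset hi)) Q.continuous.continuousOn
      Ioo_subset_Icc_self (closure_Ioo (hx.lt i hi).ne).ge
  exact ⟨fun i hi => extend hi hs.contDiff.continuousOn (hP i hi),
    fun i hi => extend hi hs.continuousOn_slope (hD 1 i hi), hD 2⟩

theorem IsSpline.exists_hasPieces (hx : IsMesh x N) (hs : IsSpline p 1 x N s) :
    ∃ P : ℕ → ℝ[X], (∀ i, (P i).natDegree ≤ p) ∧ HasPieces x N s P := by
  have hpieces : ∀ i, ∃ P : ℝ[X], P.natDegree ≤ p ∧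
      (i < N → ∀ t ∈ Ioo (x i) (x (i + 1)), s t = P.eval t) := fun i => by
    by_cases hi : i < N
    · obtain ⟨P, hdeg, hP⟩ := hs.piecewise i hi
      exact ⟨P, hdeg, fun _ => hP⟩
    · exact ⟨0, by simp, fun h => absurd h hi⟩
  choose P hdeg hP using hpieces
  exact ⟨P, hdeg, hs.hasPieces hx hP⟩

theorem HasPieces.intervalIntegrable_second (hx : IsMesh x N) (hP : HasPieces x N s P) :
    IntervalIntegrable (D 2 s) volume 0 1 :=
  hx.intervalIntegrable_of_cells (fun i _ => (P i).derivative.derivative.continuous.continuousOn)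
    hP.second

theorem HasPieces.memL2_second (hx : IsMesh x N) (hP : HasPieces x N s P) : MemL2 (D 2 s) := by
  have hmeas : AEStronglyMeasurable (D 2 s) (volume.restrict (Ioo 0 1)) :=
    ((intervalIntegrable_iff_integrableOn_Ioo_of_le zero_le_one).1
      (hP.intervalIntegrable_second hx)).aestronglyMeasurable
  refine (memLp_two_iff_integrable_sq hmeas).2 <|
    (intervalIntegrable_iff_integrableOn_Ioo_of_le zero_le_one).1 <|
    hx.intervalIntegrable_of_cells (G := fun i t => (P i).derivative.derivative.eval t ^ 2)
      (fun i _ => ((P i).derivative.derivative.continuous.pow 2).continuousOn)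
      fun i hi t ht => ?_
  rw [hP.second i hi ht]

theorem HasPieces.integral_second (hx : IsMesh x N) (hP : HasPieces x N s P)
    (hs : ContinuousOn (D 1 s) (Icc 0 1)) {t : ℝ} (ht : t ∈ Icc (0 : ℝ) 1) :
    ∫ r in (0 : ℝ)..t, D 2 s r = D 1 s t - D 1 s 0 := by
  refine integral_eq_of_hasDerivAt_off_countable_of_le (D 1 s) (D 2 s) ht.1
    ((finite_Iic N).image x).countable (hs.mono (Icc_subset_Icc_right ht.2)) (fun r hr => ?_)
    ((hP.intervalIntegrable_second hx).mono_set ?_)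
  · obtain ⟨i, hi, hir⟩ := hx.exists_mem_Ico ⟨hr.1.1.le, hr.1.2.trans_le ht.2⟩
    have hne : x i ≠ r := fun h => hr.2 ⟨i, hi.le, h⟩
    have hr' : r ∈ Ioo (x i) (x (i + 1)) := ⟨lt_of_le_of_ne hir.1 hne, hir.2⟩
    rw [hP.second i hi hr']
    exact ((P i).derivative.hasDerivAt r).congr_of_eventuallyEq <|
      Filter.eventuallyEq_of_mem (isOpen_Ioo.mem_nhds hr')
        ((hP.slope i hi).mono Ioo_subset_Icc_self)
  · rw [uIcc_of_le ht.1, uIcc_of_le zero_le_one]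
    exact Icc_subset_Icc_right ht.2

theorem absolutelyContinuousOnInterval_congr {X : Type*} [PseudoMetricSpace X] {f g : ℝ → X}
    {a b : ℝ} (hf : AbsolutelyContinuousOnInterval f a b) (h : EqOn g f (uIcc a b)) :
    AbsolutelyContinuousOnInterval g a b := by
  rw [absolutelyContinuousOnInterval_iff] at hf ⊢
  intro η hη
  obtain ⟨δ, hδ, hf⟩ := hf η hη
  refine ⟨δ, hδ, fun E hE hEδ => (Finset.sum_congr rfl fun i hi => ?_).trans_lt (hf E hE hEδ)⟩
  rw [h (hE.1 i hi).1, h (hE.1 i hi).2]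

theorem IsSpline.memH2 (hx : IsMesh x N) (hs : IsSpline p 1 x N s) : MemH2 s := by
  obtain ⟨P, -, hP⟩ := hs.exists_hasPieces hx
  refine ⟨hs.contDiff.differentiableOn (by simp), ?_, hP.memL2_second hx⟩
  have hprim : AbsolutelyContinuousOnInterval (fun t => ∫ r in (0 : ℝ)..t, D 2 s r) 0 1 :=
    (hP.intervalIntegrable_second hx).absolutelyContinuousOnInterval_intervalIntegral
      left_mem_uIcc
  have hconst : AbsolutelyContinuousOnInterval (fun _ => D 1 s 0) 0 1 :=
    ContDiffOn.absolutelyContinuousOnInterval contDiffOn_const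
  refine absolutelyContinuousOnInterval_congr (hprim.add hconst) fun t ht => ?_
  rw [uIcc_of_le zero_le_one] at ht
  rw [Pi.add_apply, hP.integral_second hx hs.continuousOn_slope ht, sub_add_cancel]

theorem isSpline_of_pieces (hx : IsMesh x N) (hdeg : ∀ i < N, (P i).natDegree ≤ p)
    (hs : ∀ i < N, EqOn s (fun t => (P i).eval t) (Icc (x i) (x (i + 1))))
    (hslope : ∀ i, i + 1 < N →
      (P i).derivative.eval (x (i + 1)) = (P (i + 1)).derivative.eval (x (i + 1))) :
    IsSpline p 1 x N s := by
  refine ⟨?_, fun i hi => ⟨P i, hdeg i hi, fun t ht => hs i hi (Ioo_subset_Icc_self ht)⟩⟩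
  obtain ⟨s', hs'⟩ := hx.exists_glue (fun i t => (P i).derivative.eval t) hslope
  have hderiv (t : ℝ) : HasDerivWithinAt s (s' t) (Icc 0 1) t :=
    hx.hasDerivWithinAt_of_cells (fun i hi t ht => by
      rw [hs' i hi ht]
      exact ((P i).hasDerivAt t).hasDerivWithinAt.congr (hs i hi) (hs i hi ht)) t
  have hcont : ContinuousOn s' (Icc 0 1) := hx.continuousOn_of_cells fun i hi =>
    (P i).derivative.continuous.continuousOn.congr (hs' i hi)
  have hunique : UniqueDiffOn ℝ (Icc (0 : ℝ) 1) := uniqueDiffOn_Icc zero_lt_one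
  exact (contDiffOn_one_iff_derivWithin hunique).2
    ⟨fun t _ => (hderiv t).differentiableWithinAt,
      hcont.congr fun t ht => (hderiv t).derivWithin (hunique t ht)⟩

theorem IsSpline.sub {k : ℕ} {t : ℝ → ℝ} (hs : IsSpline p k x N s) (ht : IsSpline p k x N t) :
    IsSpline p k x N (s - t) := by
  refine ⟨hs.contDiff.sub ht.contDiff, fun i hi => ?_⟩
  obtain ⟨P, hPdeg, hP⟩ := hs.piecewise i hi
  obtain ⟨Q, hQdeg, hQ⟩ := ht.piecewise i hi
  exact ⟨P - Q, (natDegree_sub_le _ _).trans (max_le hPdeg hQdeg), fun r hr => by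
    simp [hP r hr, hQ r hr]⟩

end Splines

/-! ### Local interpolation -/

section Calculus

variable {a b : ℝ} {g g₁ g₂ F F₁ F₂ : ℝ → ℝ}

theorem sq_integral_le_mul_integral_sq (hab : a ≤ b) (hg : ContinuousOn g (Icc a b)) :
    (∫ t in a..b, g t) ^ 2 ≤ (b - a) * ∫ t in a..b, g t ^ 2 := by
  rcases hab.eq_or_lt with rfl | hlt
  · simp
  have hg1 := hg.intervalIntegrable_of_Icc (μ := volume) hab
  have hg2 : IntervalIntegrable (fun t => g t ^ 2) volume a b :=
    (hg.pow 2).intervalIntegrable_of_Icc hab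
  set L := ∫ t in a..b, g t
  have hexpand : ∫ t in a..b, ((b - a) * g t - L) ^ 2 =
      (b - a) * ((b - a) * (∫ t in a..b, g t ^ 2) - L ^ 2) := by
    calc ∫ t in a..b, ((b - a) * g t - L) ^ 2
        = ∫ t in a..b, ((b - a) ^ 2 * g t ^ 2 - 2 * (b - a) * L * g t + L ^ 2) := by
          congr 1; ext t; ring
      _ = (b - a) ^ 2 * (∫ t in a..b, g t ^ 2) - 2 * (b - a) * L * L + (b - a) * L ^ 2 := by
          rw [intervalIntegral.integral_add ((hg2.const_mul _).sub (hg1.const_mul _)) (by simp),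
            intervalIntegral.integral_sub (hg2.const_mul _) (hg1.const_mul _),
            intervalIntegral.integral_const_mul, intervalIntegral.integral_const_mul,
            intervalIntegral.integral_const, smul_eq_mul]
      _ = _ := by ring
  have hnonneg : 0 ≤ ∫ t in a..b, ((b - a) * g t - L) ^ 2 :=
    intervalIntegral.integral_nonneg hab fun _ _ => sq_nonneg _
  rw [hexpand] at hnonneg
  exact sub_nonneg.1 (nonneg_of_mul_nonneg_right hnonneg (sub_pos.2 hlt))

theorem sq_sub_le_mul_integral_sq_of_hasDerivWithinAt
    (hg : ∀ t ∈ Icc a b, HasDerivWithinAt g (g₁ t) (Icc a b) t)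
    (hg₁ : ContinuousOn g₁ (Icc a b)) {t : ℝ} (ht : t ∈ Icc a b) :
    (g t - g a) ^ 2 ≤ (b - a) * ∫ r in a..b, g₁ r ^ 2 := by
  have hsub : Icc a t ⊆ Icc a b := Icc_subset_Icc_right ht.2
  have hab : a ≤ b := ht.1.trans ht.2
  have hFTC : ∫ r in a..t, g₁ r = g t - g a :=
    intervalIntegral.integral_eq_sub_of_hasDerivAt_of_le ht.1
      (fun r hr => (hg r (hsub hr)).continuousWithinAt.mono hsub)
      (fun r hr => (hg r (hsub (Ioo_subset_Icc_self hr))).hasDerivAt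
        (Icc_mem_nhds hr.1 (hr.2.trans_le ht.2)))
      ((hg₁.mono hsub).intervalIntegrable_of_Icc ht.1)
  calc (g t - g a) ^ 2
      ≤ (t - a) * ∫ r in a..t, g₁ r ^ 2 :=
        hFTC ▸ sq_integral_le_mul_integral_sq ht.1 (hg₁.mono hsub)
    _ ≤ (b - a) * ∫ r in a..b, g₁ r ^ 2 := by
        refine mul_le_mul (sub_le_sub_right ht.2 a) ?_
          (intervalIntegral.integral_nonneg ht.1 fun _ _ => sq_nonneg _) (sub_nonneg.2 hab)
        exact intervalIntegral.integral_mono_interval le_rfl ht.1 ht.2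
          (Filter.Eventually.of_forall fun _ => sq_nonneg _)
          ((hg₁.pow 2).intervalIntegrable_of_Icc hab)

theorem integral_second_mul_eq (hab : a ≤ b)
    (hg : ∀ t ∈ Icc a b, HasDerivWithinAt g (g₁ t) (Icc a b) t)
    (hg₁ : ∀ t ∈ Icc a b, HasDerivWithinAt g₁ (g₂ t) (Icc a b) t)
    (hg₂ : ContinuousOn g₂ (Icc a b))
    (hF : ∀ t ∈ Icc a b, HasDerivWithinAt F (F₁ t) (Icc a b) t)
    (hF₁ : ∀ t ∈ Icc a b, HasDerivWithinAt F₁ (F₂ t) (Icc a b) t)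
    (hF₂ : ContinuousOn F₂ (Icc a b)) :
    ∫ t in a..b, g₂ t * F t =
      (g₁ b * F b - g b * F₁ b) - (g₁ a * F a - g a * F₁ a) + ∫ t in a..b, g t * F₂ t := by
  have cg₁ := (HasDerivWithinAt.continuousOn hg₁).intervalIntegrable_of_Icc (μ := volume) hab
  have cF₁ := (HasDerivWithinAt.continuousOn hF₁).intervalIntegrable_of_Icc (μ := volume) hab
  have cg₂ := hg₂.intervalIntegrable_of_Icc (μ := volume) hab
  have cF₂ := hF₂.intervalIntegrable_of_Icc (μ := volume) hab
  rw [← uIcc_of_le hab] at hg hg₁ hF hF₁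
  have h₁ := intervalIntegral.integral_mul_deriv_eq_deriv_mul_of_hasDerivWithinAt hF hg₁ cF₁ cg₂
  have h₂ := intervalIntegral.integral_mul_deriv_eq_deriv_mul_of_hasDerivWithinAt hg hF₁ cg₁ cF₂
  simp only [mul_comm (F _), mul_comm (F₁ _)] at h₁
  linarith

end Calculus

section Interpolation

variable {K k p : ℕ} {a b t : ℝ} {S : Set ℝ} {w : ℝ → ℝ} {P : ℝ[X]}

theorem DiffUpTo.hasDerivWithinAt_eval_sub (hw : DiffUpTo K w) (P : ℝ[X]) (hk : k < K)
    (hS : S ⊆ Icc 0 1) (ht : t ∈ S) :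
    HasDerivWithinAt (fun t => P.eval t - D k w t) (P.derivative.eval t - D (k + 1) w t) S t :=
  (P.hasDerivAt t).hasDerivWithinAt.sub (hw.hasDerivWithinAt hk hS ht)

theorem DiffUpTo.continuousOn_eval_sub (hw : DiffUpTo K w) (P : ℝ[X]) (hk : k < K)
    (hS : S ⊆ Icc 0 1) : ContinuousOn (fun t => P.eval t - D k w t) S :=
  P.continuous.continuousOn.sub (hw.continuousOn hk hS)

/-- Mathlib's Taylor estimates need a continuous derivative of the highest order, which is not
available here. -/
theorem DiffUpTo.exists_polynomial_abs_sub_le (hw : DiffUpTo K w) {B : ℝ} (hab : a ≤ b)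
    (hsub : Icc a b ⊆ Icc 0 1) (n : ℕ) : ∀ j, j + n + 1 ≤ K →
      (∀ t ∈ Icc a b, |D (j + n + 1) w t| ≤ B) →
      ∃ T : ℝ[X], T.natDegree ≤ n ∧
        ∀ t ∈ Icc a b, |T.eval t - D j w t| ≤ B * (b - a) ^ (n + 1) := by
  have ha : a ∈ Icc a b := left_mem_Icc.2 hab
  have mean_value {j : ℕ} (hj : j < K) (R : ℝ[X]) {C : ℝ}
      (hC : ∀ t ∈ Icc a b, |R.derivative.eval t - D (j + 1) w t| ≤ C) (t : ℝ) (ht : t ∈ Icc a b) :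
      |(R + Polynomial.C (D j w a - R.eval a)).eval t - D j w t| ≤ C * (b - a) := by
    have hmv := (convex_Icc a b).norm_image_sub_le_of_norm_hasDerivWithin_le
      (fun t ht => hw.hasDerivWithinAt_eval_sub R hj hsub ht) hC ha ht
    rw [Real.norm_eq_abs, Real.norm_eq_abs, abs_of_nonneg (sub_nonneg.2 ht.1)] at hmv
    have hC0 : 0 ≤ C := (abs_nonneg _).trans (hC a ha)
    calc |(R + Polynomial.C (D j w a - R.eval a)).eval t - D j w t|
        = |R.eval t - D j w t - (R.eval a - D j w a)| := by
          rw [eval_add, eval_C]; ring_nf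
      _ ≤ C * (b - a) := hmv.trans (by gcongr; exact ht.2)
  induction n with
  | zero =>
    intro j hj hB
    exact ⟨0 + Polynomial.C (D j w a - eval a 0), by simp, by
      simpa only [zero_add, pow_one] using mean_value hj 0 (by simpa using hB)⟩
  | succ n ih =>
    intro j hj hB
    rw [show j + (n + 1) + 1 = j + 1 + n + 1 by ring] at hj hB
    obtain ⟨T, hTdeg, hT⟩ := ih (j + 1) hj hB
    obtain ⟨R, rfl⟩ := exists_antideriv T
    refine ⟨R + Polynomial.C (D j w a - R.eval a), ?_, fun t ht => ?_⟩
    · rw [natDegree_add_C]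
      have := natDegree_derivative R
      omega
    · rw [pow_succ, ← mul_assoc]
      exact mean_value (by omega) R hT t ht

theorem DiffUpTo.isLocalInterp (hw : DiffUpTo 3 w) (hp : 2 ≤ p) (hab : a < b)
    (hsub : Icc a b ⊆ Icc 0 1) : IsLocalInterp p a b w (localInterp p a b w) :=
  isLocalInterp_localInterp hp hab w
    ((hw.continuousOn (by norm_num) hsub).intervalIntegrable_of_Icc hab.le)

theorem DiffUpTo.integral_eval_sub_second_mul (hw : DiffUpTo 3 w) (hab : a ≤ b)
    (hsub : Icc a b ⊆ Icc 0 1) (P F : ℝ[X]) :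
    ∫ t in a..b, (P.derivative.derivative.eval t - D 2 w t) * F.eval t =
      ((P.derivative.eval b - D 1 w b) * F.eval b - (P.eval b - w b) * F.derivative.eval b) -
        ((P.derivative.eval a - D 1 w a) * F.eval a - (P.eval a - w a) * F.derivative.eval a) +
      ∫ t in a..b, (P.eval t - w t) * F.derivative.derivative.eval t := by
  have hF (F : ℝ[X]) : ∀ t ∈ Icc a b,
      HasDerivWithinAt (fun t => F.eval t) (F.derivative.eval t) (Icc a b) t :=
    fun t _ => (F.hasDerivAt t).hasDerivWithinAt
  have hE := integral_second_mul_eq hab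
    (fun t ht => hw.hasDerivWithinAt_eval_sub P (k := 0) (by norm_num) hsub ht)
    (fun t ht => hw.hasDerivWithinAt_eval_sub P.derivative (k := 1) (by norm_num) hsub ht)
    (hw.continuousOn_eval_sub P.derivative.derivative (by norm_num) hsub)
    (hF F) (hF F.derivative) F.derivative.derivative.continuous.continuousOn
  simpa only [D_zero] using hE

namespace IsLocalInterp

theorem value_and_slope_right (hP : IsLocalInterp p a b w P) (hp : 3 ≤ p) (hw : DiffUpTo 3 w)
    (hab : a ≤ b) (hsub : Icc a b ⊆ Icc 0 1) :
    P.eval b = w b ∧ P.derivative.eval b = D 1 w b := by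
  have hslope := hw.integral_eval_sub_second_mul hab hsub P 1
  have hvalue := hw.integral_eval_sub_second_mul hab hsub P X
  rw [hP.orth 1 (by simp; omega)] at hslope
  rw [hP.orth X (by simp; omega)] at hvalue
  simp only [hP.value, hP.slope, eval_one, eval_X, derivative_one, derivative_X,
    derivative_zero, eval_zero,
    sub_self, mul_zero, mul_one, zero_mul, sub_zero, add_zero,
    intervalIntegral.integral_zero] at hslope hvalue
  rw [← hslope] at hvalue
  constructor <;> linarith

theorem integral_second_mul (hP : IsLocalInterp p a b w P) (hp : 3 ≤ p) (hw : DiffUpTo 3 w)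
    (hab : a ≤ b) (hsub : Icc a b ⊆ Icc 0 1) (F : ℝ[X]) :
    ∫ t in a..b, (P.derivative.derivative.eval t - D 2 w t) * F.eval t =
      ∫ t in a..b, (P.eval t - w t) * F.derivative.derivative.eval t := by
  obtain ⟨hvalue, hslope⟩ := hP.value_and_slope_right hp hw hab hsub
  rw [hw.integral_eval_sub_second_mul hab hsub, hP.value, hP.slope, hvalue, hslope]
  ring

theorem integral_sq_second_sub_le (hP : IsLocalInterp p a b w P) (hw : DiffUpTo 3 w)
    (hab : a ≤ b) (hsub : Icc a b ⊆ Icc 0 1) {T : ℝ[X]} (hT : T.natDegree + 2 ≤ p) :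
    ∫ t in a..b, (P.derivative.derivative.eval t - D 2 w t) ^ 2 ≤
      ∫ t in a..b, (T.eval t - D 2 w t) ^ 2 := by
  have hE (Q : ℝ[X]) : ContinuousOn (fun t => Q.eval t - D 2 w t) (Icc a b) :=
    hw.continuousOn_eval_sub Q (by norm_num) hsub
  set Q := P.derivative.derivative
  have hQdeg : (Q - T).natDegree + 2 ≤ p := by
    have h₁ : Q.natDegree = _ := natDegree_derivative P.derivative
    have h₂ := natDegree_derivative P
    have h₃ := natDegree_sub_le Q T
    have h₄ := hP.degree
    omega
  have hsq : IntervalIntegrable (fun t => (T.eval t - D 2 w t) ^ 2) volume a b :=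
    ((hE T).pow 2).intervalIntegrable_of_Icc hab
  have hmul : IntervalIntegrable (fun t => 2 * ((Q.eval t - D 2 w t) * (Q - T).eval t))
      volume a b :=
    (((hE Q).mul (Q - T).continuous.continuousOn).const_mul 2).intervalIntegrable_of_Icc hab
  calc ∫ t in a..b, (Q.eval t - D 2 w t) ^ 2
      ≤ ∫ t in a..b,
          ((T.eval t - D 2 w t) ^ 2 + 2 * ((Q.eval t - D 2 w t) * (Q - T).eval t)) := by
        refine intervalIntegral.integral_mono_on hab
          (((hE Q).pow 2).intervalIntegrable_of_Icc hab) (hsq.add hmul) fun t _ => ?_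
        rw [eval_sub]
        nlinarith [sq_nonneg (Q.eval t - T.eval t)]
    _ = ∫ t in a..b, (T.eval t - D 2 w t) ^ 2 := by
        rw [intervalIntegral.integral_add hsq hmul, intervalIntegral.integral_const_mul,
          hP.orth _ hQdeg, mul_zero, add_zero]

theorem abs_sub_le (hP : IsLocalInterp p a b w P) (hp : 2 ≤ p)
    (hw : DiffUpTo (p + 1) w) (hsub : Icc a b ⊆ Icc 0 1) {B : ℝ}
    (hB : ∀ t ∈ Icc a b, |D (p + 1) w t| ≤ B) (ht : t ∈ Icc a b) :
    |P.eval t - w t| ≤ B * (b - a) ^ (p + 1) := by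
  obtain ⟨q, rfl⟩ := Nat.exists_eq_add_of_le' hp
  have hw3 : DiffUpTo 3 w := hw.mono (by omega)
  have hab : a ≤ b := ht.1.trans ht.2
  have hB0 : 0 ≤ B := (abs_nonneg _).trans (hB t ht)
  have : 0 ≤ b - a := sub_nonneg.2 hab
  obtain ⟨T, hTdeg, hT⟩ := hw.exists_polynomial_abs_sub_le hab hsub q 2 (by omega) (by
    rwa [show 2 + q + 1 = q + 2 + 1 by ring])
  set δ := B * (b - a) ^ (q + 1)
  have hsecond : ∫ t in a..b, (P.derivative.derivative.eval t - D 2 w t) ^ 2 ≤ δ ^ 2 * (b - a) := by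
    calc _ ≤ ∫ t in a..b, (T.eval t - D 2 w t) ^ 2 :=
          hP.integral_sq_second_sub_le hw3 hab hsub (by omega)
      _ ≤ ∫ _ in a..b, δ ^ 2 := by
          refine intervalIntegral.integral_mono_on hab
            (((hw3.continuousOn_eval_sub T (by norm_num) hsub).pow 2).intervalIntegrable_of_Icc
              hab) intervalIntegrable_const fun r hr => ?_
          exact sq_le_sq' (abs_le.1 (hT r hr)).1 (abs_le.1 (hT r hr)).2
      _ = δ ^ 2 * (b - a) := by rw [intervalIntegral.integral_const, smul_eq_mul, mul_comm]
  have hslope (r : ℝ) (hr : r ∈ Icc a b) : |P.derivative.eval r - D 1 w r| ≤ δ * (b - a) := by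
    have hsq := sq_sub_le_mul_integral_sq_of_hasDerivWithinAt
      (fun t ht => hw3.hasDerivWithinAt_eval_sub P.derivative (k := 1) (by norm_num) hsub ht)
      (hw3.continuousOn_eval_sub P.derivative.derivative (by norm_num) hsub) hr
    rw [hP.slope, sub_self, sub_zero] at hsq
    refine abs_le_of_sq_le_sq ?_ (by positivity)
    calc _ ≤ _ := hsq
      _ ≤ (b - a) * (δ ^ 2 * (b - a)) := by gcongr
      _ = _ := by ring
  have hvalue := (convex_Icc a b).norm_image_sub_le_of_norm_hasDerivWithin_le
    (f := fun t => P.eval t - D 0 w t)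
    (fun t ht => hw3.hasDerivWithinAt_eval_sub P (by norm_num) hsub ht) hslope
    (left_mem_Icc.2 hab) ht
  simp only [D_zero, hP.value, sub_self, sub_zero, Real.norm_eq_abs,
    abs_of_nonneg (sub_nonneg.2 ht.1)] at hvalue
  calc |P.eval t - w t| ≤ δ * (b - a) * (t - a) := hvalue
    _ ≤ δ * (b - a) * (b - a) := by gcongr; exact ht.2
    _ = B * (b - a) ^ (q + 2 + 1) := by ring

end IsLocalInterp

end Interpolation

/-! ### An inverse inequality -/

theorem exists_norm_le_mul_norm_of_injective {V E F : Type*} [AddCommGroup V] [Module ℝ V]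
    [FiniteDimensional ℝ V] [NormedAddCommGroup E] [NormedSpace ℝ E] [NormedAddCommGroup F]
    [NormedSpace ℝ F] (f : V →ₗ[ℝ] E) (hf : Function.Injective f) (g : V →ₗ[ℝ] F) :
    ∃ K : ℝ, 0 < K ∧ ∀ v, ‖g v‖ ≤ K * ‖f v‖ := by
  let e := LinearEquiv.ofInjective f hf
  let G := LinearMap.toContinuousLinearMap (g ∘ₗ e.symm.toLinearMap)
  refine ⟨‖G‖ + 1, by positivity, fun v => ?_⟩
  calc ‖g v‖ = ‖G (e v)‖ := by simp [G]
    _ ≤ ‖G‖ * ‖f v‖ := G.le_opNorm (e v)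
    _ ≤ (‖G‖ + 1) * ‖f v‖ := by gcongr; exact le_add_of_nonneg_right zero_le_one

/-- The class of a polynomial in `L²` of the unit interval. -/
noncomputable def polynomialToLp : ℝ[X] →ₗ[ℝ] Lp ℝ 2 (volume : Measure unitInterval) :=
  (ContinuousMap.toLp 2 volume ℝ).toLinearMap ∘ₗ (toContinuousMapOnAlgHom unitInterval).toLinearMap

theorem norm_polynomialToLp_sq (F : ℝ[X]) :
    ‖polynomialToLp F‖ ^ 2 = ∫ t in (0 : ℝ)..1, F.eval t ^ 2 := by
  have hinner := ContinuousMap.inner_toLp (𝕜 := ℝ) (volume : Measure unitInterval)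
    (toContinuousMapOnAlgHom unitInterval F) (toContinuousMapOnAlgHom unitInterval F)
  rw [intervalIntegral.integral_of_le zero_le_one, ← integral_Icc_eq_integral_Ioc,
    ← integral_subtype_comap measurableSet_Icc, ← real_inner_self_eq_norm_sq]
  refine hinner.trans (integral_congr_ae (Filter.Eventually.of_forall fun t => ?_))
  simp [sq]

theorem injective_polynomialToLp : Function.Injective polynomialToLp := by
  refine (injective_iff_map_eq_zero _).2 fun F hF => eq_zero_of_integral_sq zero_lt_one F ?_
  simpa [hF, sq] using (norm_polynomialToLp_sq F).symm

theorem exists_inverse_inequality_unitInterval (p : ℕ) :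
    ∃ K : ℝ, 0 < K ∧ ∀ F : ℝ[X], F.natDegree ≤ p →
      ∫ t in (0 : ℝ)..1, F.derivative.derivative.eval t ^ 2 ≤
        K * ∫ t in (0 : ℝ)..1, F.eval t ^ 2 := by
  have : FiniteDimensional ℝ (degreeLT ℝ (p + 1)) :=
    Module.Finite.equiv (degreeLTEquiv ℝ (p + 1)).symm
  let V := degreeLT ℝ (p + 1)
  obtain ⟨K, hK, hbound⟩ := exists_norm_le_mul_norm_of_injective
    (polynomialToLp ∘ₗ V.subtype) (injective_polynomialToLp.comp V.injective_subtype)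
    (polynomialToLp ∘ₗ derivative ∘ₗ derivative ∘ₗ V.subtype)
  refine ⟨K ^ 2, pow_pos hK 2, fun F hF => ?_⟩
  have hFV : F ∈ V := mem_degreeLT.2 <|
    (natDegree_le_iff_degree_le.1 hF).trans_lt (by exact_mod_cast p.lt_succ_self)
  rw [← norm_polynomialToLp_sq, ← norm_polynomialToLp_sq, ← mul_pow]
  exact pow_le_pow_left₀ (norm_nonneg _) (hbound ⟨F, hFV⟩) 2

theorem exists_inverse_inequality (p : ℕ) :
    ∃ K : ℝ, 0 < K ∧ ∀ F : ℝ[X], F.natDegree ≤ p → ∀ a b : ℝ, a < b →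
      (b - a) ^ 4 * ∫ t in a..b, F.derivative.derivative.eval t ^ 2 ≤
        K * ∫ t in a..b, F.eval t ^ 2 := by
  obtain ⟨K, hK, hunit⟩ := exists_inverse_inequality_unitInterval p
  refine ⟨K, hK, fun F hF a b hab => ?_⟩
  have hlen : 0 < b - a := sub_pos.2 hab
  have hscale (G : ℝ[X]) : ∫ t in (0 : ℝ)..1, G.eval (a + (b - a) * t) ^ 2 =
      (b - a)⁻¹ * ∫ t in a..b, G.eval t ^ 2 := by
    rw [intervalIntegral.integral_comp_add_mul (fun t => G.eval t ^ 2) hlen.ne']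
    simp
  have hdeg : (C a + C (b - a) * X : ℝ[X]).natDegree ≤ 1 := by compute_degree
  have hFunit := hunit (F.comp (C a + C (b - a) * X)) (natDegree_comp_le.trans (by nlinarith))
  simp only [derivative_comp, derivative_add, derivative_C, derivative_mul, derivative_X, eval_mul,
    eval_comp, eval_add, eval_C, eval_X, zero_mul, zero_add, mul_one, mul_pow,
    intervalIntegral.integral_const_mul, hscale] at hFunit
  refine le_of_mul_le_mul_left ?_ (inv_pos.2 hlen)
  linarith

/-! ### Powers of `ε` -/

section Powers

variable {ε : ℝ}

theorem rpow_natCast_div_two (hε : 0 ≤ ε) (n : ℕ) : ε ^ ((n : ℝ) / 2) = Real.sqrt ε ^ n := by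
  rw [Real.sqrt_eq_rpow, ← Real.rpow_natCast, ← Real.rpow_mul hε, one_div_mul_eq_div]

theorem rpow_three_halves (hε : 0 ≤ ε) : ε ^ (3 / 2 : ℝ) = Real.sqrt ε ^ 3 := by
  simpa using rpow_natCast_div_two hε 3

theorem rpow_five_halves (hε : 0 ≤ ε) : ε ^ (5 / 2 : ℝ) = Real.sqrt ε ^ 5 := by
  simpa using rpow_natCast_div_two hε 5

theorem rpow_neg_half (hε : 0 ≤ ε) : ε ^ (-(1 / 2) : ℝ) = (Real.sqrt ε)⁻¹ := by
  rw [Real.rpow_neg hε, Real.sqrt_eq_rpow]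

end Powers

/-! ### Cellwise densities and coercivity -/

/-- The integrand of the squared balanced norm of the pair `(E, F)` on one cell. -/
noncomputable def energyDensity (ε : ℝ) (E F : ℝ[X]) (t : ℝ) : ℝ :=
  E.eval t ^ 2 + ε ^ 3 * E.derivative.derivative.eval t ^ 2 + F.eval t ^ 2
    + ε ^ 4 * F.derivative.derivative.eval t ^ 2

/-- The integrand of `B((P, Q), (E, F))` on one cell. -/
noncomputable def bilinDensity (lam ε : ℝ) (P Q E F : ℝ[X]) (t : ℝ) : ℝ :=
  lam * ((Q.eval t - ε ^ (3 / 2 : ℝ) * P.derivative.derivative.eval t) *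
      (F.eval t - ε ^ (3 / 2 : ℝ) * E.derivative.derivative.eval t)) +
    (ε ^ (5 / 2 : ℝ) * Q.derivative.derivative.eval t + 4 * P.eval t) *
      (ε ^ (3 / 2 : ℝ) * F.derivative.derivative.eval t + 4 * E.eval t)

theorem continuous_energyDensity (ε : ℝ) (E F : ℝ[X]) : Continuous (energyDensity ε E F) := by
  unfold energyDensity; fun_prop

theorem continuous_bilinDensity (lam ε : ℝ) (P Q E F : ℝ[X]) :
    Continuous (bilinDensity lam ε P Q E F) := by
  unfold bilinDensity; fun_prop

section Pieces

variable {x : ℕ → ℝ} {N : ℕ} {P Q E F : ℕ → ℝ[X]} {s t eu ev : ℝ → ℝ}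

theorem HasPieces.normSq_eq_sum (hx : IsMesh x N) (hP : HasPieces x N s P) :
    normSq s = ∑ i ∈ Finset.range N, ∫ t in x i..x (i + 1), (P i).eval t ^ 2 :=
  hx.integral_eq_sum (fun _ _ => by fun_prop)
    fun i hi t ht => by rw [hP.value i hi (Ioo_subset_Icc_self ht)]

theorem HasPieces.normSq_second_eq_sum (hx : IsMesh x N) (hP : HasPieces x N s P) :
    normSq (D 2 s) = ∑ i ∈ Finset.range N,
      ∫ t in x i..x (i + 1), (P i).derivative.derivative.eval t ^ 2 :=
  hx.integral_eq_sum (fun _ _ => by fun_prop) fun i hi t ht => by rw [hP.second i hi ht]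

theorem integral_energyDensity (ε a b : ℝ) (E F : ℝ[X]) :
    ∫ t in a..b, energyDensity ε E F t =
      (∫ t in a..b, E.eval t ^ 2) + ε ^ 3 * (∫ t in a..b, E.derivative.derivative.eval t ^ 2)
        + (∫ t in a..b, F.eval t ^ 2)
        + ε ^ 4 * ∫ t in a..b, F.derivative.derivative.eval t ^ 2 := by
  have hint {g : ℝ → ℝ} (hg : Continuous g) : IntervalIntegrable g volume a b :=
    hg.intervalIntegrable _ _
  unfold energyDensity
  rw [intervalIntegral.integral_add (hint (by fun_prop)) (hint (by fun_prop)),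
    intervalIntegral.integral_add (hint (by fun_prop)) (hint (by fun_prop)),
    intervalIntegral.integral_add (hint (by fun_prop)) (hint (by fun_prop)),
    intervalIntegral.integral_const_mul, intervalIntegral.integral_const_mul]

theorem balancedNorm_eq_sqrt_sum (hx : IsMesh x N) (ε : ℝ) (hE : HasPieces x N eu E)
    (hF : HasPieces x N ev F) :
    balancedNorm ε (eu, ev) = Real.sqrt
      (∑ i ∈ Finset.range N, ∫ t in x i..x (i + 1), energyDensity ε (E i) (F i) t) := by
  rw [balancedNorm, hE.normSq_eq_sum hx, hE.normSq_second_eq_sum hx, hF.normSq_eq_sum hx,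
    hF.normSq_second_eq_sum hx]
  simp only [integral_energyDensity, Finset.sum_add_distrib, Finset.mul_sum]

theorem bilin_eq_sum (hx : IsMesh x N) (lam ε : ℝ) (hP : HasPieces x N s P)
    (hQ : HasPieces x N t Q) (hE : HasPieces x N eu E) (hF : HasPieces x N ev F) :
    bilin lam ε (s, t) (eu, ev) = ∑ i ∈ Finset.range N,
      ∫ r in x i..x (i + 1), bilinDensity lam ε (P i) (Q i) (E i) (F i) r := by
  have hflux := hx.integral_eq_sum
    (g := fun r => (t r - ε ^ (3 / 2 : ℝ) * D 2 s r) * (ev r - ε ^ (3 / 2 : ℝ) * D 2 eu r))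
    (G := fun i r => ((Q i).eval r - ε ^ (3 / 2 : ℝ) * (P i).derivative.derivative.eval r) *
      ((F i).eval r - ε ^ (3 / 2 : ℝ) * (E i).derivative.derivative.eval r))
    (fun i _ => by fun_prop) fun i hi r hr => by
      simp only [hP.second i hi hr, hE.second i hi hr, hQ.value i hi (Ioo_subset_Icc_self hr),
        hF.value i hi (Ioo_subset_Icc_self hr)]
  have hode := hx.integral_eq_sum
    (g := fun r => (ε ^ (5 / 2 : ℝ) * D 2 t r + 4 * s r) *
      (ε ^ (3 / 2 : ℝ) * D 2 ev r + 4 * eu r))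
    (G := fun i r => (ε ^ (5 / 2 : ℝ) * (Q i).derivative.derivative.eval r + 4 * (P i).eval r) *
      (ε ^ (3 / 2 : ℝ) * (F i).derivative.derivative.eval r + 4 * (E i).eval r))
    (fun i _ => by fun_prop) fun i hi r hr => by
      simp only [hQ.second i hi hr, hF.second i hi hr, hP.value i hi (Ioo_subset_Icc_self hr),
        hE.value i hi (Ioo_subset_Icc_self hr)]
  rw [bilin, hflux, hode, Finset.mul_sum, ← Finset.sum_add_distrib]
  refine Finset.sum_congr rfl fun i _ => ?_
  rw [← intervalIntegral.integral_const_mul, ← intervalIntegral.integral_add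
    (Continuous.intervalIntegrable (by fun_prop) _ _)
    (Continuous.intervalIntegrable (by fun_prop) _ _)]
  rfl

theorem sum_integral_second_mul_sub_eq_zero (hx : IsMesh x N) (hE : HasPieces x N eu E)
    (hF : HasPieces x N ev F) (hcl : Clamped eu) :
    ∑ i ∈ Finset.range N, ∫ t in x i..x (i + 1),
      ((F i).derivative.derivative.eval t * (E i).eval t
        - (E i).derivative.derivative.eval t * (F i).eval t) = 0 := by
  let G : ℝ → ℝ := fun t => D 1 ev t * eu t - ev t * D 1 eu t
  have hcell (i : ℕ) (hi : i ∈ Finset.range N) : ∫ t in x i..x (i + 1),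
      ((F i).derivative.derivative.eval t * (E i).eval t
        - (E i).derivative.derivative.eval t * (F i).eval t) = G (x (i + 1)) - G (x i) := by
    rw [Finset.mem_range] at hi
    have hlt := hx.lt i hi
    have hleft := left_mem_Icc.2 hlt.le
    have hright := right_mem_Icc.2 hlt.le
    have hderiv (R : ℝ[X]) (t : ℝ) (_ : t ∈ Icc (x i) (x (i + 1))) :=
      (R.hasDerivAt t).hasDerivWithinAt (s := Icc (x i) (x (i + 1)))
    rw [intervalIntegral.integral_sub (Continuous.intervalIntegrable (by fun_prop) _ _)
      (Continuous.intervalIntegrable (by fun_prop) _ _),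
      integral_second_mul_eq hlt.le (hderiv _) (hderiv _) (Polynomial.continuous _).continuousOn
        (hderiv _) (hderiv _) (Polynomial.continuous _).continuousOn]
    simp only [G, hE.value i hi hleft, hE.value i hi hright, hE.slope i hi hleft,
      hE.slope i hi hright, hF.value i hi hleft, hF.value i hi hright, hF.slope i hi hleft,
      hF.slope i hi hright, mul_comm (eval _ (F i))]
    ring
  rw [Finset.sum_congr rfl hcell, Finset.sum_range_sub (fun i => G (x i)), hx.first, hx.last]
  simp only [G, hcl.value_zero, hcl.slope_zero, hcl.value_one, hcl.slope_one]
  ring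

/-- The last term is an exact derivative, whose sum over the cells vanishes for clamped
functions; without it the cross terms of `bilinDensity` have no sign. -/
theorem energyDensity_le_bilinDensity_sub {lam ε : ℝ} (hlam : 3 ≤ lam) (hε : 0 ≤ ε) (hε1 : ε ≤ 1)
    (E F : ℝ[X]) (t : ℝ) :
    energyDensity ε E F t ≤ bilinDensity lam ε E F E F t
      - 4 * (ε ^ (5 / 2 : ℝ) + ε ^ (3 / 2 : ℝ)) * (F.derivative.derivative.eval t * E.eval t
        - E.derivative.derivative.eval t * F.eval t) := by
  rw [energyDensity, bilinDensity, rpow_three_halves hε, rpow_five_halves hε]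
  obtain ⟨r, hr0, rfl⟩ : ∃ r : ℝ, 0 ≤ r ∧ ε = r ^ 2 :=
    ⟨Real.sqrt ε, Real.sqrt_nonneg ε, (Real.sq_sqrt hε).symm⟩
  rw [Real.sqrt_sq hr0]
  generalize E.eval t = e, F.eval t = f, E.derivative.derivative.eval t = e₂,
    F.derivative.derivative.eval t = f₂
  have hflux : 3 * (f - r ^ 3 * e₂) ^ 2 ≤ lam * (f - r ^ 3 * e₂) ^ 2 := by gcongr
  have hcross : 0 ≤ 2 * f ^ 2 + 2 * (r ^ 3 * e₂) ^ 2
      + (4 * r ^ 2 - 2) * (f * (r ^ 3 * e₂)) := by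
    have hsum : 0 ≤ r ^ 2 * (f + r ^ 3 * e₂) ^ 2 := by positivity
    have hdiff : 0 ≤ (1 - r ^ 2) * (f - r ^ 3 * e₂) ^ 2 :=
      mul_nonneg (sub_nonneg.2 hε1) (sq_nonneg _)
    nlinarith [sq_nonneg f, sq_nonneg (r ^ 3 * e₂)]
  nlinarith [sq_nonneg e]

theorem sum_integral_energyDensity_le (hx : IsMesh x N) {lam ε : ℝ} (hlam : 3 ≤ lam) (hε : 0 ≤ ε)
    (hε1 : ε ≤ 1) (hE : HasPieces x N eu E) (hF : HasPieces x N ev F) (hcl : Clamped eu) :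
    ∑ i ∈ Finset.range N, ∫ t in x i..x (i + 1), energyDensity ε (E i) (F i) t ≤
      ∑ i ∈ Finset.range N, ∫ t in x i..x (i + 1),
        bilinDensity lam ε (E i) (F i) (E i) (F i) t := by
  set c := 4 * (ε ^ (5 / 2 : ℝ) + ε ^ (3 / 2 : ℝ))
  have hcell (i : ℕ) (hi : i ∈ Finset.range N) :
      ∫ t in x i..x (i + 1), energyDensity ε (E i) (F i) t ≤
        (∫ t in x i..x (i + 1), bilinDensity lam ε (E i) (F i) (E i) (F i) t)
          - c * ∫ t in x i..x (i + 1), ((F i).derivative.derivative.eval t * (E i).eval t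
            - (E i).derivative.derivative.eval t * (F i).eval t) := by
    have hB := continuous_bilinDensity lam ε (E i) (F i) (E i) (F i)
    rw [← intervalIntegral.integral_const_mul, ← intervalIntegral.integral_sub
      (hB.intervalIntegrable _ _) (Continuous.intervalIntegrable (by fun_prop) _ _)]
    exact intervalIntegral.integral_mono_on (hx.lt i (Finset.mem_range.1 hi)).le
      ((continuous_energyDensity _ _ _).intervalIntegrable _ _)
      (Continuous.intervalIntegrable (by fun_prop) _ _)
      fun t _ => energyDensity_le_bilinDensity_sub hlam hε hε1 _ _ t
  have hsum := Finset.sum_le_sum hcell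
  rwa [Finset.sum_sub_distrib, ← Finset.mul_sum, sum_integral_second_mul_sub_eq_zero hx hE hF hcl,
    mul_zero, sub_zero] at hsum

end Pieces

/-! ### The consistency error on one cell -/

/-- The error of a local approximation of a function, split into an interpolation error and a
remaining correction, each together with its second derivative. -/
structure SplitError where
  interp : ℝ → ℝ
  interp₂ : ℝ → ℝ
  corr : ℝ → ℝ
  corr₂ : ℝ → ℝ

/-- The properties of a split error on `[a,b]` that make its consistency error small: continuity,
and the two orthogonality relations that the interpolation operator provides. -/
structure SplitError.IsAdmissible (p : ℕ) (a b : ℝ) (S : SplitError) : Prop where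
  continuousOn_interp : ContinuousOn S.interp (Icc a b)
  continuousOn_interp₂ : ContinuousOn S.interp₂ (Icc a b)
  continuousOn_corr : ContinuousOn S.corr (Icc a b)
  continuousOn_corr₂ : ContinuousOn S.corr₂ (Icc a b)
  orth : ∀ E : ℝ[X], E.natDegree ≤ p →
    ∫ t in a..b, S.interp₂ t * E.derivative.derivative.eval t = 0
  symm : ∀ E : ℝ[X], ∫ t in a..b, S.interp₂ t * E.eval t =
    ∫ t in a..b, S.interp t * E.derivative.derivative.eval t

/-- The integrand of `B` at the errors `U` of `u` and `V` of `v`, tested with `(E, F)`. -/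
noncomputable def consistencyDensity (lam ε : ℝ) (U V : SplitError) (E F : ℝ[X]) (t : ℝ) : ℝ :=
  lam * ((V.interp t + V.corr t - ε ^ (3 / 2 : ℝ) * (U.interp₂ t + U.corr₂ t)) *
      (F.eval t - ε ^ (3 / 2 : ℝ) * E.derivative.derivative.eval t)) +
    (ε ^ (5 / 2 : ℝ) * (V.interp₂ t + V.corr₂ t) + 4 * (U.interp t + U.corr t)) *
      (ε ^ (3 / 2 : ℝ) * F.derivative.derivative.eval t + 4 * E.eval t)

/-- What remains of `consistencyDensity` after the second derivatives of the interpolation errors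
have been removed by orthogonality. The last term is the only one that vanishes for `lam = 4`. -/
noncomputable def reducedDensity (lam ε : ℝ) (U V : SplitError) (E F : ℝ[X]) (t : ℝ) : ℝ :=
  lam * (V.interp t * (F.eval t - ε ^ (3 / 2 : ℝ) * E.derivative.derivative.eval t)) +
    16 * U.interp t * E.eval t +
    4 * ε ^ (5 / 2 : ℝ) * V.interp t * E.derivative.derivative.eval t +
    lam * ((V.corr t - ε ^ (3 / 2 : ℝ) * U.corr₂ t) *
      (F.eval t - ε ^ (3 / 2 : ℝ) * E.derivative.derivative.eval t)) +
    (ε ^ (5 / 2 : ℝ) * V.corr₂ t + 4 * U.corr t) *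
      (ε ^ (3 / 2 : ℝ) * F.derivative.derivative.eval t + 4 * E.eval t) +
    (4 - lam) * ε ^ (3 / 2 : ℝ) * U.interp t * F.derivative.derivative.eval t

/-- The density that bounds the consistency error, with the weight `μ` for the term that stems
from `lam ≠ 4`. -/
noncomputable def errorDensity (lam ε μ : ℝ) (U V : SplitError) (t : ℝ) : ℝ :=
  V.interp t ^ 2 + U.interp t ^ 2 + (lam - 4) ^ 2 * μ ^ 2 * U.interp t ^ 2 + V.corr t ^ 2 +
    ε ^ 3 * U.corr₂ t ^ 2 + ε ^ 4 * V.corr₂ t ^ 2 + ε⁻¹ * U.corr t ^ 2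

theorem mul_le_weighted_young {c : ℝ} (hc : 0 < c) (a b : ℝ) :
    a * b ≤ c * a ^ 2 + (4 * c)⁻¹ * b ^ 2 := by
  have := two_mul_le_add_mul_sq (a := a) (b := b) (show 0 < 2 * c by positivity)
  have h4c : (4 * c)⁻¹ = (2 * c)⁻¹ / 2 := by field_simp; norm_num
  rw [h4c]
  linarith

section Consistency

variable {lam ε μ κ a b : ℝ} {p : ℕ} {U V : SplitError} {E F : ℝ[X]}

theorem sq_sum_test_coefficients_le {r : ℝ} (hr : r ^ 2 ≤ 1) (lam au av cv z w d : ℝ) :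
    (lam * av + lam * cv - lam * z) ^ 2 + (-lam * av + 4 * r ^ 2 * av - lam * cv + lam * z) ^ 2 +
      (16 * au + 4 * r * w + 16 * r * d) ^ 2 + (w + 4 * d) ^ 2 ≤
    7 * lam ^ 2 * (av ^ 2 + cv ^ 2 + z ^ 2) + 800 * (av ^ 2 + au ^ 2 + w ^ 2 + d ^ 2) := by
  have hr4 : (r ^ 2) ^ 2 ≤ 1 := pow_le_one₀ (sq_nonneg r) hr
  have hav : (r ^ 2) ^ 2 * av ^ 2 ≤ 1 * av ^ 2 := by gcongr
  have hw : r ^ 2 * w ^ 2 ≤ 1 * w ^ 2 := by gcongr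
  have hd : r ^ 2 * d ^ 2 ≤ 1 * d ^ 2 := by gcongr
  have hthree (a b c : ℝ) : (a + b + c) ^ 2 ≤ 3 * (a ^ 2 + b ^ 2 + c ^ 2) := by
    linarith [sq_nonneg (a - b), sq_nonneg (a - c), sq_nonneg (b - c)]
  have hfour (a b c d : ℝ) : (a + b + c + d) ^ 2 ≤ 4 * (a ^ 2 + b ^ 2 + c ^ 2 + d ^ 2) := by
    linarith [sq_nonneg (a + b - c - d), sq_nonneg (a - b), sq_nonneg (c - d)]
  linarith [hthree (lam * av) (lam * cv) (-lam * z),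
    hfour (-lam * av) (4 * r ^ 2 * av) (-lam * cv) (lam * z),
    hthree (16 * au) (4 * r * w) (16 * r * d), sq_nonneg (w - 4 * d), sq_nonneg w, sq_nonneg au,
    sq_nonneg d, sq_nonneg av]

theorem reducedDensity_le (hε : 0 < ε) (hε1 : ε ≤ 1) (hμ : 0 < μ) (hκ : 0 < κ) (U V : SplitError)
    (E F : ℝ[X]) (t : ℝ) :
    reducedDensity lam ε U V E F t ≤ 1 / 4 * energyDensity ε E F t +
      (7 * lam ^ 2 + 800 + κ) * errorDensity lam ε μ U V t +
      (4 * (κ * μ ^ 2))⁻¹ * (ε ^ 3 * F.derivative.derivative.eval t ^ 2) := by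
  rw [reducedDensity, energyDensity, errorDensity, rpow_three_halves hε.le,
    rpow_five_halves hε.le]
  obtain ⟨r, hr, rfl⟩ : ∃ r : ℝ, 0 < r ∧ ε = r ^ 2 :=
    ⟨Real.sqrt ε, Real.sqrt_pos.2 hε, (Real.sq_sqrt hε.le).symm⟩
  rw [Real.sqrt_sq hr.le]
  obtain ⟨d, hd⟩ : ∃ d, U.corr t = r * d := ⟨U.corr t / r, by field_simp⟩
  have hcorr : (r ^ 2)⁻¹ * U.corr t ^ 2 = d ^ 2 := by rw [hd]; field_simp
  rw [hcorr, hd]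
  generalize E.eval t = e, F.eval t = f, E.derivative.derivative.eval t = e₂,
    F.derivative.derivative.eval t = f₂, U.interp t = au, V.interp t = av, V.corr t = cv,
    U.corr₂ t = cu₂, V.corr₂ t = cv₂
  have hlam : (4 - lam) * au * (r ^ 3 * f₂) ≤
      κ * μ ^ 2 * ((4 - lam) * au) ^ 2 + (4 * (κ * μ ^ 2))⁻¹ * (r ^ 3 * f₂) ^ 2 :=
    mul_le_weighted_young (by positivity) _ _
  have hf := mul_le_weighted_young one_pos (lam * av + lam * cv - lam * (r ^ 3 * cu₂)) f
  have he₂ := mul_le_weighted_young one_pos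
    (-lam * av + 4 * r ^ 2 * av - lam * cv + lam * (r ^ 3 * cu₂)) (r ^ 3 * e₂)
  have he := mul_le_weighted_young one_pos (16 * au + 4 * r * (r ^ 4 * cv₂) + 16 * r * d) e
  have hf₂ := mul_le_weighted_young one_pos (r ^ 4 * cv₂ + 4 * d) (r ^ 4 * f₂)
  have hcoeff := sq_sum_test_coefficients_le hε1 lam au av cv (r ^ 3 * cu₂) (r ^ 4 * cv₂) d
  have hpos₁ : 0 ≤ 7 * lam ^ 2 * (au ^ 2 + (lam - 4) ^ 2 * μ ^ 2 * au ^ 2 + (r ^ 4 * cv₂) ^ 2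
    + d ^ 2) := by positivity
  have hpos₂ : 0 ≤ 800 * ((lam - 4) ^ 2 * μ ^ 2 * au ^ 2 + cv ^ 2 + (r ^ 3 * cu₂) ^ 2) := by
    positivity
  have hpos₃ : 0 ≤ κ * (av ^ 2 + au ^ 2 + cv ^ 2 + (r ^ 3 * cu₂) ^ 2 + (r ^ 4 * cv₂) ^ 2
    + d ^ 2) := by positivity
  norm_num at hf he₂ he hf₂
  linarith

theorem SplitError.IsAdmissible.continuousOn_errorDensity (hU : U.IsAdmissible p a b)
    (hV : V.IsAdmissible p a b) : ContinuousOn (errorDensity lam ε μ U V) (Icc a b) := by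
  have := hU.continuousOn_interp
  have := hU.continuousOn_corr
  have := hU.continuousOn_corr₂
  have := hV.continuousOn_interp
  have := hV.continuousOn_corr
  have := hV.continuousOn_corr₂
  unfold errorDensity
  fun_prop

theorem SplitError.IsAdmissible.continuousOn_reducedDensity (hU : U.IsAdmissible p a b)
    (hV : V.IsAdmissible p a b) : ContinuousOn (reducedDensity lam ε U V E F) (Icc a b) := by
  have := hU.continuousOn_interp
  have := hU.continuousOn_corr
  have := hU.continuousOn_corr₂
  have := hV.continuousOn_interp
  have := hV.continuousOn_corr
  have := hV.continuousOn_corr₂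
  unfold reducedDensity
  fun_prop

theorem integral_consistencyDensity_eq (hε : 0 ≤ ε) (hab : a ≤ b) (hU : U.IsAdmissible p a b)
    (hV : V.IsAdmissible p a b) (hE : E.natDegree ≤ p) (hF : F.natDegree ≤ p) :
    ∫ t in a..b, consistencyDensity lam ε U V E F t =
      ∫ t in a..b, reducedDensity lam ε U V E F t := by
  set r := Real.sqrt ε
  have hint {g : ℝ → ℝ} (hg : ContinuousOn g (Icc a b)) : IntervalIntegrable g volume a b :=
    hg.intervalIntegrable_of_Icc hab
  have hsub {g₁ g₂ : ℝ → ℝ} (h₁ : ContinuousOn g₁ (Icc a b)) (h₂ : ContinuousOn g₂ (Icc a b)) :=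
    intervalIntegral.integral_sub (hint h₁) (hint h₂)
  have hU₀ := hU.continuousOn_interp
  have hU₂ := hU.continuousOn_interp₂
  have hV₀ := hV.continuousOn_interp
  have hV₂ := hV.continuousOn_interp₂
  have hsplit (t : ℝ) : consistencyDensity lam ε U V E F t = reducedDensity lam ε U V E F t +
      lam * r ^ 6 * (U.interp₂ t * E.derivative.derivative.eval t) +
      r ^ 8 * (V.interp₂ t * F.derivative.derivative.eval t) -
      lam * r ^ 3 * (U.interp₂ t * F.eval t - U.interp t * F.derivative.derivative.eval t) +
      4 * r ^ 5 * (V.interp₂ t * E.eval t - V.interp t * E.derivative.derivative.eval t) := by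
    rw [consistencyDensity, reducedDensity, rpow_three_halves hε, rpow_five_halves hε]
    ring
  have hred := hU.continuousOn_reducedDensity hV (lam := lam) (ε := ε) (E := E) (F := F)
  simp only [hsplit]
  rw [intervalIntegral.integral_add (hint (by fun_prop)) (hint (by fun_prop)),
    intervalIntegral.integral_sub (hint (by fun_prop)) (hint (by fun_prop)),
    intervalIntegral.integral_add (hint (by fun_prop)) (hint (by fun_prop)),
    intervalIntegral.integral_add (hint (by fun_prop)) (hint (by fun_prop))]
  simp only [intervalIntegral.integral_const_mul]
  rw [hsub (by fun_prop) (by fun_prop), hsub (by fun_prop) (by fun_prop), hU.orth E hE,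
    hV.orth F hF, hU.symm F, hV.symm E]
  ring

theorem integral_consistencyDensity_le (hε : 0 < ε) (hε1 : ε ≤ 1) (hμ : 0 < μ) (hκ : 0 < κ)
    (hab : a ≤ b) (hU : U.IsAdmissible p a b) (hV : V.IsAdmissible p a b)
    (hE : E.natDegree ≤ p) (hF : F.natDegree ≤ p)
    (hinv : ε ^ 3 * ∫ t in a..b, F.derivative.derivative.eval t ^ 2 ≤
      κ * μ ^ 2 * ∫ t in a..b, energyDensity ε E F t) :
    ∫ t in a..b, consistencyDensity lam ε U V E F t ≤
      1 / 2 * (∫ t in a..b, energyDensity ε E F t) +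
        (7 * lam ^ 2 + 800 + κ) * ∫ t in a..b, errorDensity lam ε μ U V t := by
  have henergy : IntervalIntegrable (energyDensity ε E F) volume a b :=
    (continuous_energyDensity ε E F).intervalIntegrable a b
  have herror : IntervalIntegrable (errorDensity lam ε μ U V) volume a b :=
    (hU.continuousOn_errorDensity hV).intervalIntegrable_of_Icc hab
  have hsecond : IntervalIntegrable
      (fun t => (4 * (κ * μ ^ 2))⁻¹ * (ε ^ 3 * F.derivative.derivative.eval t ^ 2)) volume a b :=
    Continuous.intervalIntegrable (by fun_prop) a b
  have hmono := intervalIntegral.integral_mono_on hab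
    ((hU.continuousOn_reducedDensity hV).intervalIntegrable_of_Icc hab)
    (((henergy.const_mul (1 / 4)).add (herror.const_mul (7 * lam ^ 2 + 800 + κ))).add hsecond)
    fun t _ => reducedDensity_le (E := E) (F := F) hε hε1 hμ hκ U V t
  rw [intervalIntegral.integral_add ((henergy.const_mul _).add (herror.const_mul _)) hsecond,
    intervalIntegral.integral_add (henergy.const_mul _) (herror.const_mul _)] at hmono
  simp only [intervalIntegral.integral_const_mul] at hmono
  have habsorb : (4 * (κ * μ ^ 2))⁻¹ * (ε ^ 3 * ∫ t in a..b, F.derivative.derivative.eval t ^ 2) ≤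
      1 / 4 * ∫ t in a..b, energyDensity ε E F t :=
    (mul_le_mul_of_nonneg_left hinv (by positivity)).trans_eq (by field_simp)
  rw [integral_consistencyDensity_eq hε.le hab hU hV hE hF]
  linarith

end Consistency

/-! ### Galerkin orthogonality -/

theorem IsSolution.integral_load {ε : ℝ} {f u : ℝ → ℝ} (hu : IsSolution ε f u) (g : ℝ → ℝ) :
    ∫ t in (0 : ℝ)..1, f t * g t = ∫ t in (0 : ℝ)..1, (ε ^ 4 * D 4 u t + 4 * u t) * g t := by
  rw [intervalIntegral.integral_of_le zero_le_one, intervalIntegral.integral_of_le zero_le_one,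
    integral_Ioc_eq_integral_Ioo, integral_Ioc_eq_integral_Ioo]
  refine integral_congr_ae ?_
  filter_upwards [hu.ode] with t ht
  rw [ht]

/-- The integrand of the load functional of `u` at the test pair `(E, F)` on one cell, with the
datum `f` expressed through the differential equation. -/
noncomputable def loadDensity (ε : ℝ) (u : ℝ → ℝ) (E F : ℝ[X]) (t : ℝ) : ℝ :=
  (ε ^ 4 * D 4 u t + 4 * u t) *
    (ε ^ (3 / 2 : ℝ) * F.derivative.derivative.eval t + 4 * E.eval t)

section Galerkin

variable {x : ℕ → ℝ} {N p : ℕ} {lam ε : ℝ} {f u uh vh eu ev : ℝ → ℝ} {Uh Vh E F : ℕ → ℝ[X]}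

theorem continuousOn_loadDensity (hu : DiffUpTo 5 u) (ε : ℝ) (E F : ℝ[X]) {S : Set ℝ}
    (hS : S ⊆ Icc 0 1) : ContinuousOn (loadDensity ε u E F) S := by
  have hu₀ : ContinuousOn (D 0 u) S := hu.continuousOn (by omega) hS
  have hu₄ : ContinuousOn (D 4 u) S := hu.continuousOn (by omega) hS
  rw [D_zero] at hu₀
  unfold loadDensity
  fun_prop

theorem bilinDensity_sub (lam ε : ℝ) (P Q P' Q' E F : ℝ[X]) (t : ℝ) :
    bilinDensity lam ε (P - P') (Q - Q') E F t =
      bilinDensity lam ε P Q E F t - bilinDensity lam ε P' Q' E F t := by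
  simp only [bilinDensity, eval_sub, derivative_sub]
  ring

theorem load_eq_sum (hx : IsMesh x N) (hu : IsSolution ε f u) (hu₅ : DiffUpTo 5 u)
    (hE : HasPieces x N eu E) (hF : HasPieces x N ev F) :
    load ε f (eu, ev) = ∑ i ∈ Finset.range N,
      ∫ t in x i..x (i + 1), loadDensity ε u (E i) (F i) t := by
  rw [load, hu.integral_load]
  refine hx.integral_eq_sum
    (fun i hi => continuousOn_loadDensity hu₅ ε (E i) (F i) (hx.cell_subset hi)) fun i hi t ht => ?_
  simp only [loadDensity, hE.value i hi (Ioo_subset_Icc_self ht), hF.second i hi ht]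

theorem galerkin_orthogonality (hx : IsMesh x N) (hu : IsSolution ε f u) (hu₅ : DiffUpTo 5 u)
    (hfem : IsFEMSolution p x N lam ε f (uh, vh)) (hmem : (eu, ev) ∈ feSpace p x N)
    (hUh : HasPieces x N uh Uh) (hVh : HasPieces x N vh Vh)
    (hE : HasPieces x N eu E) (hF : HasPieces x N ev F) (P Q : ℕ → ℝ[X]) :
    ∑ i ∈ Finset.range N, ∫ t in x i..x (i + 1),
        bilinDensity lam ε (P i - Uh i) (Q i - Vh i) (E i) (F i) t =
      ∑ i ∈ Finset.range N, ∫ t in x i..x (i + 1),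
        (bilinDensity lam ε (P i) (Q i) (E i) (F i) t - loadDensity ε u (E i) (F i) t) := by
  have hdiscrete := hfem.2 _ hmem
  rw [bilin_eq_sum hx lam ε hUh hVh hE hF, load_eq_sum hx hu hu₅ hE hF] at hdiscrete
  have hint (i : ℕ) (P Q : ℝ[X]) : IntervalIntegrable (bilinDensity lam ε P Q (E i) (F i)) volume
      (x i) (x (i + 1)) :=
    (continuous_bilinDensity _ _ _ _ _ _).intervalIntegrable _ _
  have hbilin (i : ℕ) (_ : i ∈ Finset.range N) :
      ∫ t in x i..x (i + 1), bilinDensity lam ε (P i - Uh i) (Q i - Vh i) (E i) (F i) t =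
        (∫ t in x i..x (i + 1), bilinDensity lam ε (P i) (Q i) (E i) (F i) t) -
          ∫ t in x i..x (i + 1), bilinDensity lam ε (Uh i) (Vh i) (E i) (F i) t := by
    simp only [bilinDensity_sub]
    exact intervalIntegral.integral_sub (hint i _ _) (hint i _ _)
  have hresidual (i : ℕ) (hi : i ∈ Finset.range N) :
      ∫ t in x i..x (i + 1),
          (bilinDensity lam ε (P i) (Q i) (E i) (F i) t - loadDensity ε u (E i) (F i) t) =
        (∫ t in x i..x (i + 1), bilinDensity lam ε (P i) (Q i) (E i) (F i) t) -
          ∫ t in x i..x (i + 1), loadDensity ε u (E i) (F i) t := by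
    have hi := Finset.mem_range.1 hi
    exact intervalIntegral.integral_sub (hint i _ _) ((continuousOn_loadDensity hu₅ ε _ _
      (hx.cell_subset hi)).intervalIntegrable_of_Icc (hx.lt i hi).le)
  rw [Finset.sum_congr rfl hbilin, Finset.sum_congr rfl hresidual, Finset.sum_sub_distrib,
    Finset.sum_sub_distrib, hdiscrete]

end Galerkin

/-! ### The Shishkin mesh -/

section Nodes

variable {τ : ℝ} {n i : ℕ}

theorem node_of_le (hn : 0 < n) (hi : i ≤ n) : node τ (4 * n) i = i * (τ / n) := by
  have : (n : ℝ) ≠ 0 := by positivity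
  rw [node, if_pos (by omega)]
  push_cast
  field_simp

theorem node_of_mem (hn : 0 < n) (hni : n ≤ i) (hi : i ≤ 3 * n) :
    node τ (4 * n) i = τ + (i - n) * ((1 - 2 * τ) / (2 * n)) := by
  have : (n : ℝ) ≠ 0 := by positivity
  rcases hni.eq_or_lt with rfl | hni
  · rw [node_of_le hn le_rfl]
    field_simp
    ring
  · rw [node, if_neg (by omega), if_pos (by omega)]
    push_cast
    field_simp
    ring

theorem node_of_ge (hn : 0 < n) (hi : 3 * n ≤ i) :
    node τ (4 * n) i = 1 - (4 * n - i) * (τ / n) := by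
  have : (n : ℝ) ≠ 0 := by positivity
  rcases hi.eq_or_lt with rfl | hi
  · rw [node_of_mem hn (by omega) le_rfl]
    push_cast
    field_simp
    ring
  · rw [node, if_neg (by omega), if_neg (by omega)]
    push_cast
    field_simp

theorem node_first (hn : 0 < n) : node τ (4 * n) 0 = 0 := by
  rw [node_of_le hn (Nat.zero_le n)]; simp

theorem node_last (hn : 0 < n) : node τ (4 * n) (4 * n) = 1 := by
  rw [node_of_ge hn (by omega)]; simp

theorem node_left_transition (hn : 0 < n) : node τ (4 * n) n = τ := by
  rw [node_of_mem hn le_rfl (by omega)]; simp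

theorem node_right_transition (hn : 0 < n) : node τ (4 * n) (3 * n) = 1 - τ := by
  have : (n : ℝ) ≠ 0 := by positivity
  rw [node_of_ge hn le_rfl]
  push_cast
  field_simp
  ring

theorem node_sub_of_lt (hn : 0 < n) (hi : i < n) :
    node τ (4 * n) (i + 1) - node τ (4 * n) i = τ / n := by
  rw [node_of_le hn hi, node_of_le hn hi.le]; push_cast; ring

theorem node_sub_of_mem (hn : 0 < n) (hni : n ≤ i) (hi : i < 3 * n) :
    node τ (4 * n) (i + 1) - node τ (4 * n) i = (1 - 2 * τ) / (2 * n) := by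
  rw [node_of_mem hn (by omega) hi, node_of_mem hn hni hi.le]; push_cast; ring

theorem node_sub_of_ge (hn : 0 < n) (hi : 3 * n ≤ i) :
    node τ (4 * n) (i + 1) - node τ (4 * n) i = τ / n := by
  rw [node_of_ge hn (by omega), node_of_ge hn hi]; push_cast; ring

theorem isMesh_node (hn : 0 < n) (hτ₀ : 0 < τ) (hτ : τ ≤ 1 / 4) :
    IsMesh (node τ (4 * n)) (4 * n) := by
  refine ⟨node_first hn, node_last hn, fun i _ => sub_pos.1 ?_⟩
  rcases lt_or_ge i n with h | h
  · rw [node_sub_of_lt hn h]; positivity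
  · rcases lt_or_ge i (3 * n) with h' | h'
    · rw [node_sub_of_mem hn h h']
      exact div_pos (by linarith) (by positivity)
    · rw [node_sub_of_ge hn h']; positivity

end Nodes

/-! ### The special representatives as splines -/

theorem interp_eq_eval_localInterp {p N : ℕ} {x : ℕ → ℝ} (hx : IsMesh x N) (w : ℝ → ℝ) {i : ℕ}
    (hi : i < N) {t : ℝ} (ht : x i ≤ t) (ht' : t < x (i + 1) ∨ i + 1 = N) :
    interp p x N w t = (localInterp p (x i) (x (i + 1)) w).eval t := by
  classical
  have hcell : Nat.findGreatest (fun j => x j ≤ t) (N - 1) = i := by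
    refine Nat.findGreatest_eq_iff.2 ⟨by omega, fun _ => ht, fun j hij hj => ?_⟩
    rcases ht' with hlt | hlast
    · exact not_le.2 (hlt.trans_le (hx.mono hij (by omega)))
    · omega
  simp only [interp, hcell]

/-- Value and slope of a polynomial at a point, the data that must match across a mesh point. -/
noncomputable def polyJet (P : ℝ[X]) (t : ℝ) : ℝ × ℝ := (P.eval t, P.derivative.eval t)

theorem polyJet_add (P Q : ℝ[X]) (t : ℝ) : polyJet (P + Q) t = polyJet P t + polyJet Q t := by
  simp [polyJet]

theorem polyJet_comp_one_sub (P : ℝ[X]) (t : ℝ) :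
    polyJet (P.comp (1 - X)) t = (P.eval (1 - t), -P.derivative.eval (1 - t)) := by
  simp [polyJet, derivative_comp]

/-- The cubic with a double zero at `0` that has the value `c` and the slope `d` at `τ`. -/
noncomputable def hermiteCubic (τ c d : ℝ) : ℝ[X] := C d * chi₀ τ + C c * chi₁ τ

theorem natDegree_hermiteCubic_le {τ : ℝ} (hτ : τ ≠ 0) (c d : ℝ) :
    (hermiteCubic τ c d).natDegree ≤ 3 :=
  natDegree_add_le_of_degree_le ((natDegree_C_mul_le _ _).trans (chi₀_spec hτ).1)
    ((natDegree_C_mul_le _ _).trans (chi₁_spec hτ).1)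

theorem polyJet_hermiteCubic_zero {τ : ℝ} (hτ : τ ≠ 0) (c d : ℝ) :
    polyJet (hermiteCubic τ c d) 0 = 0 := by
  obtain ⟨-, hvalue₀, hslope₀, -, -⟩ := chi₀_spec hτ
  obtain ⟨-, hvalue₁, hslope₁, -, -⟩ := chi₁_spec hτ
  simp [polyJet, hermiteCubic, hvalue₀, hslope₀, hvalue₁, hslope₁]

theorem polyJet_hermiteCubic_self {τ : ℝ} (hτ : τ ≠ 0) (c d : ℝ) :
    polyJet (hermiteCubic τ c d) τ = (c, d) := by
  obtain ⟨-, -, -, hvalue₀, hslope₀⟩ := chi₀_spec hτ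
  obtain ⟨-, -, -, hslope₁, hvalue₁⟩ := chi₁_spec hτ
  simp [polyJet, hermiteCubic, hvalue₀, hslope₀, hvalue₁, hslope₁]

/-- The number `n` of cells in each quarter of the mesh, and its transition point `τ`. -/
structure MeshParameters (n : ℕ) (τ : ℝ) : Prop where
  n_pos : 0 < n
  tau_pos : 0 < τ
  tau_le : τ ≤ 1 / 4

theorem MeshParameters.isMesh {n : ℕ} {τ : ℝ} (h : MeshParameters n τ) :
    IsMesh (node τ (4 * n)) (4 * n) :=
  isMesh_node h.n_pos h.tau_pos h.tau_le

/-- A sufficiently smooth sum `w = wreg + wbl`. -/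
structure Splitting (w wreg wbl : ℝ → ℝ) : Prop where
  diff : DiffUpTo 3 w
  diff_reg : DiffUpTo 3 wreg
  value : EqOn w (wreg + wbl) (Icc 0 1)
  slope : EqOn (D 1 w) (D 1 wreg + D 1 wbl) (Icc 0 1)

/-- The function that is interpolated on the `i`-th cell. -/
noncomputable def cellTarget (n : ℕ) (w wreg : ℝ → ℝ) (i : ℕ) : ℝ → ℝ :=
  if n ≤ i ∧ i < 3 * n then wreg else w

/-- The cubic on the `i`-th cell that is added to the interpolant: it replaces the trace of `w` at
a transition point by that of `wreg`. -/
noncomputable def cellCorrection (n : ℕ) (τ : ℝ) (wbl : ℝ → ℝ) (i : ℕ) : ℝ[X] :=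
  if i < n then hermiteCubic τ (-wbl τ) (-D 1 wbl τ)
  else if i < 3 * n then 0
  else (hermiteCubic τ (-wbl (1 - τ)) (D 1 wbl (1 - τ))).comp (1 - X)

/-- The special representative on the `i`-th cell. -/
noncomputable def specialPoly (p n : ℕ) (τ : ℝ) (w wreg wbl : ℝ → ℝ) (i : ℕ) : ℝ[X] :=
  localInterp p (node τ (4 * n) i) (node τ (4 * n) (i + 1)) (cellTarget n w wreg i)
    + cellCorrection n τ wbl i

/-- Value and slope of the function that the special representative interpolates on the `i`-th
cell. -/
noncomputable def cellJet (n : ℕ) (τ : ℝ) (w wreg wbl : ℝ → ℝ) (i : ℕ) (t : ℝ) : ℝ × ℝ :=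
  (cellTarget n w wreg i t, D 1 (cellTarget n w wreg i) t) + polyJet (cellCorrection n τ wbl i) t

section Special

variable {p n i : ℕ} {τ : ℝ} {w wreg wbl : ℝ → ℝ}

theorem cellTarget_of_lt (hi : i < n) : cellTarget n w wreg i = w := if_neg (by omega)

theorem cellTarget_of_mem (hi : n ≤ i) (hi' : i < 3 * n) : cellTarget n w wreg i = wreg :=
  if_pos ⟨hi, hi'⟩

theorem cellTarget_of_ge (hi : 3 * n ≤ i) : cellTarget n w wreg i = w := if_neg (by omega)

theorem cellCorrection_of_lt (hi : i < n) :
    cellCorrection n τ wbl i = hermiteCubic τ (-wbl τ) (-D 1 wbl τ) := if_pos hi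

theorem cellCorrection_of_mem (hi : n ≤ i) (hi' : i < 3 * n) : cellCorrection n τ wbl i = 0 := by
  rw [cellCorrection, if_neg (by omega), if_pos hi']

theorem cellCorrection_of_ge (hn : 0 < n) (hi : 3 * n ≤ i) : cellCorrection n τ wbl i =
    (hermiteCubic τ (-wbl (1 - τ)) (D 1 wbl (1 - τ))).comp (1 - X) := by
  rw [cellCorrection, if_neg (by omega), if_neg (by omega)]

theorem natDegree_cellCorrection_le (hτ : τ ≠ 0) (wbl : ℝ → ℝ) (i : ℕ) :
    (cellCorrection n τ wbl i).natDegree ≤ 3 := by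
  have hlin : (1 - X : ℝ[X]).natDegree ≤ 1 := by compute_degree
  unfold cellCorrection
  split_ifs
  · exact natDegree_hermiteCubic_le hτ _ _
  · simp
  · exact natDegree_comp_le.trans (Nat.mul_le_mul (natDegree_hermiteCubic_le hτ _ _) hlin)

theorem DiffUpTo.cellTarget {K : ℕ} (hw : DiffUpTo K w) (hreg : DiffUpTo K wreg) (n i : ℕ) :
    DiffUpTo K (cellTarget n w wreg i) := by
  unfold ThinShell.cellTarget
  split_ifs <;> assumption

theorem special_eq_eval (h : MeshParameters n τ) (hi : i < 4 * n) {t : ℝ}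
    (ht : node τ (4 * n) i ≤ t) (ht' : t < node τ (4 * n) (i + 1) ∨ i + 1 = 4 * n) :
    special p (node τ (4 * n)) (4 * n) τ w wreg wbl t =
      (specialPoly p n τ w wreg wbl i).eval t := by
  have hx := h.isMesh
  have hleft := node_left_transition (τ := τ) h.n_pos
  have hright := node_right_transition (τ := τ) h.n_pos
  rw [specialPoly, eval_add]
  rcases lt_or_ge i n with hin | hin
  · have hlt : t < τ := hleft ▸
      (ht'.resolve_right (by omega)).trans_le (hx.mono (show i + 1 ≤ n by omega) (by omega))
    rw [special, if_pos hlt, interp_eq_eval_localInterp hx w hi ht ht', cellTarget_of_lt hin,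
      cellCorrection_of_lt hin, hermiteCubic]
    simp only [eval_add, eval_mul, eval_C]
    ring
  have hge : τ ≤ t := hleft ▸ (hx.mono hin hi.le).trans ht
  rcases lt_or_ge i (3 * n) with hi3 | hi3
  · have hlt : t < 1 - τ := hright ▸
      (ht'.resolve_right (by omega)).trans_le (hx.mono (show i + 1 ≤ 3 * n by omega) (by omega))
    rw [special, if_neg hge.not_gt, if_pos hlt, interp_eq_eval_localInterp hx wreg hi ht ht',
      cellTarget_of_mem hin hi3, cellCorrection_of_mem hin hi3, eval_zero, add_zero]
  · have hge' : 1 - τ ≤ t := hright ▸ (hx.mono hi3 hi.le).trans ht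
    rw [special, if_neg hge.not_gt, if_neg hge'.not_gt, interp_eq_eval_localInterp hx w hi ht ht',
      cellTarget_of_ge hi3, cellCorrection_of_ge h.n_pos hi3, hermiteCubic]
    simp only [eval_add, eval_mul, eval_C, eval_comp, eval_sub, eval_one, eval_X]
    ring

theorem isLocalInterp_cellTarget (h : MeshParameters n τ) (hp : 2 ≤ p) (hw : DiffUpTo 3 w)
    (hreg : DiffUpTo 3 wreg) (hi : i < 4 * n) :
    IsLocalInterp p (node τ (4 * n) i) (node τ (4 * n) (i + 1)) (cellTarget n w wreg i)
      (localInterp p (node τ (4 * n) i) (node τ (4 * n) (i + 1)) (cellTarget n w wreg i)) :=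
  (hw.cellTarget hreg n i).isLocalInterp hp (h.isMesh.lt i hi) (h.isMesh.cell_subset hi)

theorem Splitting.natDegree_specialPoly_le (hw : Splitting w wreg wbl) (h : MeshParameters n τ)
    (hp : 3 ≤ p) (hi : i < 4 * n) : (specialPoly p n τ w wreg wbl i).natDegree ≤ p :=
  natDegree_add_le_of_degree_le
    (isLocalInterp_cellTarget h (by omega) hw.diff hw.diff_reg hi).degree
    ((natDegree_cellCorrection_le h.tau_pos.ne' _ _).trans hp)

theorem Splitting.polyJet_specialPoly_left (hw : Splitting w wreg wbl) (h : MeshParameters n τ)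
    (hp : 2 ≤ p) (hi : i < 4 * n) :
    polyJet (specialPoly p n τ w wreg wbl i) (node τ (4 * n) i) =
      cellJet n τ w wreg wbl i (node τ (4 * n) i) := by
  have hI := isLocalInterp_cellTarget h hp hw.diff hw.diff_reg hi
  rw [specialPoly, polyJet_add, cellJet, ← hI.value, ← hI.slope]
  rfl

theorem Splitting.polyJet_specialPoly_right (hw : Splitting w wreg wbl) (h : MeshParameters n τ)
    (hp : 3 ≤ p) (hi : i < 4 * n) :
    polyJet (specialPoly p n τ w wreg wbl i) (node τ (4 * n) (i + 1)) =
      cellJet n τ w wreg wbl i (node τ (4 * n) (i + 1)) := by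
  obtain ⟨hvalue, hslope⟩ :=
    (isLocalInterp_cellTarget h (by omega) hw.diff hw.diff_reg hi).value_and_slope_right hp
      (hw.diff.cellTarget hw.diff_reg n i) (h.isMesh.lt i hi).le (h.isMesh.cell_subset hi)
  rw [specialPoly, polyJet_add, cellJet, ← hvalue, ← hslope]
  rfl

theorem cellJet_of_mem (hi : n ≤ i) (hi' : i < 3 * n) (t : ℝ) :
    cellJet n τ w wreg wbl i t = (wreg t, D 1 wreg t) := by
  simp [cellJet, cellTarget_of_mem hi hi', cellCorrection_of_mem hi hi', polyJet]

theorem Splitting.cellJet_left_transition (hw : Splitting w wreg wbl) (h : MeshParameters n τ)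
    (hi : i < n) : cellJet n τ w wreg wbl i τ = (wreg τ, D 1 wreg τ) := by
  have hτ : τ ∈ Icc (0 : ℝ) 1 := ⟨h.tau_pos.le, by linarith [h.tau_le]⟩
  rw [cellJet, cellTarget_of_lt hi, cellCorrection_of_lt hi,
    polyJet_hermiteCubic_self h.tau_pos.ne', hw.value hτ, hw.slope hτ]
  simp

theorem Splitting.cellJet_right_transition (hw : Splitting w wreg wbl) (h : MeshParameters n τ)
    (hi : 3 * n ≤ i) :
    cellJet n τ w wreg wbl i (1 - τ) = (wreg (1 - τ), D 1 wreg (1 - τ)) := by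
  have hτ : 1 - τ ∈ Icc (0 : ℝ) 1 := ⟨by linarith [h.tau_le], by linarith [h.tau_pos]⟩
  obtain ⟨hvalue, hslope⟩ := Prod.ext_iff.1
    (polyJet_hermiteCubic_self h.tau_pos.ne' (-wbl (1 - τ)) (D 1 wbl (1 - τ)))
  simp only [polyJet] at hvalue hslope
  rw [cellJet, cellTarget_of_ge hi, cellCorrection_of_ge h.n_pos hi, polyJet_comp_one_sub,
    sub_sub_cancel, hvalue, hslope, hw.value hτ, hw.slope hτ]
  simp

theorem cellJet_first (h : MeshParameters n τ) : cellJet n τ w wreg wbl 0 0 = (w 0, D 1 w 0) := by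
  rw [cellJet, cellTarget_of_lt h.n_pos, cellCorrection_of_lt h.n_pos,
    polyJet_hermiteCubic_zero h.tau_pos.ne', add_zero]

theorem cellJet_last (h : MeshParameters n τ) :
    cellJet n τ w wreg wbl (4 * n - 1) 1 = (w 1, D 1 w 1) := by
  have hn := h.n_pos
  have hi : 3 * n ≤ 4 * n - 1 := by omega
  obtain ⟨hvalue, hslope⟩ := Prod.ext_iff.1
    (polyJet_hermiteCubic_zero h.tau_pos.ne' (-wbl (1 - τ)) (D 1 wbl (1 - τ)))
  simp only [polyJet, Prod.fst_zero, Prod.snd_zero] at hvalue hslope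
  rw [cellJet, cellTarget_of_ge hi, cellCorrection_of_ge hn hi, polyJet_comp_one_sub, sub_self,
    hvalue, hslope]
  simp

theorem Splitting.cellJet_glue (hw : Splitting w wreg wbl) (h : MeshParameters n τ) (i : ℕ) :
    cellJet n τ w wreg wbl i (node τ (4 * n) (i + 1)) =
      cellJet n τ w wreg wbl (i + 1) (node τ (4 * n) (i + 1)) := by
  by_cases hleft : i + 1 = n
  · rw [hleft, node_left_transition h.n_pos, hw.cellJet_left_transition h (by omega),
      cellJet_of_mem le_rfl (by omega)]
  by_cases hright : i + 1 = 3 * n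
  · rw [hright, node_right_transition h.n_pos, hw.cellJet_right_transition h le_rfl,
      cellJet_of_mem (by omega) (by omega)]
  have htarget : cellTarget n w wreg i = cellTarget n w wreg (i + 1) :=
    if_congr (by omega) rfl rfl
  have hcorr : cellCorrection n τ wbl i = cellCorrection n τ wbl (i + 1) :=
    if_congr (by omega) rfl (if_congr (by omega) rfl rfl)
  rw [cellJet, cellJet, htarget, hcorr]

theorem Splitting.polyJet_specialPoly_glue (hw : Splitting w wreg wbl) (h : MeshParameters n τ)
    (hp : 3 ≤ p) (hi : i + 1 < 4 * n) :
    polyJet (specialPoly p n τ w wreg wbl i) (node τ (4 * n) (i + 1)) =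
      polyJet (specialPoly p n τ w wreg wbl (i + 1)) (node τ (4 * n) (i + 1)) := by
  rw [hw.polyJet_specialPoly_right h hp (by omega), hw.cellJet_glue h,
    hw.polyJet_specialPoly_left h (by omega) hi]

theorem Splitting.special_eqOn_cell (hw : Splitting w wreg wbl) (h : MeshParameters n τ)
    (hp : 3 ≤ p) (hi : i < 4 * n) :
    EqOn (special p (node τ (4 * n)) (4 * n) τ w wreg wbl)
      (fun t => (specialPoly p n τ w wreg wbl i).eval t)
      (Icc (node τ (4 * n) i) (node τ (4 * n) (i + 1))) := by
  intro t ht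
  rcases ht.2.lt_or_eq with hlt | rfl
  · exact special_eq_eval h hi ht.1 (.inl hlt)
  rcases hi.nat_succ_le.lt_or_eq with hi' | hlast
  · exact (special_eq_eval h hi' le_rfl (.inl (h.isMesh.lt _ hi'))).trans
      (Prod.ext_iff.1 (hw.polyJet_specialPoly_glue h hp hi')).1.symm
  · exact special_eq_eval h hi ht.1 (.inr hlast)

theorem Splitting.isSpline_special (hw : Splitting w wreg wbl) (h : MeshParameters n τ)
    (hp : 3 ≤ p) :
    IsSpline p 1 (node τ (4 * n)) (4 * n)
      (special p (node τ (4 * n)) (4 * n) τ w wreg wbl) :=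
  isSpline_of_pieces h.isMesh (fun _ hi => hw.natDegree_specialPoly_le h hp hi)
    (fun _ hi => hw.special_eqOn_cell h hp hi)
    fun _ hi => (Prod.ext_iff.1 (hw.polyJet_specialPoly_glue h hp hi)).2

theorem Splitting.hasPieces_special (hw : Splitting w wreg wbl) (h : MeshParameters n τ)
    (hp : 3 ≤ p) :
    HasPieces (node τ (4 * n)) (4 * n)
      (special p (node τ (4 * n)) (4 * n) τ w wreg wbl) (specialPoly p n τ w wreg wbl) :=
  (hw.isSpline_special h hp).hasPieces h.isMesh fun _ hi =>
    (hw.special_eqOn_cell h hp hi).mono Ioo_subset_Icc_self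

theorem Splitting.clamped_special (hw : Splitting w wreg wbl) (h : MeshParameters n τ)
    (hp : 3 ≤ p) (hcl : Clamped w) :
    Clamped (special p (node τ (4 * n)) (4 * n) τ w wreg wbl) := by
  have hx := h.isMesh
  have hn := h.n_pos
  have hP := hw.hasPieces_special h hp
  have hfirst : 0 < 4 * n := by omega
  have hlast : 4 * n - 1 < 4 * n := by omega
  have hsucc : 4 * n - 1 + 1 = 4 * n := by omega
  have hleft := hw.polyJet_specialPoly_left h (p := p) (by omega) hfirst
  have hright := hw.polyJet_specialPoly_right h hp hlast
  have hmem₀ : 0 ∈ Icc (node τ (4 * n) 0) (node τ (4 * n) (0 + 1)) := by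
    rw [hx.first]
    exact left_mem_Icc.2 (hx.nonneg (by omega))
  have hmem₁ : 1 ∈ Icc (node τ (4 * n) (4 * n - 1)) (node τ (4 * n) (4 * n - 1 + 1)) := by
    rw [hsucc, hx.last]
    exact right_mem_Icc.2 (hx.le_one hlast.le)
  rw [hx.first] at hleft
  rw [hsucc, hx.last] at hright
  rw [cellJet_first h] at hleft
  rw [cellJet_last h] at hright
  obtain ⟨hvalue₀, hslope₀⟩ := Prod.ext_iff.1 hleft
  obtain ⟨hvalue₁, hslope₁⟩ := Prod.ext_iff.1 hright
  exact ⟨(hP.value 0 hfirst hmem₀).trans (hvalue₀.trans hcl.value_zero),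
    (hP.slope 0 hfirst hmem₀).trans (hslope₀.trans hcl.slope_zero),
    (hP.value _ hlast hmem₁).trans (hvalue₁.trans hcl.value_one),
    (hP.slope _ hlast hmem₁).trans (hslope₁.trans hcl.slope_one)⟩

end Special

/-! ### Boundary layers -/

/-- The common majorant of the two boundary layers. -/
noncomputable def layer (ε t : ℝ) : ℝ := Real.exp (-t / ε) + Real.exp (-(1 - t) / ε)

theorem layer_pos (ε t : ℝ) : 0 < layer ε t := by unfold layer; positivity

theorem layer_one_sub (ε t : ℝ) : layer ε (1 - t) = layer ε t := by
  rw [layer, layer, sub_sub_cancel, add_comm]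

theorem continuous_layer (ε : ℝ) : Continuous (layer ε) := by unfold layer; fun_prop

theorem layer_le_of_abs_sub_le {ε κ s t : ℝ} (hε : 0 < ε) (h : |t - s| ≤ κ * ε) :
    layer ε s ≤ Real.exp κ * layer ε t := by
  obtain ⟨hlow, hupp⟩ := abs_le.1 h
  have hκ : κ = κ * ε / ε := by field_simp
  rw [layer, layer, mul_add, ← Real.exp_add, ← Real.exp_add]
  refine add_le_add (Real.exp_le_exp.2 ?_) (Real.exp_le_exp.2 ?_) <;>
  · rw [hκ, ← add_div]
    gcongr
    linarith

theorem layer_le_of_le_half {ε t : ℝ} (hε : 0 < ε) (ht : t ≤ 1 / 2) :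
    layer ε t ≤ 2 * Real.exp (-t / ε) := by
  rw [layer, two_mul]
  gcongr
  linarith

theorem exp_neg_div_sq (ε t : ℝ) : Real.exp (-t / ε) ^ 2 = Real.exp (-(2 * t) / ε) := by
  rw [← Real.exp_nat_mul]
  congr 1
  push_cast
  ring

theorem layer_sq_le (ε t : ℝ) :
    layer ε t ^ 2 ≤ 2 * (Real.exp (-(2 * t) / ε) + Real.exp (-(2 * (1 - t)) / ε)) := by
  rw [← exp_neg_div_sq, ← exp_neg_div_sq, layer]
  exact add_sq_le

theorem integral_layer_sq_le_of_le_half {ε c : ℝ} (hε : 0 < ε) (hc : c ≤ 1 / 2) :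
    ∫ t in c..(1 - c), layer ε t ^ 2 ≤ 2 * ε * Real.exp (-c / ε) ^ 2 := by
  let G : ℝ → ℝ := fun t => ε * (Real.exp (-(2 * (1 - t)) / ε) - Real.exp (-(2 * t) / ε))
  let g : ℝ → ℝ := fun t => 2 * (Real.exp (-(2 * t) / ε) + Real.exp (-(2 * (1 - t)) / ε))
  have hg : IntervalIntegrable g volume c (1 - c) := Continuous.intervalIntegrable (by fun_prop) _ _
  have hderiv (t : ℝ) : HasDerivAt G (g t) t := by
    have hright : HasDerivAt (fun t : ℝ => -(2 * (1 - t)) / ε) (2 / ε) t := by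
      simpa using ((((hasDerivAt_id t).const_sub 1).const_mul 2).neg).div_const ε
    have hleft : HasDerivAt (fun t : ℝ => -(2 * t) / ε) (-2 / ε) t := by
      simpa using (((hasDerivAt_id t).const_mul 2).neg).div_const ε
    convert! (hright.exp.sub hleft.exp).const_mul ε using 1
    simp only [g]
    field_simp
    ring
  calc ∫ t in c..(1 - c), layer ε t ^ 2
      ≤ ∫ t in c..(1 - c), g t :=
        intervalIntegral.integral_mono_on (by linarith)
          (((continuous_layer ε).pow 2).intervalIntegrable _ _) hg fun t _ => layer_sq_le ε t
    _ = G (1 - c) - G c :=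
        intervalIntegral.integral_eq_sub_of_hasDerivAt (fun t _ => hderiv t) hg
    _ = 2 * ε * (Real.exp (-(2 * c) / ε) - Real.exp (-(2 * (1 - c)) / ε)) := by
        simp only [G, sub_sub_cancel]
        ring
    _ ≤ 2 * ε * Real.exp (-c / ε) ^ 2 := by
        rw [exp_neg_div_sq]
        gcongr
        exact sub_le_self _ (Real.exp_pos _).le

theorem integral_layer_sq_le {ε a b : ℝ} (hε : 0 < ε) (ha : 0 ≤ a) (hab : a ≤ b) (hb : b ≤ 1) :
    ∫ t in a..b, layer ε t ^ 2 ≤ 2 * ε := by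
  have hmono : ∫ t in a..b, layer ε t ^ 2 ≤ ∫ t in (0 : ℝ)..1, layer ε t ^ 2 :=
    intervalIntegral.integral_mono_interval ha hab hb
      (Filter.Eventually.of_forall fun t => sq_nonneg (layer ε t))
      (((continuous_layer ε).pow 2).intervalIntegrable _ _)
  simpa using hmono.trans (by simpa using integral_layer_sq_le_of_le_half (c := 0) hε (by norm_num))

/-! ### Shishkin meshes -/

/-- The parameters of a Shishkin mesh with `4 * n` cells and transition point `τ`. -/
structure ShishkinParameters (p n : ℕ) (σ ε τ : ℝ) : Prop where
  three_le : 3 ≤ p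
  n_pos : 0 < n
  le_sigma : (p : ℝ) + 1 ≤ σ
  eps_pos : 0 < ε
  eps_le_one : ε ≤ 1
  tau_eq : τ = σ * ε * Real.log (4 * n : ℕ)
  tau_le : τ ≤ 1 / 4

namespace ShishkinParameters

variable {p n i : ℕ} {σ ε τ : ℝ} (h : ShishkinParameters p n σ ε τ)
include h

theorem one_le_log : 1 ≤ Real.log (4 * n : ℕ) := by
  have hn : (1 : ℝ) ≤ n := by exact_mod_cast h.n_pos
  rw [Real.le_log_iff_exp_le (by push_cast; linarith)]
  push_cast
  linarith [Real.exp_one_lt_three]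

theorem one_le_sigma : 1 ≤ σ := (le_add_of_nonneg_left p.cast_nonneg).trans h.le_sigma

theorem sigma_pos : 0 < σ := zero_lt_one.trans_le h.one_le_sigma

theorem eps_le_tau : ε ≤ τ := by
  have := one_le_mul_of_one_le_of_one_le h.one_le_sigma h.one_le_log
  rw [h.tau_eq]
  nlinarith [h.eps_pos]

theorem mesh : MeshParameters n τ := ⟨h.n_pos, h.eps_pos.trans_le h.eps_le_tau, h.tau_le⟩

theorem tau_div_eps : τ / ε = σ * Real.log (4 * n : ℕ) := by
  have := h.eps_pos.ne'
  rw [h.tau_eq]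
  field_simp

theorem exp_neg_tau_div_eps_le : Real.exp (-τ / ε) ≤ (((4 * n : ℕ) : ℝ) ^ (p + 1))⁻¹ := by
  have hN : (0 : ℝ) < (4 * n : ℕ) := by have := h.n_pos; positivity
  have hlog := mul_le_mul_of_nonneg_right h.le_sigma (zero_le_one.trans h.one_le_log)
  rw [← Real.exp_log (pow_pos hN (p + 1)), ← Real.exp_neg, Real.exp_le_exp, Real.log_pow, neg_div,
    h.tau_div_eps]
  push_cast at hlog ⊢
  linarith

theorem layer_tau_le : layer ε τ ≤ 2 * (((4 * n : ℕ) : ℝ) ^ (p + 1))⁻¹ :=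
  (layer_le_of_le_half h.eps_pos (by linarith [h.tau_le])).trans
    (mul_le_mul_of_nonneg_left h.exp_neg_tau_div_eps_le zero_le_two)

theorem fine_length : τ / n = ε * (4 * σ * (Real.log (4 * n : ℕ) / (4 * n : ℕ))) := by
  have := h.n_pos.ne'
  rw [h.tau_eq]
  push_cast
  field_simp

theorem fine_length_le : τ / n ≤ 4 * σ * ε := by
  have := h.sigma_pos
  have := h.eps_pos
  have hlog : Real.log (4 * n : ℕ) / (4 * n : ℕ) ≤ 1 :=
    div_le_one_of_le₀ (Real.log_le_self (by positivity)) (by positivity)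
  calc τ / n = 4 * σ * ε * (Real.log (4 * n : ℕ) / (4 * n : ℕ)) := by rw [h.fine_length]; ring
    _ ≤ 4 * σ * ε * 1 := by gcongr
    _ = 4 * σ * ε := mul_one _

theorem node_sub_of_fine (hi : i < n ∨ 3 * n ≤ i) :
    node τ (4 * n) (i + 1) - node τ (4 * n) i = τ / n :=
  hi.elim (node_sub_of_lt h.n_pos) (node_sub_of_ge h.n_pos)

end ShishkinParameters

/-! ### Representatives of a layer decomposition -/

theorem eval_second_comp_one_sub (P : ℝ[X]) (t : ℝ) :
    (P.comp (1 - X)).derivative.derivative.eval t = P.derivative.derivative.eval (1 - t) := by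
  simp [derivative_comp]

theorem abs_eval_hermiteCubic_le {τ y : ℝ} (hτ : 0 < τ) (hy : y ∈ Icc 0 τ) (c d : ℝ) :
    |(hermiteCubic τ c d).eval y| ≤ |d| * τ + |c| * 3 := by
  obtain ⟨z, rfl⟩ : ∃ z, y = τ * z := ⟨y / τ, by field_simp⟩
  have hz₀ : 0 ≤ z := nonneg_of_mul_nonneg_right hy.1 hτ
  have hz₁ : z ≤ 1 := (mul_le_iff_le_one_right hτ).1 hy.2
  have hval : (hermiteCubic τ c d).eval (τ * z) =
      d * (τ * (z ^ 2 * (z - 1))) + c * (z ^ 2 * (3 - 2 * z)) := by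
    simp [hermiteCubic, chi₀, chi₁]
    field_simp
  have hslope : |z ^ 2 * (z - 1)| ≤ 1 := abs_le.2 ⟨by nlinarith, by nlinarith⟩
  have hvalue : |z ^ 2 * (3 - 2 * z)| ≤ 3 := abs_le.2 ⟨by nlinarith, by nlinarith⟩
  rw [hval]
  refine (abs_add_le _ _).trans ?_
  simp only [abs_mul d, abs_mul c, abs_mul τ, abs_of_pos hτ]
  gcongr
  exact mul_le_of_le_one_right hτ.le hslope

theorem abs_eval_second_hermiteCubic_le {τ y : ℝ} (hτ : 0 < τ) (hy : y ∈ Icc 0 τ) (c d : ℝ) :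
    |(hermiteCubic τ c d).derivative.derivative.eval y| ≤ |d| * (6 / τ) + |c| * (6 / τ ^ 2) := by
  obtain ⟨z, rfl⟩ : ∃ z, y = τ * z := ⟨y / τ, by field_simp⟩
  have hz₀ : 0 ≤ z := nonneg_of_mul_nonneg_right hy.1 hτ
  have hz₁ : z ≤ 1 := (mul_le_iff_le_one_right hτ).1 hy.2
  have hval : (hermiteCubic τ c d).derivative.derivative.eval (τ * z) =
      d * ((6 * z - 2) / τ) + c * ((6 - 12 * z) / τ ^ 2) := by
    simp [hermiteCubic, chi₀, chi₁]
    field_simp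
    ring
  have hslope : |6 * z - 2| ≤ 6 := abs_le.2 ⟨by linarith, by linarith⟩
  have hvalue : |6 - 12 * z| ≤ 6 := abs_le.2 ⟨by linarith, by linarith⟩
  rw [hval]
  refine (abs_add_le _ _).trans ?_
  simp only [abs_mul d, abs_mul c, abs_div, abs_of_pos hτ, abs_of_pos (pow_pos hτ 2)]
  gcongr

/-- A splitting `w = wreg + wbl` into a regular component, whose derivatives are bounded by `Breg`,
and a boundary layer component, whose derivatives grow like powers of `ε⁻¹`. -/
structure LayerSplitting (p : ℕ) (Breg Bbl ε : ℝ) (w wreg wbl : ℝ → ℝ) : Prop where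
  diff : DiffUpTo (p + 1) w
  diff_reg : DiffUpTo (p + 1) wreg
  sum : ∀ k ≤ p + 1, EqOn (D k w) (D k wreg + D k wbl) (Icc 0 1)
  bound_reg : ∀ t ∈ Icc (0 : ℝ) 1, |D (p + 1) wreg t| ≤ Breg
  bound_bl : ∀ k ≤ p + 1, ∀ t ∈ Icc (0 : ℝ) 1, |D k wbl t| ≤ Bbl * ((ε ^ k)⁻¹ * layer ε t)

/-- The relative size of the interpolation error on the fine cells. -/
noncomputable def fineFactor (p n : ℕ) (σ : ℝ) : ℝ :=
  Real.exp (4 * σ) * (4 * σ * (Real.log (4 * n : ℕ) / (4 * n : ℕ))) ^ (p + 1)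

/-- The relative size of the cubic corrections on the fine cells. -/
noncomputable def correctionFactor (p n : ℕ) (σ : ℝ) : ℝ :=
  2 * (σ + 12) * Real.log (4 * n : ℕ) * (((4 * n : ℕ) : ℝ) ^ (p + 1))⁻¹

section Bounds

variable {p n i : ℕ} {σ ε τ Breg Bbl t : ℝ} {w wreg wbl : ℝ → ℝ}

theorem LayerSplitting.splitting (hw : LayerSplitting p Breg Bbl ε w wreg wbl) (hp : 2 ≤ p) :
    Splitting w wreg wbl where
  diff := hw.diff.mono (by omega)
  diff_reg := hw.diff_reg.mono (by omega)
  value := by simpa only [D_zero] using hw.sum 0 (by omega)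
  slope := hw.sum 1 (by omega)

theorem LayerSplitting.exists_hermiteCubic (hw : LayerSplitting p Breg Bbl ε w wreg wbl)
    (h : MeshParameters n τ) (hi : i < 4 * n) (hfine : i < n ∨ 3 * n ≤ i)
    (ht : t ∈ Icc (node τ (4 * n) i) (node τ (4 * n) (i + 1))) :
    ∃ c d, ∃ y ∈ Icc 0 τ, |c| ≤ Bbl * layer ε τ ∧ |d| ≤ Bbl * (ε⁻¹ * layer ε τ) ∧
      (cellCorrection n τ wbl i).eval t = (hermiteCubic τ c d).eval y ∧
      (cellCorrection n τ wbl i).derivative.derivative.eval t =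
        (hermiteCubic τ c d).derivative.derivative.eval y := by
  have hx := h.isMesh
  have hvalue := hw.bound_bl 0 (by omega)
  have hslope := hw.bound_bl 1 (by omega)
  simp only [D_zero, pow_zero, inv_one, one_mul, pow_one] at hvalue hslope
  rcases hfine with hi' | hi'
  · have hτ : τ ∈ Icc (0 : ℝ) 1 := ⟨h.tau_pos.le, by linarith [h.tau_le]⟩
    have htτ : t ≤ τ := node_left_transition (τ := τ) h.n_pos ▸
      ht.2.trans (hx.mono (show i + 1 ≤ n from hi') (by omega))
    exact ⟨-wbl τ, -D 1 wbl τ, t, ⟨(hx.nonneg hi.le).trans ht.1, htτ⟩,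
      (abs_neg _).trans_le (hvalue τ hτ), (abs_neg _).trans_le (hslope τ hτ),
      by rw [cellCorrection_of_lt hi'], by rw [cellCorrection_of_lt hi']⟩
  · have hτ : 1 - τ ∈ Icc (0 : ℝ) 1 := ⟨by linarith [h.tau_le], by linarith [h.tau_pos]⟩
    have htτ : 1 - τ ≤ t := node_right_transition (τ := τ) h.n_pos ▸
      (hx.mono hi' hi.le).trans ht.1
    have ht₁ : t ≤ 1 := ht.2.trans (hx.le_one hi)
    refine ⟨-wbl (1 - τ), D 1 wbl (1 - τ), 1 - t, ⟨by linarith, by linarith⟩,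
      (abs_neg _).trans_le ((hvalue _ hτ).trans_eq ?_), (hslope _ hτ).trans_eq ?_, ?_, ?_⟩
    · rw [layer_one_sub]
    · rw [layer_one_sub]
    · simp [cellCorrection_of_ge h.n_pos hi', eval_comp]
    · rw [cellCorrection_of_ge h.n_pos hi', eval_second_comp_one_sub]

theorem ShishkinParameters.layer_tau_mul_le (h : ShishkinParameters p n σ ε τ) :
    layer ε τ * (σ * Real.log (4 * n : ℕ) + 12) ≤ correctionFactor p n σ := by
  have hlog := h.one_le_log
  have := h.sigma_pos
  calc _ ≤ 2 * (((4 * n : ℕ) : ℝ) ^ (p + 1))⁻¹ * ((σ + 12) * Real.log (4 * n : ℕ)) := by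
        gcongr
        · exact h.layer_tau_le
        · linarith
    _ = correctionFactor p n σ := by
        rw [correctionFactor]
        ring

theorem LayerSplitting.abs_cellCorrection_le (hw : LayerSplitting p Breg Bbl ε w wreg wbl)
    (h : ShishkinParameters p n σ ε τ) (hB : 0 ≤ Bbl) (hi : i < 4 * n)
    (hfine : i < n ∨ 3 * n ≤ i)
    (ht : t ∈ Icc (node τ (4 * n) i) (node τ (4 * n) (i + 1))) :
    |(cellCorrection n τ wbl i).eval t| ≤ Bbl * correctionFactor p n σ ∧
      |(cellCorrection n τ wbl i).derivative.derivative.eval t| ≤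
        Bbl * correctionFactor p n σ * (ε ^ 2)⁻¹ := by
  obtain ⟨c, d, y, hy, hc, hd, hvalue, hsecond⟩ := hw.exists_hermiteCubic h.mesh hi hfine ht
  have hε := h.eps_pos
  have hτ := h.mesh.tau_pos
  have hετ := h.eps_le_tau
  have hlayer := (layer_pos ε τ).le
  have hfactor := h.layer_tau_mul_le
  have hσlog : 0 ≤ σ * Real.log (4 * n : ℕ) :=
    mul_nonneg h.sigma_pos.le (zero_le_one.trans h.one_le_log)
  rw [hvalue, hsecond]
  constructor
  · calc _ ≤ |d| * τ + |c| * 3 := abs_eval_hermiteCubic_le hτ hy c d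
      _ ≤ Bbl * (ε⁻¹ * layer ε τ) * τ + Bbl * layer ε τ * 3 := by gcongr
      _ = Bbl * (layer ε τ * (τ / ε + 3)) := by ring
      _ ≤ Bbl * (layer ε τ * (σ * Real.log (4 * n : ℕ) + 12)) := by
        rw [h.tau_div_eps]
        gcongr
        norm_num
      _ ≤ _ := by gcongr
  · calc _ ≤ |d| * (6 / τ) + |c| * (6 / τ ^ 2) := abs_eval_second_hermiteCubic_le hτ hy c d
      _ ≤ Bbl * (ε⁻¹ * layer ε τ) * (6 / ε) + Bbl * layer ε τ * (6 / ε ^ 2) := by gcongr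
      _ = Bbl * (layer ε τ * (0 + 12)) * (ε ^ 2)⁻¹ := by field_simp; ring
      _ ≤ Bbl * (layer ε τ * (σ * Real.log (4 * n : ℕ) + 12)) * (ε ^ 2)⁻¹ := by gcongr
      _ ≤ _ := by gcongr

theorem LayerSplitting.abs_D_le_of_fine (hw : LayerSplitting p Breg Bbl ε w wreg wbl)
    (h : ShishkinParameters p n σ ε τ) (hB : 0 ≤ Bbl) (hi : i < 4 * n)
    (hfine : i < n ∨ 3 * n ≤ i) {s : ℝ}
    (hs : s ∈ Icc (node τ (4 * n) i) (node τ (4 * n) (i + 1)))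
    (ht : t ∈ Icc (node τ (4 * n) i) (node τ (4 * n) (i + 1))) :
    |D (p + 1) w s| ≤ Breg + Bbl * ((ε ^ (p + 1))⁻¹ * (Real.exp (4 * σ) * layer ε t)) := by
  have hε := h.eps_pos
  have hmem := h.mesh.isMesh.cell_subset hi hs
  have hdist : |t - s| ≤ 4 * σ * ε :=
    (abs_sub_le_of_le_of_le ht.1 ht.2 hs.1 hs.2).trans
      ((h.node_sub_of_fine hfine).trans_le h.fine_length_le)
  calc |D (p + 1) w s| ≤ |D (p + 1) wreg s| + |D (p + 1) wbl s| := by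
        rw [hw.sum _ le_rfl hmem]
        exact abs_add_le _ _
    _ ≤ Breg + Bbl * ((ε ^ (p + 1))⁻¹ * layer ε s) :=
        add_le_add (hw.bound_reg _ hmem) (hw.bound_bl _ le_rfl _ hmem)
    _ ≤ _ := by
        gcongr
        exact layer_le_of_abs_sub_le hε hdist

theorem LayerSplitting.abs_interp_sub_le_of_fine (hw : LayerSplitting p Breg Bbl ε w wreg wbl)
    (h : ShishkinParameters p n σ ε τ) (hBreg : 0 ≤ Breg) (hB : Breg ≤ Bbl) (hi : i < 4 * n)
    (hfine : i < n ∨ 3 * n ≤ i) {P : ℝ[X]}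
    (hP : IsLocalInterp p (node τ (4 * n) i) (node τ (4 * n) (i + 1)) w P)
    (ht : t ∈ Icc (node τ (4 * n) i) (node τ (4 * n) (i + 1))) :
    |P.eval t - w t| ≤ Bbl * (fineFactor p n σ * (Real.sqrt ε + layer ε t)) := by
  have hε := h.eps_pos
  have hBbl := hBreg.trans hB
  have hp : 2 ≤ p := (Nat.le_succ 2).trans h.three_le
  have hexp : 1 ≤ Real.exp (4 * σ) := Real.one_le_exp (by linarith [h.sigma_pos])
  have hpow : ε ^ (p + 1) ≤ Real.sqrt ε :=
    (pow_le_of_le_one hε.le h.eps_le_one p.succ_ne_zero).trans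
      (Real.le_sqrt_of_sq_le (pow_le_of_le_one hε.le h.eps_le_one two_ne_zero))
  have hg : 0 ≤ 4 * σ * (Real.log (4 * n : ℕ) / (4 * n : ℕ)) := by
    have := h.one_le_log
    have := h.sigma_pos
    positivity
  refine (hP.abs_sub_le hp hw.diff (h.mesh.isMesh.cell_subset hi)
    (fun s hs => hw.abs_D_le_of_fine h hBbl hi hfine hs ht) ht).trans ?_
  rw [h.node_sub_of_fine hfine, h.fine_length, mul_pow, fineFactor]
  generalize 4 * σ * (Real.log (4 * n : ℕ) / (4 * n : ℕ)) = g at hg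
  calc _ = g ^ (p + 1) * (Breg * ε ^ (p + 1) + Bbl * (Real.exp (4 * σ) * layer ε t)) := by
        field_simp
    _ ≤ g ^ (p + 1) *
          (Bbl * (Real.exp (4 * σ) * Real.sqrt ε) + Bbl * (Real.exp (4 * σ) * layer ε t)) := by
        gcongr
        exact hpow.trans (le_mul_of_one_le_left (Real.sqrt_nonneg ε) hexp)
    _ = _ := by ring

theorem LayerSplitting.abs_interp_sub_le_of_coarse (hw : LayerSplitting p Breg Bbl ε w wreg wbl)
    (h : MeshParameters n τ) (hp : 2 ≤ p) (hBreg : 0 ≤ Breg) (hi : n ≤ i) (hi' : i < 3 * n)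
    {P : ℝ[X]} (hP : IsLocalInterp p (node τ (4 * n) i) (node τ (4 * n) (i + 1)) wreg P)
    (ht : t ∈ Icc (node τ (4 * n) i) (node τ (4 * n) (i + 1))) :
    |P.eval t - wreg t| ≤ Breg * (2 / (4 * n : ℕ)) ^ (p + 1) := by
  have hsub := h.isMesh.cell_subset (show i < 4 * n by omega)
  have hlength : (1 - 2 * τ) / (2 * n) ≤ 2 / (4 * n : ℕ) := by
    have hn : (2 : ℝ) / (4 * n : ℕ) = 1 / (2 * n) := by push_cast; field_simp; norm_num
    rw [hn]
    gcongr
    linarith [h.tau_pos]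
  refine (hP.abs_sub_le hp hw.diff_reg hsub (fun s hs => hw.bound_reg s (hsub hs)) ht).trans ?_
  rw [node_sub_of_mem h.n_pos hi hi']
  gcongr
  exact div_nonneg (by linarith [h.tau_le]) (by positivity)

end Bounds

/-! ### The error of the special representative -/

/-- The error of the special representative on the `i`-th cell: the interpolation error of the
function that is interpolated there, and the correction together with the layer component that the
coarse cells leave out. -/
noncomputable def cellError (p n : ℕ) (τ : ℝ) (w wreg wbl : ℝ → ℝ) (i : ℕ) : SplitError where
  interp t := (localInterp p (node τ (4 * n) i) (node τ (4 * n) (i + 1))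
    (cellTarget n w wreg i)).eval t - cellTarget n w wreg i t
  interp₂ t := (localInterp p (node τ (4 * n) i) (node τ (4 * n) (i + 1))
    (cellTarget n w wreg i)).derivative.derivative.eval t - D 2 (cellTarget n w wreg i) t
  corr t := (cellCorrection n τ wbl i).eval t + (cellTarget n w wreg i t - w t)
  corr₂ t := (cellCorrection n τ wbl i).derivative.derivative.eval t
    + (D 2 (cellTarget n w wreg i) t - D 2 w t)

/-- Bounds on a split error at the point `t`; in the correction each derivative may cost a factor
`ε⁻¹`. -/
structure SplitError.IsBoundedAt (ε θ κ : ℝ) (S : SplitError) (t : ℝ) : Prop where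
  interp_le : |S.interp t| ≤ θ
  corr_le : |S.corr t| ≤ κ
  corr₂_le : |S.corr₂ t| ≤ κ * (ε ^ 2)⁻¹

theorem SplitError.IsBoundedAt.errorDensity_le {U V : SplitError} {lam ε μ θ θ' κ t : ℝ}
    (hε : 0 < ε) (hU : U.IsBoundedAt ε θ κ t)
    (hV : V.IsBoundedAt ε θ' ((Real.sqrt ε)⁻¹ * κ) t) :
    errorDensity lam ε μ U V t ≤
      θ' ^ 2 + (1 + (lam - 4) ^ 2 * μ ^ 2) * θ ^ 2 + 4 * (ε⁻¹ * κ ^ 2) := by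
  have sq_le {x y : ℝ} (hxy : |x| ≤ y) : x ^ 2 ≤ y ^ 2 :=
    sq_le_sq' (abs_le.1 hxy).1 (abs_le.1 hxy).2
  have hsqrt : (Real.sqrt ε)⁻¹ ^ 2 = ε⁻¹ := by rw [inv_pow, Real.sq_sqrt hε.le]
  have hUinterp := mul_le_mul_of_nonneg_left (sq_le hU.interp_le)
    (show 0 ≤ 1 + (lam - 4) ^ 2 * μ ^ 2 by positivity)
  have hUcorr := mul_le_mul_of_nonneg_left (sq_le hU.corr_le) (inv_pos.2 hε).le
  have hUcorr₂ : ε ^ 3 * U.corr₂ t ^ 2 ≤ ε⁻¹ * κ ^ 2 :=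
    (mul_le_mul_of_nonneg_left (sq_le hU.corr₂_le) (by positivity)).trans_eq (by field_simp)
  have hVcorr : V.corr t ^ 2 ≤ ε⁻¹ * κ ^ 2 := by
    simpa only [mul_pow, hsqrt] using sq_le hV.corr_le
  have hVcorr₂ : ε ^ 4 * V.corr₂ t ^ 2 ≤ ε⁻¹ * κ ^ 2 := by
    refine (mul_le_mul_of_nonneg_left (sq_le hV.corr₂_le) (by positivity)).trans_eq ?_
    rw [mul_pow, mul_pow, hsqrt]
    field_simp
  rw [errorDensity]
  linarith [sq_le hV.interp_le]

section CellError

variable {p n i : ℕ} {ε τ : ℝ} {w wreg : ℝ → ℝ}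

theorem isAdmissible_cellError (h : MeshParameters n τ) (hp : 3 ≤ p) (hw : DiffUpTo 3 w)
    (hreg : DiffUpTo 3 wreg) (wbl : ℝ → ℝ) (hi : i < 4 * n) :
    (cellError p n τ w wreg wbl i).IsAdmissible p (node τ (4 * n) i) (node τ (4 * n) (i + 1)) := by
  have hsub := h.isMesh.cell_subset hi
  have htarget := hw.cellTarget hreg n i
  have hI := isLocalInterp_cellTarget h (by omega) hw hreg hi (p := p)
  have htarget₀ : ContinuousOn (D 0 (cellTarget n w wreg i)) _ :=
    htarget.continuousOn (by omega) hsub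
  have htarget₂ : ContinuousOn (D 2 (cellTarget n w wreg i)) _ :=
    htarget.continuousOn (by omega) hsub
  have hw₀ : ContinuousOn (D 0 w) _ := hw.continuousOn (by omega) hsub
  have hw₂ : ContinuousOn (D 2 w) _ := hw.continuousOn (by omega) hsub
  rw [D_zero] at htarget₀ hw₀
  refine ⟨?_, ?_, ?_, ?_, fun E hE => hI.orth _ ?_,
    hI.integral_second_mul hp htarget (h.isMesh.lt i hi).le hsub⟩
  iterate 4 unfold cellError; fun_prop
  have hdegree := natDegree_derivative_le E
  have hdegree₂ := natDegree_derivative_le E.derivative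
  omega

theorem bilinDensity_specialPoly_sub_loadDensity {u ureg ubl v vreg vbl : ℝ → ℝ} {t : ℝ}
    (hε : 0 < ε) (hv : v t = ε ^ (3 / 2 : ℝ) * D 2 u t)
    (hv₂ : D 2 v t = ε ^ (3 / 2 : ℝ) * D 4 u t) (lam : ℝ) (E F : ℝ[X]) :
    bilinDensity lam ε (specialPoly p n τ u ureg ubl i) (specialPoly p n τ v vreg vbl i) E F t -
        loadDensity ε u E F t =
      consistencyDensity lam ε (cellError p n τ u ureg ubl i) (cellError p n τ v vreg vbl i)
        E F t := by
  have hpow : ε ^ 4 = ε ^ (5 / 2 : ℝ) * ε ^ (3 / 2 : ℝ) := by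
    rw [← Real.rpow_add hε, ← Real.rpow_natCast]
    norm_num
  simp only [bilinDensity, loadDensity, consistencyDensity, cellError, specialPoly, eval_add,
    derivative_add]
  rw [hv, hv₂, hpow]
  ring

variable {σ Breg Bbl t : ℝ} {wbl : ℝ → ℝ}

theorem LayerSplitting.isBoundedAt_cellError_of_fine
    (hw : LayerSplitting p Breg Bbl ε w wreg wbl) (h : ShishkinParameters p n σ ε τ)
    (hBreg : 0 ≤ Breg) (hB : Breg ≤ Bbl) (hi : i < 4 * n) (hfine : i < n ∨ 3 * n ≤ i)
    (ht : t ∈ Icc (node τ (4 * n) i) (node τ (4 * n) (i + 1))) :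
    (cellError p n τ w wreg wbl i).IsBoundedAt ε
      (Bbl * (fineFactor p n σ * (Real.sqrt ε + layer ε t))) (Bbl * correctionFactor p n σ) t := by
  have hp : 2 ≤ p := (Nat.le_succ 2).trans h.three_le
  have hsplit := hw.splitting hp
  have htarget : cellTarget n w wreg i = w := hfine.elim cellTarget_of_lt cellTarget_of_ge
  have hI := isLocalInterp_cellTarget h.mesh hp hsplit.diff hsplit.diff_reg hi
  rw [htarget] at hI
  obtain ⟨hvalue, hsecond⟩ := hw.abs_cellCorrection_le h (hBreg.trans hB) hi hfine ht
  refine ⟨?_, ?_, ?_⟩ <;> simp only [cellError, htarget, sub_self, add_zero]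
  · exact hw.abs_interp_sub_le_of_fine h hBreg hB hi hfine hI ht
  · exact hvalue
  · exact hsecond

theorem LayerSplitting.isBoundedAt_cellError_of_coarse
    (hw : LayerSplitting p Breg Bbl ε w wreg wbl) (h : MeshParameters n τ) (hp : 2 ≤ p)
    (hBreg : 0 ≤ Breg) (hi : n ≤ i) (hi' : i < 3 * n)
    (ht : t ∈ Icc (node τ (4 * n) i) (node τ (4 * n) (i + 1))) :
    (cellError p n τ w wreg wbl i).IsBoundedAt ε
      (Breg * (2 / (4 * n : ℕ)) ^ (p + 1)) (Bbl * layer ε t) t := by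
  have hin : i < 4 * n := by omega
  have hmem := h.isMesh.cell_subset hin ht
  have hsplit := hw.splitting hp
  have htarget : cellTarget n w wreg i = wreg := cellTarget_of_mem hi hi'
  have hI := isLocalInterp_cellTarget h hp hsplit.diff hsplit.diff_reg hin
  rw [htarget] at hI
  have hvalue := hw.bound_bl 0 (by omega) t hmem
  have hsecond := hw.bound_bl 2 (by omega) t hmem
  refine ⟨?_, ?_, ?_⟩ <;> simp only [cellError, htarget, cellCorrection_of_mem hi hi',
    derivative_zero, eval_zero, zero_add]
  · exact hw.abs_interp_sub_le_of_coarse h hp hBreg hi hi' hI ht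
  · rw [hsplit.value hmem]
    simpa using hvalue
  · rw [hw.sum 2 (by omega) hmem, mul_assoc, mul_comm (layer ε t)]
    simpa using hsecond

end CellError

section ErrorDensity

variable {p n i : ℕ} {σ ε τ B t : ℝ} {u ureg ubl v vreg vbl : ℝ → ℝ}

theorem errorDensity_cellError_le_of_fine (h : ShishkinParameters p n σ ε τ) (hB : 0 ≤ B)
    (hu : LayerSplitting p B B ε u ureg ubl)
    (hv : LayerSplitting p B ((Real.sqrt ε)⁻¹ * B) ε v vreg vbl) (lam : ℝ) (hi : i < 4 * n)
    (hfine : i < n ∨ 3 * n ≤ i)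
    (ht : t ∈ Icc (node τ (4 * n) i) (node τ (4 * n) (i + 1))) :
    errorDensity lam ε (Real.sqrt ε)⁻¹ (cellError p n τ u ureg ubl i)
        (cellError p n τ v vreg vbl i) t ≤
      2 * (2 + (lam - 4) ^ 2) * (B * fineFactor p n σ) ^ 2 * (1 + ε⁻¹ * layer ε t ^ 2) +
        4 * (ε⁻¹ * (B * correctionFactor p n σ) ^ 2) := by
  have hε := h.eps_pos
  have hsqrt : 1 ≤ (Real.sqrt ε)⁻¹ :=
    (one_le_inv₀ (Real.sqrt_pos.2 hε)).2 (Real.sqrt_le_one.2 h.eps_le_one)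
  have hU := hu.isBoundedAt_cellError_of_fine h hB le_rfl hi hfine ht
  have hV := hv.isBoundedAt_cellError_of_fine h hB (le_mul_of_one_le_left hB hsqrt) hi hfine ht
  rw [mul_assoc _ B (correctionFactor p n σ)] at hV
  refine (hU.errorDensity_le hε hV).trans (add_le_add_left ?_ _)
  have hinv : 1 ≤ ε⁻¹ := (one_le_inv₀ hε).2 h.eps_le_one
  have hsum := add_sq_le (a := Real.sqrt ε) (b := layer ε t)
  rw [Real.sq_sqrt hε.le] at hsum
  set g := B * fineFactor p n σ with hg
  set y := Real.sqrt ε + layer ε t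
  have hgy : (g * y) ^ 2 ≤ ε⁻¹ * (g * y) ^ 2 := le_mul_of_one_le_left (sq_nonneg _) hinv
  calc _ = ε⁻¹ * (g * y) ^ 2 + (g * y) ^ 2 + (lam - 4) ^ 2 * (ε⁻¹ * (g * y) ^ 2) := by
        rw [mul_assoc _ B, mul_pow _ (B * _), ← mul_assoc B, ← hg, inv_pow, Real.sq_sqrt hε.le]
        ring
    _ ≤ (2 + (lam - 4) ^ 2) * g ^ 2 * (ε⁻¹ * y ^ 2) := by linarith
    _ ≤ (2 + (lam - 4) ^ 2) * g ^ 2 * (ε⁻¹ * (2 * (ε + layer ε t ^ 2))) := by gcongr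
    _ = _ := by field_simp

theorem errorDensity_cellError_le_of_coarse (h : MeshParameters n τ) (hp : 2 ≤ p) (hε : 0 < ε)
    (hB : 0 ≤ B) (hu : LayerSplitting p B B ε u ureg ubl)
    (hv : LayerSplitting p B ((Real.sqrt ε)⁻¹ * B) ε v vreg vbl) (lam μ : ℝ) (hi : n ≤ i)
    (hi' : i < 3 * n) (ht : t ∈ Icc (node τ (4 * n) i) (node τ (4 * n) (i + 1))) :
    errorDensity lam ε μ (cellError p n τ u ureg ubl i) (cellError p n τ v vreg vbl i) t ≤
      (2 + (lam - 4) ^ 2 * μ ^ 2) * (B * (2 / (4 * n : ℕ)) ^ (p + 1)) ^ 2 +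
        4 * B ^ 2 * (ε⁻¹ * layer ε t ^ 2) := by
  have hU := hu.isBoundedAt_cellError_of_coarse h hp hB hi hi' ht
  have hV := hv.isBoundedAt_cellError_of_coarse h hp hB hi hi' ht
  rw [mul_assoc _ B (layer ε t)] at hV
  exact (hU.errorDensity_le hε hV).trans_eq (by ring)

end ErrorDensity

/-! ### Inverse estimates on the mesh -/

/-- The weight of `errorDensity` on the coarse cells: the cost of an inverse estimate for
`ε ^ (3 / 2) * F''`, or of its trivial bound by the energy, whichever is smaller. -/
noncomputable def coarseWeight (n : ℕ) (ε : ℝ) : ℝ :=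
  min (ε ^ (3 / 2 : ℝ) * ((4 * n : ℕ) : ℝ) ^ 2) (ε ^ (-(1 / 2) : ℝ))

/-- The weight of `errorDensity` on the `i`-th cell. -/
noncomputable def cellWeight (n : ℕ) (ε : ℝ) (i : ℕ) : ℝ :=
  if n ≤ i ∧ i < 3 * n then coarseWeight n ε else (Real.sqrt ε)⁻¹

section InverseEstimates

variable {p n i : ℕ} {ε τ K a b : ℝ} {F : ℝ[X]}

theorem cellWeight_of_mem (hi : n ≤ i) (hi' : i < 3 * n) : cellWeight n ε i = coarseWeight n ε :=
  if_pos ⟨hi, hi'⟩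

theorem cellWeight_of_fine (hfine : i < n ∨ 3 * n ≤ i) : cellWeight n ε i = (Real.sqrt ε)⁻¹ :=
  if_neg (by omega)

theorem coarseWeight_pos (hn : 0 < n) (hε : 0 < ε) : 0 < coarseWeight n ε :=
  lt_min (by positivity) (by positivity)

theorem cellWeight_pos (hn : 0 < n) (hε : 0 < ε) (i : ℕ) : 0 < cellWeight n ε i := by
  unfold cellWeight
  split_ifs
  · exact coarseWeight_pos hn hε
  · positivity

theorem integral_sq_le_integral_energyDensity (hε : 0 ≤ ε) (hab : a ≤ b) (E F : ℝ[X]) :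
    ∫ t in a..b, F.eval t ^ 2 ≤ ∫ t in a..b, energyDensity ε E F t := by
  refine intervalIntegral.integral_mono_on hab (Continuous.intervalIntegrable (by fun_prop) _ _)
    ((continuous_energyDensity ε E F).intervalIntegrable _ _) fun t _ => ?_
  have : 0 ≤ E.eval t ^ 2 + ε ^ 3 * E.derivative.derivative.eval t ^ 2
    + ε ^ 4 * F.derivative.derivative.eval t ^ 2 := by positivity
  rw [energyDensity]
  linarith

theorem integral_second_sq_le_inv_mul_energy (hε : 0 < ε) (hab : a ≤ b) (E F : ℝ[X]) :
    ε ^ 3 * ∫ t in a..b, F.derivative.derivative.eval t ^ 2 ≤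
      (Real.sqrt ε)⁻¹ ^ 2 * ∫ t in a..b, energyDensity ε E F t := by
  rw [inv_pow, Real.sq_sqrt hε.le, ← intervalIntegral.integral_const_mul,
    ← intervalIntegral.integral_const_mul]
  refine intervalIntegral.integral_mono_on hab (Continuous.intervalIntegrable (by fun_prop) _ _)
    (((continuous_energyDensity ε E F).const_mul _).intervalIntegrable _ _) fun t _ => ?_
  have : 0 ≤ E.eval t ^ 2 + ε ^ 3 * E.derivative.derivative.eval t ^ 2 + F.eval t ^ 2 := by
    positivity
  calc ε ^ 3 * F.derivative.derivative.eval t ^ 2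
      = ε⁻¹ * (ε ^ 4 * F.derivative.derivative.eval t ^ 2) := by field_simp
    _ ≤ ε⁻¹ * energyDensity ε E F t := by
        rw [energyDensity]
        gcongr
        linarith

theorem integral_second_sq_le_of_coarse (h : MeshParameters n τ)
    (hinv : ∀ a b : ℝ, a < b → (b - a) ^ 4 * ∫ t in a..b, F.derivative.derivative.eval t ^ 2 ≤
      K * ∫ t in a..b, F.eval t ^ 2) (hi : n ≤ i) (hi' : i < 3 * n) :
    ∫ t in node τ (4 * n) i..node τ (4 * n) (i + 1), F.derivative.derivative.eval t ^ 2 ≤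
      K * ((4 * n : ℕ) : ℝ) ^ 4 *
        ∫ t in node τ (4 * n) i..node τ (4 * n) (i + 1), F.eval t ^ 2 := by
  have hn : (0 : ℝ) < n := by exact_mod_cast h.n_pos
  have hlt := h.isMesh.lt i (by omega)
  have hcell := hinv _ _ hlt
  have hI : 0 ≤ ∫ t in node τ (4 * n) i..node τ (4 * n) (i + 1),
      F.derivative.derivative.eval t ^ 2 :=
    intervalIntegral.integral_nonneg hlt.le fun _ _ => sq_nonneg _
  rw [node_sub_of_mem h.n_pos hi hi'] at hcell
  have hlength : 1 ≤ ((4 * n : ℕ) : ℝ) * ((1 - 2 * τ) / (2 * n)) := by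
    have : ((4 * n : ℕ) : ℝ) * ((1 - 2 * τ) / (2 * n)) = 2 * (1 - 2 * τ) := by
      push_cast
      field_simp
      ring
    linarith [h.tau_le]
  calc _ ≤ (((4 * n : ℕ) : ℝ) * ((1 - 2 * τ) / (2 * n))) ^ 4 * _ :=
        le_mul_of_one_le_left hI (one_le_pow₀ hlength)
    _ = ((4 * n : ℕ) : ℝ) ^ 4 * (((1 - 2 * τ) / (2 * n)) ^ 4 * _) := by rw [mul_pow, mul_assoc]
    _ ≤ ((4 * n : ℕ) : ℝ) ^ 4 * (K * _) := by gcongr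
    _ = _ := by ring

theorem integral_second_sq_le_cellWeight (h : MeshParameters n τ) (hε : 0 < ε) (hK : 0 ≤ K)
    (hinv : ∀ a b : ℝ, a < b → (b - a) ^ 4 * ∫ t in a..b, F.derivative.derivative.eval t ^ 2 ≤
      K * ∫ t in a..b, F.eval t ^ 2) (E : ℝ[X]) (hi : i < 4 * n) :
    ε ^ 3 * ∫ t in node τ (4 * n) i..node τ (4 * n) (i + 1),
        F.derivative.derivative.eval t ^ 2 ≤
      (K + 1) * cellWeight n ε i ^ 2 *
        ∫ t in node τ (4 * n) i..node τ (4 * n) (i + 1), energyDensity ε E F t := by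
  have hlt := (h.isMesh.lt i hi).le
  have henergy := integral_sq_le_integral_energyDensity hε.le hlt E F
  have hpos : 0 ≤ ∫ t in node τ (4 * n) i..node τ (4 * n) (i + 1), energyDensity ε E F t :=
    (intervalIntegral.integral_nonneg hlt fun _ _ => sq_nonneg _).trans henergy
  have htrivial := (integral_second_sq_le_inv_mul_energy hε hlt E F).trans
    (mul_le_mul_of_nonneg_right (le_mul_of_one_le_left (sq_nonneg _)
      (le_add_of_nonneg_left hK)) hpos)
  by_cases hcoarse : n ≤ i ∧ i < 3 * n
  · rw [cellWeight_of_mem hcoarse.1 hcoarse.2]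
    rcases min_choice (ε ^ (3 / 2 : ℝ) * ((4 * n : ℕ) : ℝ) ^ 2) (ε ^ (-(1 / 2) : ℝ)) with hm | hm
    · have hpow : (ε ^ (3 / 2 : ℝ)) ^ 2 = ε ^ 3 := by
        rw [rpow_three_halves hε.le, pow_right_comm, Real.sq_sqrt hε.le]
      calc _ ≤ ε ^ 3 * (K * ((4 * n : ℕ) : ℝ) ^ 4 * _) :=
            mul_le_mul_of_nonneg_left
              (integral_second_sq_le_of_coarse h hinv hcoarse.1 hcoarse.2) (by positivity)
        _ ≤ ε ^ 3 * ((K + 1) * ((4 * n : ℕ) : ℝ) ^ 4 *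
              ∫ t in node τ (4 * n) i..node τ (4 * n) (i + 1), energyDensity ε E F t) := by
            gcongr
            · exact intervalIntegral.integral_nonneg hlt fun _ _ => sq_nonneg _
            · linarith
        _ = _ := by rw [coarseWeight, hm, mul_pow, hpow]; ring
    · rwa [coarseWeight, hm, rpow_neg_half hε.le]
  · rwa [cellWeight_of_fine (by omega)]

end InverseEstimates

/-! ### The consistency error on the mesh -/

section Sums

variable {x : ℕ → ℝ} {N a b n : ℕ} {τ : ℝ} {φ : ℕ → ℝ → ℝ} {g k : ℝ → ℝ}

theorem IsMesh.sum_Ico_integral_le (hx : IsMesh x N) (hab : a ≤ b) (hb : b ≤ N)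
    (hφ : ∀ i < N, ContinuousOn (φ i) (Icc (x i) (x (i + 1)))) (hg : Continuous g)
    (hle : ∀ i ∈ Finset.Ico a b, ∀ t ∈ Icc (x i) (x (i + 1)), φ i t ≤ g t) :
    ∑ i ∈ Finset.Ico a b, ∫ t in x i..x (i + 1), φ i t ≤ ∫ t in x a..x b, g t := by
  rw [← intervalIntegral.sum_integral_adjacent_intervals_Ico hab fun i _ =>
    hg.intervalIntegrable _ _]
  refine Finset.sum_le_sum fun i hi => ?_
  have hiN : i < N := (Finset.mem_Ico.1 hi).2.trans_le hb
  have hlt := (hx.lt i hiN).le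
  exact intervalIntegral.integral_mono_on hlt ((hφ i hiN).intervalIntegrable_of_Icc hlt)
    (hg.intervalIntegrable _ _) (hle i hi)

theorem MeshParameters.sum_integral_le (h : MeshParameters n τ)
    (hφ : ∀ i < 4 * n, ContinuousOn (φ i) (Icc (node τ (4 * n) i) (node τ (4 * n) (i + 1))))
    (hg : Continuous g) (hk : Continuous k)
    (hfine : ∀ i < 4 * n, (i < n ∨ 3 * n ≤ i) →
      ∀ t ∈ Icc (node τ (4 * n) i) (node τ (4 * n) (i + 1)), φ i t ≤ g t)
    (hcoarse : ∀ i, n ≤ i → i < 3 * n →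
      ∀ t ∈ Icc (node τ (4 * n) i) (node τ (4 * n) (i + 1)), φ i t ≤ k t) :
    ∑ i ∈ Finset.range (4 * n), ∫ t in node τ (4 * n) i..node τ (4 * n) (i + 1), φ i t ≤
      (∫ t in 0..τ, g t) + (∫ t in τ..(1 - τ), k t) + ∫ t in (1 - τ)..1, g t := by
  have hx := h.isMesh
  have hleft := hx.sum_Ico_integral_le (Nat.zero_le n) (by omega) hφ hg fun i hi =>
    hfine i (by grind) (.inl (Finset.mem_Ico.1 hi).2)
  have hmiddle := hx.sum_Ico_integral_le (a := n) (b := 3 * n) (by omega) (by omega) hφ hk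
    fun i hi => hcoarse i (Finset.mem_Ico.1 hi).1 (Finset.mem_Ico.1 hi).2
  have hright := hx.sum_Ico_integral_le (a := 3 * n) (by omega) le_rfl hφ hg fun i hi =>
    hfine i (Finset.mem_Ico.1 hi).2 (.inr (Finset.mem_Ico.1 hi).1)
  rw [hx.first, node_left_transition h.n_pos] at hleft
  rw [node_left_transition h.n_pos, node_right_transition h.n_pos] at hmiddle
  rw [node_right_transition h.n_pos, hx.last] at hright
  rw [Finset.range_eq_Ico, ← Finset.sum_Ico_consecutive _ (Nat.zero_le (3 * n)) (by omega),
    ← Finset.sum_Ico_consecutive _ (Nat.zero_le n) (by omega)]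
  exact add_le_add (add_le_add hleft hmiddle) hright

end Sums

section LayerIntegrals

variable {ε : ℝ}

theorem integral_add_mul_layer_sq (ε c d a b : ℝ) :
    ∫ t in a..b, (c + d * (ε⁻¹ * layer ε t ^ 2)) =
      c * (b - a) + d * (ε⁻¹ * ∫ t in a..b, layer ε t ^ 2) := by
  have hlayer : IntervalIntegrable (fun t => layer ε t ^ 2) volume a b :=
    ((continuous_layer ε).pow 2).intervalIntegrable a b
  rw [intervalIntegral.integral_add (by simp) ((hlayer.const_mul _).const_mul _),
    intervalIntegral.integral_const_mul, intervalIntegral.integral_const_mul,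
    intervalIntegral.integral_const, smul_eq_mul, mul_comm (b - a)]

theorem integral_add_mul_layer_sq_le {a b c d : ℝ} (hε : 0 < ε) (hd : 0 ≤ d) (ha : 0 ≤ a)
    (hab : a ≤ b) (hb : b ≤ 1) :
    ∫ t in a..b, (c + d * (ε⁻¹ * layer ε t ^ 2)) ≤ c * (b - a) + 2 * d := by
  have hlayer := mul_le_mul_of_nonneg_left (integral_layer_sq_le hε ha hab hb) (inv_pos.2 hε).le
  rw [mul_left_comm, inv_mul_cancel₀ hε.ne', mul_one] at hlayer
  rw [integral_add_mul_layer_sq]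
  linarith [mul_le_mul_of_nonneg_left hlayer hd]

theorem integral_add_mul_layer_sq_le_of_le_half {c d τ : ℝ} (hε : 0 < ε) (hc : 0 ≤ c) (hd : 0 ≤ d)
    (hτ : 0 ≤ τ) (hτ' : τ ≤ 1 / 2) :
    ∫ t in τ..(1 - τ), (c + d * (ε⁻¹ * layer ε t ^ 2)) ≤ c + 2 * d * Real.exp (-τ / ε) ^ 2 := by
  have hlayer := mul_le_mul_of_nonneg_left (integral_layer_sq_le_of_le_half hε hτ')
    (inv_pos.2 hε).le
  rw [mul_assoc 2, mul_left_comm, ← mul_assoc ε⁻¹, inv_mul_cancel₀ hε.ne', one_mul] at hlayer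
  rw [integral_add_mul_layer_sq]
  nlinarith [mul_le_mul_of_nonneg_left hlayer hd, mul_nonneg hc hτ]

end LayerIntegrals

section Estimate

variable {p n : ℕ} {σ ε τ lam B : ℝ} {u ureg ubl v vreg vbl : ℝ → ℝ}

theorem sum_integral_residual_le {K : ℝ} (h : MeshParameters n τ) (hp : 3 ≤ p) (hε : 0 < ε)
    (hε1 : ε ≤ 1) (hK : 0 ≤ K)
    (hinv : ∀ F : ℝ[X], F.natDegree ≤ p → ∀ a b : ℝ, a < b →
      (b - a) ^ 4 * ∫ t in a..b, F.derivative.derivative.eval t ^ 2 ≤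
        K * ∫ t in a..b, F.eval t ^ 2)
    (hu : DiffUpTo 3 u) (hureg : DiffUpTo 3 ureg) (hv : DiffUpTo 3 v) (hvreg : DiffUpTo 3 vreg)
    (hvu : EqOn v (fun t => ε ^ (3 / 2 : ℝ) * D 2 u t) (Icc 0 1))
    (hvu₂ : EqOn (D 2 v) (fun t => ε ^ (3 / 2 : ℝ) * D 4 u t) (Icc 0 1)) (ubl vbl : ℝ → ℝ)
    {E F : ℕ → ℝ[X]} (hE : ∀ i < 4 * n, (E i).natDegree ≤ p)
    (hF : ∀ i < 4 * n, (F i).natDegree ≤ p) :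
    ∑ i ∈ Finset.range (4 * n), ∫ t in node τ (4 * n) i..node τ (4 * n) (i + 1),
        (bilinDensity lam ε (specialPoly p n τ u ureg ubl i) (specialPoly p n τ v vreg vbl i)
          (E i) (F i) t - loadDensity ε u (E i) (F i) t) ≤
      1 / 2 * (∑ i ∈ Finset.range (4 * n), ∫ t in node τ (4 * n) i..node τ (4 * n) (i + 1),
        energyDensity ε (E i) (F i) t) + (7 * lam ^ 2 + 800 + (K + 1)) *
        ∑ i ∈ Finset.range (4 * n), ∫ t in node τ (4 * n) i..node τ (4 * n) (i + 1),
          errorDensity lam ε (cellWeight n ε i) (cellError p n τ u ureg ubl i)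
            (cellError p n τ v vreg vbl i) t := by
  rw [Finset.mul_sum, Finset.mul_sum, ← Finset.sum_add_distrib]
  refine Finset.sum_le_sum fun i hi => ?_
  have hi := Finset.mem_range.1 hi
  have hlt := (h.isMesh.lt i hi).le
  refine le_of_eq_of_le (intervalIntegral.integral_congr fun t ht => ?_)
    (integral_consistencyDensity_le hε hε1 (cellWeight_pos h.n_pos hε i)
      (add_pos_of_nonneg_of_pos hK one_pos) hlt (isAdmissible_cellError h hp hu hureg ubl hi)
      (isAdmissible_cellError h hp hv hvreg vbl hi) (hE i hi) (hF i hi)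
      (integral_second_sq_le_cellWeight h hε hK (hinv _ (hF i hi)) _ hi))
  rw [uIcc_of_le hlt] at ht
  have hmem := h.isMesh.cell_subset hi ht
  exact bilinDensity_specialPoly_sub_loadDensity hε (hvu hmem) (hvu₂ hmem) lam (E i) (F i)

theorem sum_integral_errorDensity_le (h : ShishkinParameters p n σ ε τ) (hB : 0 ≤ B)
    (hu : LayerSplitting p B B ε u ureg ubl)
    (hv : LayerSplitting p B ((Real.sqrt ε)⁻¹ * B) ε v vreg vbl) (lam : ℝ) :
    ∑ i ∈ Finset.range (4 * n), ∫ t in node τ (4 * n) i..node τ (4 * n) (i + 1),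
        errorDensity lam ε (cellWeight n ε i) (cellError p n τ u ureg ubl i)
          (cellError p n τ v vreg vbl i) t ≤
      10 * (2 + (lam - 4) ^ 2) * (B * fineFactor p n σ) ^ 2 +
        8 * (σ * Real.log (4 * n : ℕ)) * (B * correctionFactor p n σ) ^ 2 +
        (2 + (lam - 4) ^ 2 * coarseWeight n ε ^ 2) * (B * (2 / (4 * n : ℕ)) ^ (p + 1)) ^ 2 +
        8 * B ^ 2 * Real.exp (-τ / ε) ^ 2 := by
  have hε := h.eps_pos
  have hτ := h.mesh.tau_pos
  have hτ' := h.tau_le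
  have hp := h.three_le
  have hlayer := continuous_layer ε
  have husplit := hu.splitting (by omega)
  have hvsplit := hv.splitting (by omega)
  set A := 2 * (2 + (lam - 4) ^ 2) * (B * fineFactor p n σ) ^ 2
  set c := 4 * (ε⁻¹ * (B * correctionFactor p n σ) ^ 2) with hc
  set d := (2 + (lam - 4) ^ 2 * coarseWeight n ε ^ 2) * (B * (2 / (4 * n : ℕ)) ^ (p + 1)) ^ 2
  have hA₀ : 0 ≤ A := by positivity
  have hsum := h.mesh.sum_integral_le
    (g := fun t => A + c + A * (ε⁻¹ * layer ε t ^ 2))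
    (k := fun t => d + 4 * B ^ 2 * (ε⁻¹ * layer ε t ^ 2))
    (fun i hi => SplitError.IsAdmissible.continuousOn_errorDensity (lam := lam) (ε := ε)
      (μ := cellWeight n ε i)
      (isAdmissible_cellError h.mesh hp husplit.diff husplit.diff_reg ubl hi)
      (isAdmissible_cellError h.mesh hp hvsplit.diff hvsplit.diff_reg vbl hi))
    (by fun_prop) (by fun_prop)
    (fun i hi hfine t ht => by
      rw [cellWeight_of_fine hfine]
      linarith [errorDensity_cellError_le_of_fine h hB hu hv lam hi hfine ht])
    (fun i hi hi' t ht => by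
      rw [cellWeight_of_mem hi hi']
      exact errorDensity_cellError_le_of_coarse h.mesh (by omega) hε hB hu hv lam _ hi hi' ht)
  have hleft := integral_add_mul_layer_sq_le (c := A + c) hε hA₀ le_rfl hτ.le (by linarith)
  have hright := integral_add_mul_layer_sq_le (a := 1 - τ) (b := 1) (c := A + c) hε hA₀
    (by linarith) (by linarith) le_rfl
  have hmiddle := integral_add_mul_layer_sq_le_of_le_half (c := d) (d := 4 * B ^ 2) (τ := τ) hε
    (by positivity) (by positivity) hτ.le (by linarith)
  have hcτ : 2 * (c * τ) = 8 * (σ * Real.log (4 * n : ℕ)) * (B * correctionFactor p n σ) ^ 2 := by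
    rw [hc, ← h.tau_div_eps]
    ring
  nlinarith

/-- The constant of the consistency estimate. Its summands come, in this order, from interpolation
on the fine cells, the cubic corrections, interpolation of the regular part on the coarse cells,
and the boundary layers outside the fine regions. -/
noncomputable def consistencyConst (p : ℕ) (σ lam B : ℝ) : ℝ :=
  10 * (2 + (lam - 4) ^ 2) * (B * (Real.exp (4 * σ) * (4 * σ) ^ (p + 1))) ^ 2 +
    32 * σ * (σ + 12) ^ 2 * B ^ 2 + 3 * (B * 2 ^ (p + 1)) ^ 2 + 8 * B ^ 2

/-- The convergence rate of the method, as it appears in the error estimate. -/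
noncomputable def convergenceRate (p n : ℕ) (ε lam : ℝ) : ℝ :=
  (Real.log (4 * n : ℕ) ^ (p + 1) + |lam - 4| * coarseWeight n ε) * (((4 * n : ℕ) : ℝ) ^ (p + 1))⁻¹

theorem sum_integral_errorDensity_le_rate (h : ShishkinParameters p n σ ε τ) (hB : 0 ≤ B)
    (hu : LayerSplitting p B B ε u ureg ubl)
    (hv : LayerSplitting p B ((Real.sqrt ε)⁻¹ * B) ε v vreg vbl) (lam : ℝ) :
    ∑ i ∈ Finset.range (4 * n), ∫ t in node τ (4 * n) i..node τ (4 * n) (i + 1),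
        errorDensity lam ε (cellWeight n ε i) (cellError p n τ u ureg ubl i)
          (cellError p n τ v vreg vbl i) t ≤
      consistencyConst p σ lam B * convergenceRate p n ε lam ^ 2 := by
  have hweight := (coarseWeight_pos h.n_pos h.eps_pos).le
  have hσ := h.sigma_pos
  have hlog := h.one_le_log
  have hexp := h.exp_neg_tau_div_eps_le
  refine (sum_integral_errorDensity_le h hB hu hv lam).trans ?_
  rw [fineFactor, correctionFactor, consistencyConst, convergenceRate, mul_pow (4 * σ), div_pow,
    div_pow, div_eq_mul_inv, div_eq_mul_inv]
  set q := (((4 * n : ℕ) : ℝ) ^ (p + 1))⁻¹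
  set m := coarseWeight n ε
  set L := Real.log (4 * n : ℕ)
  have hq : 0 ≤ q := by positivity
  have hpow : 1 ≤ L ^ (p + 1) := one_le_pow₀ hlog
  have hcube : L ^ 3 ≤ (L ^ (p + 1)) ^ 2 := by
    rw [← pow_mul]
    exact pow_le_pow_right₀ hlog (by have := h.three_le; omega)
  set a := L ^ (p + 1)
  have hrate : (a * q) ^ 2 + (lam - 4) ^ 2 * m ^ 2 * q ^ 2 ≤ ((a + |lam - 4| * m) * q) ^ 2 := by
    have : 0 ≤ 2 * a * (|lam - 4| * m) * q ^ 2 := by positivity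
    rw [← sq_abs (lam - 4)]
    linarith
  set T := (a + |lam - 4| * m) * q
  have hfine : a * q ≤ T :=
    mul_le_mul_of_nonneg_right (le_add_of_nonneg_right (by positivity)) hq
  have hqT : q ≤ T := (le_mul_of_one_le_left hq hpow).trans hfine
  have hcorr : L ^ 3 * q ^ 2 ≤ T ^ 2 := by
    refine (mul_le_mul_of_nonneg_right hcube (sq_nonneg q)).trans ?_
    rw [← mul_pow]
    gcongr
  have hcoarse : (2 + (lam - 4) ^ 2 * m ^ 2) * q ^ 2 ≤ 3 * T ^ 2 := by
    linarith [sq_nonneg (a * q), pow_le_pow_left₀ hq hqT 2]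
  calc _ = 10 * (2 + (lam - 4) ^ 2) * (B * (Real.exp (4 * σ) * (4 * σ) ^ (p + 1))) ^ 2 *
          (a * q) ^ 2 + 32 * σ * (σ + 12) ^ 2 * B ^ 2 * (L ^ 3 * q ^ 2) +
          (B * 2 ^ (p + 1)) ^ 2 * ((2 + (lam - 4) ^ 2 * m ^ 2) * q ^ 2) +
          8 * B ^ 2 * Real.exp (-τ / ε) ^ 2 := by ring
    _ ≤ 10 * (2 + (lam - 4) ^ 2) * (B * (Real.exp (4 * σ) * (4 * σ) ^ (p + 1))) ^ 2 * T ^ 2 +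
          32 * σ * (σ + 12) ^ 2 * B ^ 2 * T ^ 2 + (B * 2 ^ (p + 1)) ^ 2 * (3 * T ^ 2) +
          8 * B ^ 2 * T ^ 2 := by
        gcongr
        exact hexp.trans hqT
    _ = _ := by ring

end Estimate

/-! ### The error of the finite element method -/

section Decomposition

variable {p k K : ℕ} {ε M t : ℝ} {f u ureg ubl₀ ubl₁ : ℝ → ℝ}

namespace IsDecomp

theorem nonneg (hd : IsDecomp K M ε f u ureg ubl₀ ubl₁) : 0 ≤ M :=
  (abs_nonneg _).trans (hd.bound_reg 0 K.zero_le 0 (left_mem_Icc.2 zero_le_one))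

theorem diffUpTo_bl (hd : IsDecomp K M ε f u ureg ubl₀ ubl₁) : DiffUpTo K (ubl₀ + ubl₁) :=
  hd.diff_bl₀.add hd.diff_bl₁

theorem eqOn_add (hd : IsDecomp K M ε f u ureg ubl₀ ubl₁) :
    EqOn u (ureg + (ubl₀ + ubl₁)) (Icc 0 1) := fun t ht => by
  rw [hd.sum t ht]
  simp only [Pi.add_apply]
  ring

theorem diffUpTo (hd : IsDecomp K M ε f u ureg ubl₀ ubl₁) : DiffUpTo K u :=
  (hd.diff_reg.add hd.diffUpTo_bl).congr hd.eqOn_add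

theorem D_eq (hd : IsDecomp K M ε f u ureg ubl₀ ubl₁) (hk : k ≤ K) (ht : t ∈ Icc (0 : ℝ) 1) :
    D k u t = D k ureg t + D k (ubl₀ + ubl₁) t := by
  rw [D_congr hd.eqOn_add k ht, D_add hd.diff_reg hd.diffUpTo_bl hk ht]

theorem bound_bl (hd : IsDecomp K M ε f u ureg ubl₀ ubl₁) (hk : k ≤ K)
    (ht : t ∈ Icc (0 : ℝ) 1) : |D k (ubl₀ + ubl₁) t| ≤ M * ((ε ^ k)⁻¹ * layer ε t) := by
  rw [D_add hd.diff_bl₀ hd.diff_bl₁ hk ht, layer, mul_add, mul_add]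
  exact (abs_add_le _ _).trans (add_le_add (hd.bound_bl₀ k hk t ht) (hd.bound_bl₁ k hk t ht))

theorem layerSplitting (hd : IsDecomp (p + 1) M ε f u ureg ubl₀ ubl₁) :
    LayerSplitting p M M ε u ureg (ubl₀ + ubl₁) where
  diff := hd.diffUpTo
  diff_reg := hd.diff_reg
  sum _ hk _ ht := hd.D_eq hk ht
  bound_reg t ht := hd.bound_reg (p + 1) le_rfl t ht
  bound_bl _ hk _ ht := hd.bound_bl hk ht

theorem mono {L : ℕ} (hd : IsDecomp K M ε f u ureg ubl₀ ubl₁) (hL : L ≤ K) :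
    IsDecomp L M ε f u ureg ubl₀ ubl₁ :=
  { hd with
    diff_reg := hd.diff_reg.mono hL
    diff_bl₀ := hd.diff_bl₀.mono hL
    diff_bl₁ := hd.diff_bl₁.mono hL
    bound_reg := fun k hk => hd.bound_reg k (hk.trans hL)
    bound_bl₀ := fun k hk => hd.bound_bl₀ k (hk.trans hL)
    bound_bl₁ := fun k hk => hd.bound_bl₁ k (hk.trans hL) }

theorem layerSplitting_scaledSecond (hd : IsDecomp (p + 3) M ε f u ureg ubl₀ ubl₁)
    (hε : 0 < ε) (hε1 : ε ≤ 1) :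
    LayerSplitting p M ((Real.sqrt ε)⁻¹ * M) ε (scaledSecond ε u) (scaledSecond ε ureg)
      (scaledSecond ε (ubl₀ + ubl₁)) where
  diff := hd.diffUpTo.scaledSecond ε
  diff_reg := hd.diff_reg.scaledSecond ε
  sum k hk t ht := by
    rw [Pi.add_apply, D_scaledSecond hd.diffUpTo ε hk ht, D_scaledSecond hd.diff_reg ε hk ht,
      D_scaledSecond hd.diffUpTo_bl ε hk ht, hd.D_eq (by omega) ht, mul_add]
  bound_reg t ht := by
    rw [D_scaledSecond hd.diff_reg ε le_rfl ht, abs_mul, abs_of_nonneg (by positivity)]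
    exact (mul_le_of_le_one_left (abs_nonneg _)
      (Real.rpow_le_one hε.le hε1 (by norm_num))).trans (hd.bound_reg _ le_rfl t ht)
  bound_bl k hk t ht := by
    have hpow : Real.sqrt ε ^ 3 * (ε ^ (k + 2))⁻¹ = (Real.sqrt ε)⁻¹ * (ε ^ k)⁻¹ := by
      have := Real.sqrt_pos.2 hε
      have hsq : ε ^ 2 = Real.sqrt ε ^ 4 := by rw [pow_mul _ 2 2, Real.sq_sqrt hε.le]
      rw [pow_add, hsq]
      field_simp
    rw [D_scaledSecond hd.diffUpTo_bl ε hk ht, abs_mul, abs_of_nonneg (by positivity),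
      rpow_three_halves hε.le]
    calc Real.sqrt ε ^ 3 * |D (k + 2) (ubl₀ + ubl₁) t|
        ≤ Real.sqrt ε ^ 3 * (M * ((ε ^ (k + 2))⁻¹ * layer ε t)) := by
          gcongr
          exact hd.bound_bl (by omega) ht
      _ = _ := by linear_combination (M * layer ε t) * hpow

end IsDecomp

end Decomposition

section Supercloseness

variable {p n : ℕ} {ε τ lam : ℝ} {f u ureg ubl vreg vbl uh vh s t : ℝ → ℝ}

theorem Clamped.sub (hs : Clamped s) (ht : Clamped t) (hds : DifferentiableOn ℝ s (Icc 0 1))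
    (hdt : DifferentiableOn ℝ t (Icc 0 1)) : Clamped (s - t) := by
  have hslope {r : ℝ} (hr : r ∈ Icc (0 : ℝ) 1) : D 1 (s - t) r = D 1 s r - D 1 t r := by
    simp only [iteratedDerivWithin_one]
    exact derivWithin_sub (hds r hr) (hdt r hr)
  refine ⟨?_, ?_, ?_, ?_⟩
  · rw [Pi.sub_apply, hs.value_zero, ht.value_zero, sub_zero]
  · rw [hslope (left_mem_Icc.2 zero_le_one), hs.slope_zero, ht.slope_zero, sub_zero]
  · rw [Pi.sub_apply, hs.value_one, ht.value_one, sub_zero]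
  · rw [hslope (right_mem_Icc.2 zero_le_one), hs.slope_one, ht.slope_one, sub_zero]

theorem HasPieces.sub {x : ℕ → ℝ} {N : ℕ} {P Q : ℕ → ℝ[X]} (hP : HasPieces x N s P)
    (hQ : HasPieces x N t Q) (hx : IsMesh x N) (hs : IsSpline p 1 x N s)
    (ht : IsSpline p 1 x N t) : HasPieces x N (s - t) (P - Q) :=
  (hs.sub ht).hasPieces hx fun i hi r hr => by
    have hr := Ioo_subset_Icc_self hr
    simp only [Pi.sub_apply, eval_sub, hP.value i hi hr, hQ.value i hi hr]

theorem balancedNorm_special_sub_le_sqrt {K : ℝ} (h : MeshParameters n τ) (hp : 3 ≤ p)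
    (hlam : 3 ≤ lam) (hε : 0 < ε) (hε1 : ε ≤ 1) (hK : 0 ≤ K)
    (hinv : ∀ F : ℝ[X], F.natDegree ≤ p → ∀ a b : ℝ, a < b →
      (b - a) ^ 4 * ∫ t in a..b, F.derivative.derivative.eval t ^ 2 ≤
        K * ∫ t in a..b, F.eval t ^ 2)
    (hsol : IsSolution ε f u) (hu₅ : DiffUpTo 5 u) (hu : Splitting u ureg ubl)
    (hv : Splitting (scaledSecond ε u) vreg vbl)
    (hfem : IsFEMSolution p (node τ (4 * n)) (4 * n) lam ε f (uh, vh)) :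
    balancedNorm ε (special p (node τ (4 * n)) (4 * n) τ u ureg ubl - uh,
        special p (node τ (4 * n)) (4 * n) τ (scaledSecond ε u) vreg vbl - vh) ≤
      Real.sqrt (2 * (7 * lam ^ 2 + 800 + (K + 1)) *
        ∑ i ∈ Finset.range (4 * n), ∫ t in node τ (4 * n) i..node τ (4 * n) (i + 1),
          errorDensity lam ε (cellWeight n ε i) (cellError p n τ u ureg ubl i)
            (cellError p n τ (scaledSecond ε u) vreg vbl i) t) := by
  have hx := h.isMesh
  have hus := hu.isSpline_special h hp
  have hvs := hv.isSpline_special h hp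
  obtain ⟨huh, hvh, huh₀, hvh₂⟩ := hfem.1
  dsimp only at huh hvh huh₀ hvh₂
  obtain ⟨Uh, hdegU, hUh⟩ := huh.exists_hasPieces hx
  obtain ⟨Vh, hdegV, hVh⟩ := hvh.exists_hasPieces hx
  have hE := (hu.hasPieces_special h hp).sub hUh hx hus huh
  have hF := (hv.hasPieces_special h hp).sub hVh hx hvs hvh
  have hcl := (hu.clamped_special h hp hsol.clamped).sub huh₀.toClamped (hus.memH2 hx).diff
    huh₀.diff
  have hcoercive := sum_integral_energyDensity_le hx hlam hε.le hε1 hE hF hcl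
  have horth := galerkin_orthogonality hx hsol hu₅ hfem ⟨hus.sub huh, hvs.sub hvh,
    ⟨(hus.sub huh).memH2 hx, hcl⟩, (hvs.sub hvh).memH2 hx⟩ hUh hVh hE hF
    (specialPoly p n τ u ureg ubl) (specialPoly p n τ (scaledSecond ε u) vreg vbl)
  have hresidual := sum_integral_residual_le (lam := lam) h hp hε hε1 hK hinv hu.diff hu.diff_reg
    hv.diff hv.diff_reg (fun _ _ => rfl) (fun _ ht => D_scaledSecond hu₅ ε (by omega) ht) ubl vbl
    (fun i hi => (natDegree_sub_le _ _).trans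
      (max_le (hu.natDegree_specialPoly_le h hp hi) (hdegU i)))
    (fun i hi => (natDegree_sub_le _ _).trans
      (max_le (hv.natDegree_specialPoly_le h hp hi) (hdegV i)))
  rw [balancedNorm_eq_sqrt_sum hx ε hE hF]
  refine Real.sqrt_le_sqrt ?_
  simp only [Pi.sub_apply] at hcoercive hresidual horth ⊢
  linarith

end Supercloseness

theorem convergenceRate_nonneg {n : ℕ} {ε : ℝ} (hn : 0 < n) (hε : 0 < ε) (p : ℕ) (lam : ℝ) :
    0 ≤ convergenceRate p n ε lam := by
  have hweight := coarseWeight_pos hn hε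
  have : 0 ≤ Real.log (4 * n : ℕ) := Real.log_natCast_nonneg _
  rw [convergenceRate]
  positivity

end ThinShell

theorem mainTheorem3 (p : ℕ) (hp : 3 ≤ p) (σ : ℝ) (hσ : (p : ℝ) + 1 ≤ σ)
    (lam : ℝ) (hlam : 3 ≤ lam) (M : ℝ) :
    ∃ C : ℝ, 0 < C ∧
      ∀ (ε : ℝ) (N : ℕ) (f u ureg ubl₀ ubl₁ uh vh : ℝ → ℝ) (τ : ℝ) (x : ℕ → ℝ),
        0 < ε → ε ≤ 1 → 0 < N → 4 ∣ N →
        σ * ε * Real.log N ≤ 1 / 4 →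
        τ = transition σ ε N → x = node τ N →
        MemL2 f → IsSolution ε f u →
        IsDecomp (p + 3) M ε f u ureg ubl₀ ubl₁ →
        IsFEMSolution p x N lam ε f (uh, vh) →
        balancedNorm ε
            (uTilde p x N τ u ureg ubl₀ ubl₁ - uh, vTilde p x N τ ε u ureg ubl₀ ubl₁ - vh) ≤
          C * ((Real.log N ^ (p + 1) +
              |lam - 4| * min (ε ^ (3 / 2 : ℝ) * (N : ℝ) ^ 2) (ε ^ (-(1 / 2) : ℝ))) *
            ((N : ℝ) ^ (p + 1))⁻¹) := by
  obtain ⟨K, hK, hinv⟩ := exists_inverse_inequality p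
  set c := 2 * (7 * lam ^ 2 + 800 + (K + 1))
  refine ⟨Real.sqrt (c * consistencyConst p σ lam M) + 1, by positivity, ?_⟩
  rintro ε N f u ureg ubl₀ ubl₁ uh vh τ x hε hε1 hN ⟨n, rfl⟩ hτ rfl rfl - hsol hd hfem
  have h : ShishkinParameters p n σ ε (transition σ ε (4 * n)) :=
    ⟨hp, by omega, hσ, hε, hε1, min_eq_right hτ, min_le_left _ _⟩
  have hu := (hd.mono (by omega)).layerSplitting (p := p)
  have hv := hd.layerSplitting_scaledSecond hε hε1
  have hrate := convergenceRate_nonneg h.n_pos hε p lam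
  calc _ ≤ Real.sqrt (c * ∑ i ∈ Finset.range (4 * n), _) :=
        balancedNorm_special_sub_le_sqrt h.mesh hp hlam hε hε1 hK.le hinv hsol
          (hd.diffUpTo.mono (by omega)) (hu.splitting (by omega)) (hv.splitting (by omega)) hfem
    _ ≤ Real.sqrt (c * (consistencyConst p σ lam M * convergenceRate p n ε lam ^ 2)) :=
        Real.sqrt_le_sqrt (mul_le_mul_of_nonneg_left
          (sum_integral_errorDensity_le_rate h hd.nonneg hu hv lam) (by positivity))
    _ = Real.sqrt (c * consistencyConst p σ lam M) * convergenceRate p n ε lam := by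
        rw [← mul_assoc, Real.sqrt_mul' _ (sq_nonneg _), Real.sqrt_sq hrate]
    _ ≤ _ := mul_le_mul_of_nonneg_right (le_add_of_nonneg_right zero_le_one) hrate
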